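/- Let $p\in(0,1]$ and let $\xi\ge0$ be a random variable with $\mathbb P(\xi=0)<1$ and $\xi\in L^\alpha(\mathbb P)$ for some $\alpha>1$. Write $m_\gamma=\mathbb E[\xi^\gamma]$ and $\Lambda_0=\{\gamma>1:\ m_\gamma<\gamma m_1\}$. Let $(\varepsilon_n)_{n\ge2}$, $(\xi_n)_{n\ge2}$, $(U_n)_{n\ge2}$ be mutually independent random variables with $\varepsilon_n\sim$ Bernoulli$(p)$, $\xi_n\overset{d}{=}\xi$ and $U_n$ uniform on $\{1,\dots,n-1\}$. Consider the random recursive tree with vertices $1,2,\dots$ in which $U_n$ is the parent of $n$, and remove the edge between $n$ and $U_n$ when $\varepsilon_n=0$. Define vertex weights by $\omega(1)=1$ and $\omega(n)=(1-\varepsilon_n)+\varepsilon_n\xi_n\,\omega(U_n)$ for $n\ge2$. For $r\ge 1$ let $T_r(n)$ be the set of vertices $i\le n$ of the connected component, after this removal, whose vertex closest to the original root is $r$ ($T_r(n)=\emptyset$ if $r\geq 2$ and $\varepsilon_r=1$, or if $r>n$), and let $\|T_r(n)\|=\sum_{i\in T_r(n)}\omega(i)$. For an echo variable $\eta$, let $\mathcal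 L^{(\eta)}$ denote the almost sure (integrable) limit of $n^{-\mathbb E\eta}\sum_{i=1}^n\omega(i)$ in the above model with $p=1$ and with echo variables distributed as $\eta$. Let $\varepsilon\xi$ be the product of independent $\varepsilon\sim$ Bernoulli$(p)$ and $\xi$. Then there are integrable random variables $(L_r)_{r\ge1}$ such that for every $r\ge1$ $$\lim_{n\to\infty}\frac{\|T_r(n)\|}{n^{pm_1}}=L_r\quad\text{almost surely.}$$ The limit $\mathcal L^{(\varepsilon\xi)}$ exists almost surely and is integrable, and $$L_1\overset{d}{=}\mathcal L^{(\varepsilon\xi)},\qquad L_r\overset{d}{=}(1-\varepsilon_r)\,\mathcal L^{(\varepsilon\xi)}\,\beta_r^{pm_1}\quad(r\ge2),$$ where on the right-hand side $\varepsilon_r\sim$ Bernoulli$(p)$, $\mathcal L^{(\varepsilon\xi)}$ and $\beta_r\sim$ Beta$(1,r-1)$ are mutually independent. Furthermore (with $0\log0=0$): (i) If $\mathbb E[\xi\log\xi]<m_1$, then for every $r\ge1$ and every $\gamma\in\Lambda_0$ the convergence $\|T_r(n)\|/n^{pm_1}\to L_r$ also holds in $L^\gamma(\mathbb P)$, and for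 every $r\ge1$ $$\mathbb E L_r=(1-p\mathbf 1_{\{r>1\}})\frac{(r-1)!}{\Gamma(r+pm_1)}.$$ If moreover $p<1$, then each $L_r$, $r\ge1$, is non-degenerate (not almost surely constant); if $p=1$ and $\mathbb P(\xi=1)<1$, then $L_1$ is non-degenerate. (ii) If $\mathbb E[\xi\log\xi]\ge m_1$, then $L_r=0$ almost surely for every $r\ge1$. -/

import Mathlib

open MeasureTheory ProbabilityTheory Filter Topology

/-- The random inputs of the percolated and weighted random recursive tree with vertices `1, 2, …`:
`ε n ∈ {0, 1}` says whether the edge above vertex `n` is kept (probability `p`), `ξ n` is the weight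
(echo variable, law `ν`) of that edge, and `U n`, uniform on `{1, …, n - 1}`, is the parent of `n`
(`n ≥ 2`). For each `n ≥ 2` the three variables are independent with these laws, and the triples for
different `n ≥ 2` are independent, so that all the variables are mutually independent. -/
structure IsEchoModel {Ω : Type*} [MeasurableSpace Ω] (p : unitInterval) (ν : Measure ℝ)
    (ε ξ : ℕ → Ω → ℝ) (U : ℕ → Ω → ℕ) (μ : Measure Ω) : Prop where
  law : ∀ n : ℕ, 2 ≤ n → HasLaw (fun ω => (ε n ω, ξ n ω, U n ω))
    ((bernoulliMeasure (1 : ℝ) 0 p).prod (ν.prod (uniformOn (Set.Icc 1 (n - 1))))) μ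
  indep : iIndepFun (fun (n : Set.Ici (2 : ℕ)) ω => (ε n ω, ξ n ω, U n ω)) μ

/-- The weight of a vertex: `1` for vertex `1`, and `(1 - e n) + e n * x n * (weight of the parent)`
for a vertex `n ≥ 2`. (The test `u n < n` is always met by a parent function.) -/
noncomputable def vertexWeight (e x : ℕ → ℝ) (u : ℕ → ℕ) (n : ℕ) : ℝ :=
  if _h : 2 ≤ n ∧ u n < n then (1 - e n) + e n * x n * vertexWeight e x u (u n) else 1
termination_by n
decreasing_by exact _h.2

/-- The root of the percolation subtree that contains the vertex `n`: starting from `n`, follow the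
edges to the parents until one meets vertex `1` or a vertex whose edge to its parent was removed
(`e = 0`). -/
noncomputable def subtreeRoot (e : ℕ → ℝ) (u : ℕ → ℕ) (n : ℕ) : ℕ :=
  if _h : 2 ≤ n ∧ u n < n ∧ e n ≠ 0 then subtreeRoot e u (u n) else n
termination_by n
decreasing_by exact _h.2.1

/-- The vertices of the percolation subtree `T_r(n)` rooted at `r`, at time `n`
(empty if `r` is not the root of a percolation subtree, or if `r > n`). -/
noncomputable def subtree (e : ℕ → ℝ) (u : ℕ → ℕ) (r n : ℕ) : Finset ℕ :=
  (Finset.Icc 1 n).filter (fun i => subtreeRoot e u i = r)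

/-- The weight `‖T_r(n)‖` of the percolation subtree rooted at `r`, at time `n`. -/
noncomputable def subtreeWeight (e x : ℕ → ℝ) (u : ℕ → ℕ) (r n : ℕ) : ℝ :=
  ∑ i ∈ subtree e u r n, vertexWeight e x u i

/-- The weight of the whole tree at time `n`. In the pure echoing case (`e n = 1` for all `n`) it is
`‖𝕋(n)‖`, the position at time `n` of the walk with echoed steps that starts with a step `1`. -/
noncomputable def treeWeight (e x : ℕ → ℝ) (u : ℕ → ℕ) (n : ℕ) : ℝ :=
  ∑ i ∈ Finset.Icc 1 n, vertexWeight e x u i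

/-- The moment `m_q = 𝔼 ξ^q` of the echo law. -/
noncomputable def echoMoment (ν : Measure ℝ) (q : ℝ) : ℝ := ∫ x, x ^ q ∂ν

/-- The law of the product `ε ξ`, with `ε ∼ Bernoulli(p)` and `ξ ∼ ν` independent. -/
noncomputable def thinnedEchoLaw (p : unitInterval) (ν : Measure ℝ) : Measure ℝ :=
  ((bernoulliMeasure (1 : ℝ) 0 p).prod ν).map (fun q => q.1 * q.2)

theorem vertexWeight_one (e x : ℕ → ℝ) (u : ℕ → ℕ) : vertexWeight e x u 1 = 1 := by
  rw [vertexWeight]; simp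

theorem vertexWeight_of_two_le (e x : ℕ → ℝ) (u : ℕ → ℕ) (n : ℕ) (hn : 2 ≤ n) (hu : u n < n) :
    vertexWeight e x u n = (1 - e n) + e n * x n * vertexWeight e x u (u n) := by
  rw [vertexWeight]; simp [hn, hu]

/-! Removing an edge has the same effect as giving it the echo `0`. Let a unit mass start at `r` and
be multiplied by `ε_n ξ_n` along every later edge: it lives exactly on the subtree rooted at `r`. So
`‖T_r(n)‖` is a `flowSum` started at `r`, times the indicator that `r` is a root
(`subtreeWeight_eq_flowSum`). Percolation thus disappears, and one works with the single echo law of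
`ε ξ`, of mean `m = p m_1`. The passage from `ξ` to `ε ξ` multiplies the moments `m_γ`, `γ > 0`, and
`𝔼[ξ log ξ]` by `p`, so the conditions of the theorem do not change.

Given the past, vertex `n + 1` has expected weight `m / n` times the current total. Hence the total
divided by `Γ(n + m) / Γ(n) ∼ n ^ m` is a nonnegative martingale, and it converges almost surely. If
`m_q < q m_1` for some `q > 1`, it is bounded in `L^q`: in the expansion of the `q`-th power of the
total the main term grows like `n ^ (q m)`, and the corrections, governed by the sum of the `q`-th
powers of the weights, grow more slowly. The martingale then converges in `L^q` and keeps its mean.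
Such a `q` exists when `𝔼[ξ log ξ] < m_1`, because `𝔼[ξ log ξ]` is the derivative of `q ↦ m_q` at
`1`.

The descendants of `r`, given their number `k`, carry the weights of the first `k` vertices of a
whole tree (`IsGrowth.lintegral_population`). Their number is a Pólya urn, with limiting proportion
`β` of law `Beta(1, r - 1)`. So the limit at `r` has the law of `Z β ^ m`, where `Z`, the limit for
a whole tree, is independent of `β`.

Splitting the tree between the vertices `1` and `2` gives the smoothing equation `L = A + T B`,
where `T` has the echo law and is independent of `B`, and where `A` and `B` both have the law of `Z
β ^ m` with `β` uniform. A comparison of moments of order `q < 1`, with a sharpened subadditivity of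
`t ↦ t ^ q`, shows that `m_q - q m_1` is at least a positive multiple of `1 - q` unless `L = 0`. If
`𝔼[ξ log ξ] ≥ m_1`, the derivative at `1` forbids this (`ae_eq_zero_of_smoothing`).

For non-degeneracy, a constant limit makes the whole closed martingale constant, and the first three
vertices already force all echoes to be `1`. -/

/-! ### Deterministic flows of mass along a recursive tree -/

/-- Masses carried along a recursive tree: the vertices `n ≤ r` carry the prescribed masses `a n`,
and every vertex `n > r` carries `(x n).1` times the mass of its parent `(x n).2`. -/
noncomputable def flow (x : ℕ → ℝ × ℕ) (a : ℕ → ℝ) (r n : ℕ) : ℝ :=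
  if _h : r < n ∧ (x n).2 < n then (x n).1 * flow x a r (x n).2 else a n
termination_by n
decreasing_by exact _h.2

/-- The total mass of the vertices `1, …, n`. -/
noncomputable def flowSum (x : ℕ → ℝ × ℕ) (a : ℕ → ℝ) (r n : ℕ) : ℝ :=
  ∑ i ∈ Finset.Icc 1 n, flow x a r i

/-- The second components of `x` are the parents in a recursive tree with vertices `1, 2, …`. -/
def IsRecursive (x : ℕ → ℝ × ℕ) : Prop := ∀ n, 2 ≤ n → 1 ≤ (x n).2 ∧ (x n).2 < n

theorem flow_of_le (x : ℕ → ℝ × ℕ) (a : ℕ → ℝ) {r n : ℕ} (h : n ≤ r) : flow x a r n = a n := by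
  rw [flow, dif_neg (by omega)]

theorem flow_of_lt {x : ℕ → ℝ × ℕ} (hx : IsRecursive x) (a : ℕ → ℝ) {r n : ℕ} (hr : 1 ≤ r)
    (h : r < n) : flow x a r n = (x n).1 * flow x a r (x n).2 := by
  rw [flow, dif_pos ⟨h, (hx n (by omega)).2⟩]

theorem flow_congr_of_lt {x y : ℕ → ℝ × ℕ} (a : ℕ → ℝ) {r n : ℕ}
    (h : ∀ j, r < j → j ≤ n → x j = y j) : flow x a r n = flow y a r n := by
  induction n using Nat.strong_induction_on with
  | _ n ih =>
    by_cases hn : r < n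
    · conv_lhs => rw [flow]
      conv_rhs => rw [flow]
      rw [← h n hn le_rfl]
      split_ifs with h1
      · rw [ih _ h1.2 fun j h2 h3 => h j h2 (h3.trans h1.2.le)]
      · rfl
    · rw [flow_of_le _ _ (by omega), flow_of_le _ _ (by omega)]

theorem flow_congr {x y : ℕ → ℝ × ℕ} (a : ℕ → ℝ) {r : ℕ} (hr : 1 ≤ r) {n : ℕ}
    (h : ∀ j, 2 ≤ j → j ≤ n → x j = y j) : flow x a r n = flow y a r n :=
  flow_congr_of_lt a fun j h1 h2 => h j (by omega) h2

theorem flowSum_congr_of_lt {x y : ℕ → ℝ × ℕ} (a : ℕ → ℝ) {r n : ℕ}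
    (h : ∀ j, r < j → j ≤ n → x j = y j) : flowSum x a r n = flowSum y a r n :=
  Finset.sum_congr rfl fun _ hi => flow_congr_of_lt a fun j h2 h3 =>
    h j h2 (h3.trans (Finset.mem_Icc.1 hi).2)

theorem flowSum_congr {x y : ℕ → ℝ × ℕ} (a : ℕ → ℝ) {r : ℕ} (hr : 1 ≤ r) {n : ℕ}
    (h : ∀ j, 2 ≤ j → j ≤ n → x j = y j) : flowSum x a r n = flowSum y a r n :=
  flowSum_congr_of_lt a fun j h1 h2 => h j (by omega) h2

theorem flow_nonneg {x : ℕ → ℝ × ℕ} {a : ℕ → ℝ} (hx : ∀ n, 2 ≤ n → 0 ≤ (x n).1)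
    (ha : ∀ n, 0 ≤ a n) {r : ℕ} (hr : 1 ≤ r) (n : ℕ) : 0 ≤ flow x a r n := by
  induction n using Nat.strong_induction_on with
  | _ n ih =>
    rw [flow]
    split_ifs with h
    · exact mul_nonneg (hx n (by omega)) (ih _ h.2)
    · exact ha n

theorem flowSum_nonneg {x : ℕ → ℝ × ℕ} {a : ℕ → ℝ} (hx : ∀ n, 2 ≤ n → 0 ≤ (x n).1)
    (ha : ∀ n, 0 ≤ a n) {r : ℕ} (hr : 1 ≤ r) (n : ℕ) : 0 ≤ flowSum x a r n :=
  Finset.sum_nonneg fun i _ => flow_nonneg hx ha hr i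

theorem flowSum_succ (x : ℕ → ℝ × ℕ) (a : ℕ → ℝ) (r n : ℕ) :
    flowSum x a r (n + 1) = flowSum x a r n + flow x a r (n + 1) := by
  rw [flowSum, Finset.sum_Icc_succ_top (by omega)]; rfl

theorem flowSum_single (x : ℕ → ℝ × ℕ) {i r : ℕ} (hi : 1 ≤ i) (hir : i ≤ r) :
    flowSum x (Pi.single i 1) r r = 1 := by
  rw [flowSum, Finset.sum_congr rfl fun j hj => flow_of_le x (Pi.single i 1) (Finset.mem_Icc.1 hj).2]
  simp [Pi.single_apply, hi, hir]

theorem flow_single_mem_zero_one {x : ℕ → ℝ × ℕ} (hx : ∀ n, 2 ≤ n → (x n).1 = 1) (i : ℕ) {r : ℕ}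
    (hr : 1 ≤ r) (n : ℕ) :
    flow x (Pi.single i 1) r n = 0 ∨ flow x (Pi.single i 1) r n = 1 := by
  induction n using Nat.strong_induction_on with
  | _ n ih =>
    rw [flow]
    split_ifs with h
    · rw [hx n (by omega), one_mul]; exact ih _ h.2
    · by_cases hni : n = i
      · subst hni; simp
      · simp [hni]

/-- Vertex `2` is always a child of vertex `1`, so every vertex descends either from `2` or from `1`
without passing through `2`. This splitting becomes the smoothing equation in the limit. -/
theorem flow_eq_add {x : ℕ → ℝ × ℕ} (hx : IsRecursive x) {n : ℕ} (hn : 1 ≤ n) :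
    flow x (Pi.single 1 1) 1 n
      = flow x (Pi.single 1 1) 2 n + (x 2).1 * flow x (Pi.single 2 1) 2 n := by
  induction n using Nat.strong_induction_on with
  | _ n ih =>
    rcases lt_trichotomy n 2 with h | h | h
    · obtain rfl : n = 1 := by omega
      rw [flow_of_le _ _ le_rfl, flow_of_le _ _ (by omega), flow_of_le _ _ (by omega)]
      simp
    · subst h
      have h2 : (x 2).2 = 1 := by have := hx 2 le_rfl; omega
      rw [flow_of_lt hx _ le_rfl (by omega), h2, flow_of_le _ _ le_rfl, flow_of_le _ _ le_rfl,
        flow_of_le _ _ le_rfl]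
      simp
    · have h3 := hx n (by omega)
      rw [flow_of_lt hx _ le_rfl (by omega), flow_of_lt hx _ (by omega) h,
        flow_of_lt hx _ (by omega) h, ih _ h3.2 h3.1]
      ring

theorem flowSum_eq_add {x : ℕ → ℝ × ℕ} (hx : IsRecursive x) (n : ℕ) :
    flowSum x (Pi.single 1 1) 1 n
      = flowSum x (Pi.single 1 1) 2 n + (x 2).1 * flowSum x (Pi.single 2 1) 2 n := by
  rw [flowSum, flowSum, flowSum, Finset.mul_sum, ← Finset.sum_add_distrib]
  exact Finset.sum_congr rfl fun i hi => flow_eq_add hx (Finset.mem_Icc.1 hi).1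

theorem measurable_flow (a : ℕ → ℝ) (r n : ℕ) :
    Measurable fun x : ℕ → ℝ × ℕ => flow x a r n := by
  induction n using Nat.strong_induction_on with
  | _ n ih =>
    -- The index of the parent depends on `x`, so the value at the parent is written as a finite sum
    -- over its possible values.
    have h : (fun x : ℕ → ℝ × ℕ => flow x a r n) = fun x => if r < n ∧ (x n).2 < n then
        (x n).1 * ∑ j ∈ Finset.range n, if (x n).2 = j then flow x a r j else 0 else a n := by
      ext x
      rw [flow, Finset.sum_ite_eq (Finset.range n)]
      split_ifs with h1 h2
      · rfl
      · exact absurd (Finset.mem_range.2 h1.2) h2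
      · rfl
    rw [h]
    have hc : Measurable fun x : ℕ → ℝ × ℕ => x n := measurable_pi_apply n
    refine Measurable.ite ?_ (hc.fst.mul (Finset.measurable_fun_sum _ fun j hj => ?_))
      measurable_const
    · exact (measurable_const.and
        (measurableSet_lt hc.snd measurable_const).mem).setOf
    · exact Measurable.ite (hc.snd (measurableSet_singleton j)) (ih j (Finset.mem_range.1 hj))
        measurable_const

theorem measurable_flowSum (a : ℕ → ℝ) (r n : ℕ) :
    Measurable fun x : ℕ → ℝ × ℕ => flowSum x a r n :=
  Finset.measurable_fun_sum _ fun i _ => measurable_flow a r i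

/-! ### Percolation subtrees as flows -/

theorem vertexWeight_congr {e e' x x' : ℕ → ℝ} {u u' : ℕ → ℕ}
    (h : ∀ n, 2 ≤ n → e n = e' n ∧ x n = x' n ∧ u n = u' n) (n : ℕ) :
    vertexWeight e x u n = vertexWeight e' x' u' n := by
  induction n using Nat.strong_induction_on with
  | _ n ih =>
    by_cases hn : 2 ≤ n
    · conv_lhs => rw [vertexWeight]
      conv_rhs => rw [vertexWeight]
      rw [← (h n hn).1, ← (h n hn).2.1, ← (h n hn).2.2]
      split_ifs with h1
      · rw [ih _ h1.2]
      · rfl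
    · conv_lhs => rw [vertexWeight, dif_neg (by tauto)]
      conv_rhs => rw [vertexWeight, dif_neg (by tauto)]

theorem subtreeRoot_congr {e e' : ℕ → ℝ} {u u' : ℕ → ℕ}
    (h : ∀ n, 2 ≤ n → e n = e' n ∧ u n = u' n) (n : ℕ) :
    subtreeRoot e u n = subtreeRoot e' u' n := by
  induction n using Nat.strong_induction_on with
  | _ n ih =>
    by_cases hn : 2 ≤ n
    · conv_lhs => rw [subtreeRoot]
      conv_rhs => rw [subtreeRoot]
      rw [← (h n hn).1, ← (h n hn).2]
      split_ifs with h1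
      · rw [ih _ h1.2.1]
      · rfl
    · conv_lhs => rw [subtreeRoot, dif_neg (by tauto)]
      conv_rhs => rw [subtreeRoot, dif_neg (by tauto)]

theorem subtreeWeight_congr {e e' x x' : ℕ → ℝ} {u u' : ℕ → ℕ}
    (h : ∀ n, 2 ≤ n → e n = e' n ∧ x n = x' n ∧ u n = u' n) (r n : ℕ) :
    subtreeWeight e x u r n = subtreeWeight e' x' u' r n := by
  simp only [subtreeWeight, subtree, vertexWeight_congr h,
    subtreeRoot_congr fun n hn => ⟨(h n hn).1, (h n hn).2.2⟩]

theorem treeWeight_congr {e e' x x' : ℕ → ℝ} {u u' : ℕ → ℕ}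
    (h : ∀ n, 2 ≤ n → e n = e' n ∧ x n = x' n ∧ u n = u' n) (n : ℕ) :
    treeWeight e x u n = treeWeight e' x' u' n := by
  simp only [treeWeight, vertexWeight_congr h]

theorem subtreeRoot_le (e : ℕ → ℝ) (u : ℕ → ℕ) (n : ℕ) : subtreeRoot e u n ≤ n := by
  induction n using Nat.strong_induction_on with
  | _ n ih =>
    rw [subtreeRoot]
    split_ifs with h
    · exact (ih _ h.2.1).trans h.2.1.le
    · exact le_rfl

theorem treeWeight_eq_flowSum {e x : ℕ → ℝ} {u : ℕ → ℕ} (he : ∀ n, 2 ≤ n → e n = 1)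
    (hu : ∀ n, 2 ≤ n → 1 ≤ u n ∧ u n < n) (n : ℕ) :
    treeWeight e x u n = flowSum (fun n => (e n * x n, u n)) (Pi.single 1 1) 1 n := by
  refine Finset.sum_congr rfl fun i hi => ?_
  replace hi := (Finset.mem_Icc.1 hi).1
  induction i using Nat.strong_induction_on with
  | _ i ih =>
    by_cases h : 2 ≤ i
    · rw [vertexWeight_of_two_le _ _ _ _ h (hu i h).2, flow_of_lt (by exact hu) _ le_rfl (by omega),
        ih _ (hu i h).2 (hu i h).1, he i h]
      ring
    · obtain rfl : i = 1 := by omega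
      rw [vertexWeight_one, flow_of_le _ _ le_rfl]; simp

/-- At a removed edge the product `e n * x n` is `0`, so the flow from `r` dies exactly where the
subtree ends. When `e r = 0` the vertex `r` itself has weight `1`, the initial mass of the flow;
when `e r = 1` and `r ≥ 2`, the subtree is empty and the prefactor vanishes. -/
theorem subtreeWeight_eq_flowSum {e x : ℕ → ℝ} {u : ℕ → ℕ}
    (he : ∀ n, 2 ≤ n → e n = 0 ∨ e n = 1) (hu : ∀ n, 2 ≤ n → 1 ≤ u n ∧ u n < n)
    {r : ℕ} (hr : 1 ≤ r) (n : ℕ) :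
    subtreeWeight e x u r n = (if r = 1 then 1 else 1 - e r) *
      flowSum (fun n => (e n * x n, u n)) (Pi.single r 1) r n := by
  rw [subtreeWeight, subtree, Finset.sum_filter, flowSum, Finset.mul_sum]
  refine Finset.sum_congr rfl fun i hi => ?_
  replace hi := (Finset.mem_Icc.1 hi).1
  induction i using Nat.strong_induction_on with
  | _ i ih =>
    rcases lt_trichotomy i r with h | h | h
    · rw [flow_of_le _ _ h.le, if_neg]
      · simp [h.ne]
      · exact ((subtreeRoot_le e u i).trans_lt h).ne
    · subst h
      rw [flow_of_le _ _ le_rfl]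
      by_cases h1 : i = 1
      · subst h1
        rw [subtreeRoot, dif_neg (by omega), vertexWeight_one]; simp
      · have h2 : 2 ≤ i := by omega
        rcases he i h2 with h3 | h3
        · rw [subtreeRoot, dif_neg (by tauto), vertexWeight_of_two_le _ _ _ _ h2 (hu i h2).2]
          simp [h1, h3]
        · rw [subtreeRoot, dif_pos ⟨h2, (hu i h2).2, by simp [h3]⟩, if_neg]
          · simp [h1, h3]
          · exact ((subtreeRoot_le e u _).trans_lt (hu i h2).2).ne
    · have h2 : 2 ≤ i := by omega
      rw [flow_of_lt (by exact hu) _ hr h]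
      have := ih _ (hu i h2).2 (hu i h2).1
      rcases he i h2 with h3 | h3
      · rw [subtreeRoot, dif_neg (by tauto), if_neg h.ne']
        simp [h3]
      · rw [subtreeRoot, dif_pos ⟨h2, (hu i h2).2, by simp [h3]⟩,
          vertexWeight_of_two_le _ _ _ _ h2 (hu i h2).2]
        simp only [h3, one_mul]
        rw [mul_left_comm, ← this]
        split_ifs <;> ring

/-! ### Independence of disjoint blocks of inputs -/

open scoped Classical in
/-- The sequence `y` with the entries outside `S` replaced by `c`. -/
noncomputable def mask {β : Type*} (S : Set ℕ) (c : β) (y : ℕ → β) (n : ℕ) : β :=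
  if n ∈ S then y n else c

theorem measurable_mask {β : Type*} [MeasurableSpace β] (S : Set ℕ) (c : β) :
    Measurable (mask S c) := by
  refine measurable_pi_iff.2 fun n => ?_
  unfold mask
  split_ifs
  · exact measurable_pi_apply n
  · exact measurable_const

/-- Each masked sequence is measurable with respect to the inputs indexed by its set. As both are
still full sequences, functionals defined on all inputs can be composed with them directly. -/
theorem indepFun_mask {Ω β : Type*} [MeasurableSpace Ω] [MeasurableSpace β] {μ : Measure Ω}
    {Y : Ω → ℕ → β} (hY : Measurable Y)
    (hind : iIndepFun (fun (n : Set.Ici (2 : ℕ)) ω => Y ω n) μ) {S T : Set ℕ}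
    (hS : S ⊆ Set.Ici 2) (hT : T ⊆ Set.Ici 2) (hST : Disjoint S T) (c : β) :
    IndepFun (fun ω => mask S c (Y ω)) (fun ω => mask T c (Y ω)) μ := by
  have hle : ∀ n : Set.Ici (2 : ℕ),
      MeasurableSpace.comap (fun ω => Y ω n) inferInstance ≤ ‹MeasurableSpace Ω› := fun n =>
    (measurable_pi_iff.1 hY n).comap_le
  have key : ∀ R : Set ℕ, R ⊆ Set.Ici 2 →
      MeasurableSpace.comap (fun ω => mask R c (Y ω)) inferInstance ≤
        ⨆ i ∈ {i : Set.Ici (2 : ℕ) | (i : ℕ) ∈ R},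
          MeasurableSpace.comap (fun ω => Y ω i) inferInstance := by
    intro R hR
    rw [← measurable_iff_comap_le]
    refine @measurable_pi_lambda _ _ _ (_) _ _ fun n => ?_
    unfold mask
    split_ifs with hn
    · rw [measurable_iff_comap_le]
      exact le_iSup₂_of_le (f := fun (i : Set.Ici (2 : ℕ)) (_ : i ∈ {i : Set.Ici (2 : ℕ) | (i : ℕ) ∈ R})
        => MeasurableSpace.comap (fun ω => Y ω i) inferInstance) ⟨n, hR hn⟩ hn le_rfl
    · exact @measurable_const _ _ (_) (_) _
  refine indep_of_indep_of_le_left (indep_of_indep_of_le_right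
    (indep_iSup_of_disjoint hle hind (S := {i | (i : ℕ) ∈ S}) (T := {i | (i : ℕ) ∈ T}) ?_)
    (key T hT)) (key S hS)
  exact Set.disjoint_left.2 fun i h1 h2 => Set.disjoint_left.1 hST h1 h2

/-! ### Random growth, one vertex at a time -/

/-- The random inputs of a growing recursive tree with echo law `ν`: the echo variable and the
parent of every vertex `n ≥ 2`. -/
structure IsGrowth {Ω : Type*} [MeasurableSpace Ω] (ν : Measure ℝ) (X : Ω → ℕ → ℝ × ℕ)
    (μ : Measure Ω) : Prop where
  measurable : Measurable X
  recursive : ∀ ω, IsRecursive (X ω)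
  nonneg : ∀ ω n, 2 ≤ n → 0 ≤ (X ω n).1
  law : ∀ n, 2 ≤ n → μ.map (fun ω => X ω n) = ν.prod (uniformOn (Set.Icc 1 (n - 1)))
  indep : iIndepFun (fun (n : Set.Ici (2 : ℕ)) ω => X ω n) μ

/-- The part of the inputs that is known at time `n`. -/
noncomputable abbrev past (n : ℕ) : (ℕ → ℝ × ℕ) → ℕ → ℝ × ℕ := mask (Set.Icc 2 n) 0

theorem past_past {m n : ℕ} (h : m ≤ n) (x : ℕ → ℝ × ℕ) : past m (past n x) = past m x := by
  funext j
  simp only [mask, Set.mem_Icc]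
  split_ifs <;> first | rfl | omega

theorem past_apply {n j : ℕ} (x : ℕ → ℝ × ℕ) (h : 2 ≤ j) (hj : j ≤ n) : past n x j = x j :=
  if_pos ⟨h, hj⟩

theorem flow_past {n j r : ℕ} (hr : 1 ≤ r) (x : ℕ → ℝ × ℕ) (a : ℕ → ℝ) (hj : j ≤ n) :
    flow (past n x) a r j = flow x a r j :=
  flow_congr a hr fun _ h h' => past_apply x h (h'.trans hj)

theorem flowSum_past {n j r : ℕ} (hr : 1 ≤ r) (x : ℕ → ℝ × ℕ) (a : ℕ → ℝ) (hj : j ≤ n) :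
    flowSum (past n x) a r j = flowSum x a r j :=
  flowSum_congr a hr fun _ h h' => past_apply x h (h'.trans hj)

theorem lintegral_uniformOn_Icc {n : ℕ} (f : ℕ → ENNReal) :
    ∫⁻ i, f i ∂(uniformOn (Set.Icc 1 n)) = (n : ENNReal)⁻¹ * ∑ i ∈ Finset.Icc 1 n, f i := by
  rw [uniformOn, ProbabilityTheory.cond, lintegral_smul_measure, smul_eq_mul]
  congr 1
  · rw [Measure.count_apply_finite _ (Set.finite_Icc 1 n)]
    simp
  · rw [← Finset.coe_Icc, lintegral_finset]
    simp

section IsGrowth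

variable {Ω : Type*} [MeasurableSpace Ω] {ν : Measure ℝ} {X : Ω → ℕ → ℝ × ℕ} {μ : Measure Ω}

theorem IsGrowth.indepFun_past (h : IsGrowth ν X μ) {n : ℕ} (hn : 1 ≤ n) :
    IndepFun (fun ω => past n (X ω)) (fun ω => X ω (n + 1)) μ := by
  have := (indepFun_mask h.measurable h.indep (S := Set.Icc 2 n) (T := {n + 1})
    (fun j hj => hj.1) (by simpa using hn) (by simp) 0).comp measurable_id
    (measurable_pi_apply (n + 1))
  refine this.congr (ae_of_all _ fun ω => rfl) (ae_of_all _ fun ω => ?_)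
  simp [mask]

/-- The new input is independent of the past, so Fubini lets one average first over the uniform
parent and the echo. The hypothesis `hloc` says that `g` sees only the past. -/
theorem IsGrowth.lintegral_succ [IsProbabilityMeasure ν] [IsProbabilityMeasure μ]
    (h : IsGrowth ν X μ) {n : ℕ} (hn : 1 ≤ n) (g : ℕ → (ℕ → ℝ × ℕ) → ℝ → ENNReal)
    (hg : ∀ i, Measurable fun q : (ℕ → ℝ × ℕ) × ℝ => g i q.1 q.2)
    (hloc : ∀ i ∈ Finset.Icc 1 n, ∀ x t, g i (past n x) t = g i x t) :
    ∫⁻ ω, g (X ω (n + 1)).2 (X ω) (X ω (n + 1)).1 ∂μ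
      = (n : ENNReal)⁻¹ * ∑ i ∈ Finset.Icc 1 n, ∫⁻ ω, ∫⁻ t, g i (X ω) t ∂ν ∂μ := by
  have hX := h.measurable
  have hXn : Measurable fun ω => X ω (n + 1) := measurable_pi_iff.1 hX (n + 1)
  have hP : Measurable fun ω => past n (X ω) := (measurable_mask _ _).comp hX
  have hG : Measurable fun q : (ℕ → ℝ × ℕ) × (ℝ × ℕ) => g q.2.2 q.1 q.2.1 := by
    have : Measurable fun q : ((ℕ → ℝ × ℕ) × ℝ) × ℕ => g q.2 q.1.1 q.1.2 :=
      measurable_from_prod_countable_left fun i => hg i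
    exact this.comp ((measurable_fst.prodMk measurable_snd.fst).prodMk measurable_snd.snd)
  have hU : IsProbabilityMeasure (uniformOn (Set.Icc 1 n)) :=
    isProbabilityMeasure_uniformOn (Set.finite_Icc 1 n) ⟨1, by simpa using hn⟩
  have h1 : ∫⁻ ω, g (X ω (n + 1)).2 (X ω) (X ω (n + 1)).1 ∂μ
      = ∫⁻ ω, (fun q : (ℕ → ℝ × ℕ) × (ℝ × ℕ) => g q.2.2 q.1 q.2.1)
          (past n (X ω), X ω (n + 1)) ∂μ := by
    refine lintegral_congr fun ω => ?_
    have := h.recursive ω (n + 1) (by omega)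
    exact (hloc _ (Finset.mem_Icc.2 ⟨this.1, by omega⟩) _ _).symm
  rw [h1, ← lintegral_map hG (hP.prodMk hXn),
    (indepFun_iff_map_prod_eq_prod_map_map hP.aemeasurable hXn.aemeasurable).1
      (h.indepFun_past hn), h.law (n + 1) (by omega), Nat.add_sub_cancel,
    lintegral_prod _ hG.aemeasurable, lintegral_map hG.lintegral_prod_right' hP]
  have h2 : ∀ ω, ∫⁻ y, g y.2 (past n (X ω)) y.1 ∂(ν.prod (uniformOn (Set.Icc 1 n)))
      = (n : ENNReal)⁻¹ * ∑ i ∈ Finset.Icc 1 n, ∫⁻ t, g i (X ω) t ∂ν := by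
    intro ω
    rw [lintegral_prod_symm (fun y : ℝ × ℕ => g y.2 (past n (X ω)) y.1)
        (hG.comp measurable_prodMk_left).aemeasurable,
      lintegral_uniformOn_Icc]
    congr 1
    exact Finset.sum_congr rfl fun i hi => lintegral_congr fun t => hloc i hi _ _
  have hm : ∀ i, Measurable fun ω => ∫⁻ t, g i (X ω) t ∂ν := fun i =>
    ((hg i).lintegral_prod_right').comp hX
  rw [lintegral_congr h2, lintegral_const_mul _ (Finset.measurable_fun_sum _ fun i _ => hm i),
    lintegral_finsetSum _ fun i _ => hm i]

end IsGrowth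

/-! ### The normalization and its asymptotics -/

/-- The ratio `Γ(n + z) / Γ(n)`. -/
noncomputable def gammaRatio (z : ℝ) (n : ℕ) : ℝ := Real.Gamma (n + z) / Real.Gamma n

theorem gammaRatio_pos {z : ℝ} (hz : 0 ≤ z) {n : ℕ} (hn : 1 ≤ n) : 0 < gammaRatio z n := by
  have : (0 : ℝ) < n := by exact_mod_cast hn
  exact div_pos (Real.Gamma_pos_of_pos (by positivity)) (Real.Gamma_pos_of_pos this)

theorem gammaRatio_succ {z : ℝ} (hz : 0 ≤ z) {n : ℕ} (hn : 1 ≤ n) :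
    gammaRatio z (n + 1) = (1 + z / n) * gammaRatio z n := by
  have h : (0 : ℝ) < n := by exact_mod_cast hn
  have h2 : (0 : ℝ) < n + z := by positivity
  have h3 := (Real.Gamma_pos_of_pos h).ne'
  rw [gammaRatio, gammaRatio, Nat.cast_add_one, show (n : ℝ) + 1 + z = (n + z) + 1 by ring,
    Real.Gamma_add_one h2.ne', Real.Gamma_add_one h.ne']
  field_simp

/-- `Γ(n + 1 + z) / Γ(z)` is the product in the denominator of Euler's sequence `GammaSeq`, and
going back from `n + 1` to `n` costs the factor `n / (n + z)`, which tends to `1`. -/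
theorem tendsto_gammaRatio {z : ℝ} (hz : 0 ≤ z) :
    Tendsto (fun n : ℕ => gammaRatio z n / (n : ℝ) ^ z) atTop (𝓝 1) := by
  -- The argument divides by `Gamma z`, which takes the default value `0` at `z = 0`.
  rcases hz.eq_or_lt with rfl | hz
  · refine tendsto_const_nhds.congr' ?_
    filter_upwards [eventually_ge_atTop 1] with n hn
    have h : (0 : ℝ) < n := by exact_mod_cast hn
    simp [gammaRatio, (Real.Gamma_pos_of_pos h).ne']
  have hG := (Real.Gamma_pos_of_pos hz).ne'
  have h1 : ∀ n : ℕ, Real.Gamma (n + 1 + z)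
      = (∏ j ∈ Finset.range (n + 1), (z + j)) * Real.Gamma z := by
    intro n
    induction n with
    | zero => simp [Real.Gamma_add_one hz.ne', add_comm]
    | succ n ih =>
      rw [Finset.prod_range_succ, mul_right_comm, ← ih]
      push_cast
      rw [show (n : ℝ) + 1 + 1 + z = (n + 1 + z) + 1 by ring, Real.Gamma_add_one (by positivity)]
      ring
  have h2 : Tendsto (fun n : ℕ => Real.Gamma z / Real.GammaSeq z n * ((n : ℝ) / (n + z))) atTop
      (𝓝 (Real.Gamma z / Real.Gamma z * 1)) := by
    refine (tendsto_const_nhds.div (Real.GammaSeq_tendsto_Gamma z) hG).mul ?_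
    exact tendsto_natCast_div_add_atTop z
  rw [div_self hG, one_mul] at h2
  refine h2.congr' ?_
  filter_upwards [eventually_ge_atTop 1] with n hn
  have h : (0 : ℝ) < n := by exact_mod_cast hn
  have hs := gammaRatio_succ hz.le hn
  have h3 : gammaRatio z n = n / (n + z) * gammaRatio z (n + 1) := by
    rw [hs]; field_simp
  rw [h3, gammaRatio, Nat.cast_add_one, h1, Real.GammaSeq, Real.Gamma_nat_eq_factorial]
  have h4 : (∏ j ∈ Finset.range (n + 1), (z + j)) ≠ 0 :=
    Finset.prod_ne_zero_iff.2 fun j _ => by positivity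
  have h5 : ((n : ℝ) ^ z) ≠ 0 := by positivity
  field_simp

/-! ### The martingale of normalized masses and its almost sure limit -/

section IsGrowth

variable {Ω : Type*} [MeasurableSpace Ω] {ν : Measure ℝ} {X : Ω → ℕ → ℝ × ℕ} {μ : Measure Ω}

theorem IsGrowth.measurable_flow (h : IsGrowth ν X μ) (a : ℕ → ℝ) (r n : ℕ) :
    Measurable fun ω => flow (X ω) a r n := (_root_.measurable_flow a r n).comp h.measurable

theorem IsGrowth.measurable_flowSum (h : IsGrowth ν X μ) (a : ℕ → ℝ) (r n : ℕ) :
    Measurable fun ω => flowSum (X ω) a r n := (_root_.measurable_flowSum a r n).comp h.measurable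

theorem single_one_nonneg (i n : ℕ) : 0 ≤ (Pi.single i 1 : ℕ → ℝ) n := by
  by_cases h : n = i
  · subst h; simp
  · simp [h]

theorem IsGrowth.flow_nonneg (h : IsGrowth ν X μ) (ω : Ω) (i : ℕ) {r : ℕ} (hr : 1 ≤ r) (n : ℕ) :
    0 ≤ flow (X ω) (Pi.single i 1) r n :=
  _root_.flow_nonneg (h.nonneg ω) (single_one_nonneg i) hr n

theorem IsGrowth.flowSum_nonneg (h : IsGrowth ν X μ) (ω : Ω) (i : ℕ) {r : ℕ} (hr : 1 ≤ r)
    (n : ℕ) : 0 ≤ flowSum (X ω) (Pi.single i 1) r n :=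
  _root_.flowSum_nonneg (h.nonneg ω) (single_one_nonneg i) hr n

/-- One step of growth: expectation of the weight of a new vertex to the power `q`. -/
theorem IsGrowth.lintegral_flow_succ [IsProbabilityMeasure ν] [IsProbabilityMeasure μ]
    (h : IsGrowth ν X μ) (hν : ∀ᵐ t ∂ν, 0 ≤ t) (i : ℕ) {r n : ℕ} (hr : 1 ≤ r) (hrn : r ≤ n)
    {F : (ℕ → ℝ × ℕ) → ENNReal} (hF : Measurable F) (hFn : ∀ x, F (past n x) = F x) (q : ℝ) :
    ∫⁻ ω, F (X ω) * ENNReal.ofReal (flow (X ω) (Pi.single i 1) r (n + 1) ^ q) ∂μ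
      = (n : ENNReal)⁻¹ * (∫⁻ t, ENNReal.ofReal (t ^ q) ∂ν) * ∫⁻ ω, F (X ω) *
        ∑ j ∈ Finset.Icc 1 n, ENNReal.ofReal (flow (X ω) (Pi.single i 1) r j ^ q) ∂μ := by
  set a : ℕ → ℝ := Pi.single i 1
  let g : ℕ → (ℕ → ℝ × ℕ) → ℝ → ENNReal := fun k x t =>
    F x * ENNReal.ofReal ((t * flow x a r k) ^ q)
  have h1 : ∀ ω, F (X ω) * ENNReal.ofReal (flow (X ω) a r (n + 1) ^ q)
      = g (X ω (n + 1)).2 (X ω) (X ω (n + 1)).1 := by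
    intro ω
    simp only [g]
    rw [flow_of_lt (h.recursive ω) a hr (by omega)]
  have hm : ∀ j, Measurable fun ω => F (X ω) * ENNReal.ofReal (flow (X ω) a r j ^ q) := fun j =>
    (hF.comp h.measurable).mul ((h.measurable_flow a r j).pow_const q).ennreal_ofReal
  rw [lintegral_congr h1, h.lintegral_succ (by omega) g, mul_assoc]
  · congr 1
    have h2 : ∀ j, ∫⁻ ω, ∫⁻ t, F (X ω) * ENNReal.ofReal ((t * flow (X ω) a r j) ^ q) ∂ν ∂μ
        = (∫⁻ t, ENNReal.ofReal (t ^ q) ∂ν) *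
          ∫⁻ ω, F (X ω) * ENNReal.ofReal (flow (X ω) a r j ^ q) ∂μ := by
      intro j
      rw [← lintegral_const_mul _ (hm j)]
      refine lintegral_congr fun ω => ?_
      have hw : 0 ≤ flow (X ω) a r j := h.flow_nonneg ω i hr j
      have h3 : ∀ᵐ t ∂ν, F (X ω) * ENNReal.ofReal ((t * flow (X ω) a r j) ^ q)
          = F (X ω) * ENNReal.ofReal (flow (X ω) a r j ^ q) * ENNReal.ofReal (t ^ q) := by
        filter_upwards [hν] with t ht
        rw [Real.mul_rpow ht hw, ENNReal.ofReal_mul (by positivity), mul_assoc]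
        congr 1
        rw [mul_comm]
      rw [lintegral_congr_ae h3, lintegral_const_mul _ (by fun_prop), mul_comm]
    simp only [Finset.mul_sum]
    rw [lintegral_finsetSum _ fun j _ => hm j, Finset.mul_sum]
    exact Finset.sum_congr rfl fun j _ => h2 j
  · intro k
    have := _root_.measurable_flow a r k
    fun_prop
  · intro k hk x t
    simp only [g]
    rw [hFn, flow_past hr _ _ (Finset.mem_Icc.1 hk).2]

theorem lintegral_rpow_one (hν : ∀ᵐ t ∂ν, 0 ≤ t) (hi : Integrable (fun t : ℝ => t) ν) :
    ∫⁻ t, ENNReal.ofReal (t ^ (1 : ℝ)) ∂ν = ENNReal.ofReal (∫ t, t ∂ν) := by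
  simp only [Real.rpow_one]
  exact (ofReal_integral_eq_lintegral_ofReal hi hν).symm

/-- The expected weight of the new vertex is the mean echo times the average current weight. A
weight `F` of the past is carried along: an indicator gives the martingale property, and `F = 1` the
mean. -/
theorem IsGrowth.lintegral_flowSum_succ [IsProbabilityMeasure ν] [IsProbabilityMeasure μ]
    (h : IsGrowth ν X μ) (hν : ∀ᵐ t ∂ν, 0 ≤ t) (hi : Integrable (fun t : ℝ => t) ν)
    (i : ℕ) {r n : ℕ} (hr : 1 ≤ r) (hrn : r ≤ n)
    {F : (ℕ → ℝ × ℕ) → ENNReal} (hF : Measurable F) (hFn : ∀ x, F (past n x) = F x) :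
    ∫⁻ ω, F (X ω) * ENNReal.ofReal (flowSum (X ω) (Pi.single i 1) r (n + 1)) ∂μ
      = ENNReal.ofReal (1 + (∫ t, t ∂ν) / n) *
        ∫⁻ ω, F (X ω) * ENNReal.ofReal (flowSum (X ω) (Pi.single i 1) r n) ∂μ := by
  have hn : (0 : ℝ) < n := by exact_mod_cast hr.trans hrn
  have hm : 0 ≤ ∫ t, t ∂ν := integral_nonneg_of_ae hν
  have h1 := h.lintegral_flow_succ hν i hr hrn hF hFn 1
  rw [lintegral_rpow_one hν hi] at h1
  simp only [Real.rpow_one] at h1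
  have h2 : ∀ ω, ∑ j ∈ Finset.Icc 1 n, ENNReal.ofReal (flow (X ω) (Pi.single i 1) r j)
      = ENNReal.ofReal (flowSum (X ω) (Pi.single i 1) r n) := fun ω =>
    (ENNReal.ofReal_sum_of_nonneg fun j _ => h.flow_nonneg ω i hr j).symm
  simp only [h2] at h1
  have h3 : ∀ ω, F (X ω) * ENNReal.ofReal (flowSum (X ω) (Pi.single i 1) r (n + 1))
      = F (X ω) * ENNReal.ofReal (flowSum (X ω) (Pi.single i 1) r n)
        + F (X ω) * ENNReal.ofReal (flow (X ω) (Pi.single i 1) r (n + 1)) := fun ω => by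
    rw [flowSum_succ, ENNReal.ofReal_add (h.flowSum_nonneg ω i hr n) (h.flow_nonneg ω i hr _),
      mul_add]
  have h4 : Measurable fun ω =>
      F (X ω) * ENNReal.ofReal (flowSum (X ω) (Pi.single i 1) r n) :=
    (hF.comp h.measurable).mul (h.measurable_flowSum _ r n).ennreal_ofReal
  rw [lintegral_congr h3, lintegral_add_left h4, h1, ENNReal.ofReal_add zero_le_one (by positivity),
    add_mul, ENNReal.ofReal_one, one_mul, ENNReal.ofReal_div_of_pos hn, ENNReal.ofReal_natCast,
    div_eq_mul_inv]
  ring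

theorem IsGrowth.lintegral_flowSum [IsProbabilityMeasure ν] [IsProbabilityMeasure μ]
    (h : IsGrowth ν X μ) (hν : ∀ᵐ t ∂ν, 0 ≤ t) (hi : Integrable (fun t : ℝ => t) ν)
    {i r n : ℕ} (hi1 : 1 ≤ i) (hir : i ≤ r) (hrn : r ≤ n) :
    ∫⁻ ω, ENNReal.ofReal (flowSum (X ω) (Pi.single i 1) r n) ∂μ
      = ENNReal.ofReal (gammaRatio (∫ t, t ∂ν) n / gammaRatio (∫ t, t ∂ν) r) := by
  have hm : 0 ≤ ∫ t, t ∂ν := integral_nonneg_of_ae hν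
  have hr : 1 ≤ r := hi1.trans hir
  induction n, hrn using Nat.le_induction with
  | base =>
    simp only [flowSum_single _ hi1 hir]
    rw [div_self (gammaRatio_pos hm hr).ne']
    simp
  | succ n hrn ih =>
    have := h.lintegral_flowSum_succ hν hi i hr hrn (F := fun _ => 1) measurable_const
      fun _ => rfl
    simp only [one_mul] at this
    rw [this, ih, ← ENNReal.ofReal_mul (by positivity), gammaRatio_succ hm (hr.trans hrn),
      mul_div_assoc]

theorem IsGrowth.integrable_flowSum [IsProbabilityMeasure ν] [IsProbabilityMeasure μ]
    (h : IsGrowth ν X μ) (hν : ∀ᵐ t ∂ν, 0 ≤ t) (hi : Integrable (fun t : ℝ => t) ν)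
    {i r n : ℕ} (hi1 : 1 ≤ i) (hir : i ≤ r) (hrn : r ≤ n) :
    Integrable (fun ω => flowSum (X ω) (Pi.single i 1) r n) μ := by
  refine ⟨(h.measurable_flowSum _ r n).aestronglyMeasurable, ?_⟩
  rw [hasFiniteIntegral_iff_ofReal (ae_of_all _ fun ω => h.flowSum_nonneg ω i (hi1.trans hir) n),
    h.lintegral_flowSum hν hi hi1 hir hrn]
  exact ENNReal.ofReal_lt_top

/-- The normalized mass of the descendants of the vertex `i ≤ r`, at time `r + k`. -/
noncomputable def massRatio (ν : Measure ℝ) (X : Ω → ℕ → ℝ × ℕ) (i r k : ℕ) (ω : Ω) : ℝ :=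
  flowSum (X ω) (Pi.single i 1) r (r + k) / gammaRatio (∫ t, t ∂ν) (r + k)

/-- The information available from time `r` on. -/
noncomputable def IsGrowth.filtration (h : IsGrowth ν X μ) (r : ℕ) :
    Filtration ℕ ‹MeasurableSpace Ω› where
  seq k := MeasurableSpace.comap (fun ω => past (r + k) (X ω)) inferInstance
  mono' k l hkl := by
    have : (fun ω => past (r + k) (X ω)) = past (r + k) ∘ fun ω => past (r + l) (X ω) := by
      funext ω
      exact (past_past (by omega) _).symm
    simp only [this, ← MeasurableSpace.comap_comp]
    exact MeasurableSpace.comap_mono (measurable_mask _ _).comap_le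
  le' k := ((measurable_mask _ _).comp h.measurable).comap_le

theorem massRatio_nonneg (h : IsGrowth ν X μ) (hν : ∀ᵐ t ∂ν, 0 ≤ t) (i : ℕ) {r : ℕ} (hr : 1 ≤ r)
    (k : ℕ) (ω : Ω) : 0 ≤ massRatio ν X i r k ω :=
  div_nonneg (h.flowSum_nonneg ω i hr _)
    (gammaRatio_pos (integral_nonneg_of_ae hν) (by omega)).le

theorem IsGrowth.martingale_massRatio [IsProbabilityMeasure ν] [IsProbabilityMeasure μ]
    (h : IsGrowth ν X μ) (hν : ∀ᵐ t ∂ν, 0 ≤ t) (hi : Integrable (fun t : ℝ => t) ν)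
    {i r : ℕ} (hi1 : 1 ≤ i) (hir : i ≤ r) :
    Martingale (massRatio ν X i r) (h.filtration r) μ := by
  have hm : 0 ≤ ∫ t, t ∂ν := integral_nonneg_of_ae hν
  have hr : 1 ≤ r := hi1.trans hir
  refine martingale_of_setIntegral_eq_succ (fun k => ?_) (fun k => ?_) fun k s hs => ?_
  · refine Measurable.stronglyMeasurable ?_
    have h1 : massRatio ν X i r k
        = (fun x => flowSum x (Pi.single i 1) r (r + k) / gammaRatio (∫ t, t ∂ν) (r + k)) ∘
          fun ω => past (r + k) (X ω) := by
      funext ω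
      simp only [Function.comp, massRatio]
      rw [flowSum_past hr _ _ le_rfl]
    rw [h1]
    exact ((_root_.measurable_flowSum _ r (r + k)).div_const _).comp (comap_measurable _)
  · exact (h.integrable_flowSum hν hi hi1 hir (by omega)).div_const _
  · obtain ⟨t, ht, rfl⟩ := hs
    have hs : MeasurableSet ((fun ω => past (r + k) (X ω)) ⁻¹' t) :=
      ((measurable_mask _ _).comp h.measurable) ht
    -- An event of the filtration is the preimage of some `t` under the past, so its indicator is an
    -- admissible weight.
    have hF : Measurable fun x : ℕ → ℝ × ℕ => t.indicator (fun _ => (1 : ENNReal)) (past (r + k) x) :=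
      (measurable_const.indicator ht).comp (measurable_mask _ _)
    have h2 := h.lintegral_flowSum_succ hν hi i hr (n := r + k) (by omega) hF fun x => by
      rw [past_past le_rfl]
    have h3 : ∀ l, ∫ ω in (fun ω => past (r + k) (X ω)) ⁻¹' t, massRatio ν X i r l ω ∂μ
        = (∫⁻ ω, t.indicator (fun _ => (1 : ENNReal)) (past (r + k) (X ω)) *
          ENNReal.ofReal (flowSum (X ω) (Pi.single i 1) r (r + l)) ∂μ).toReal
            / gammaRatio (∫ t, t ∂ν) (r + l) := by
      intro l
      unfold massRatio
      rw [integral_div, integral_eq_lintegral_of_nonneg_ae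
        (ae_of_all _ fun ω => h.flowSum_nonneg ω i hr _)
        (h.measurable_flowSum _ r _).aestronglyMeasurable.restrict,
        ← lintegral_indicator hs]
      congr 2
      refine lintegral_congr fun ω => ?_
      by_cases hω : past (r + k) (X ω) ∈ t
      · rw [Set.indicator_of_mem (by exact hω), Set.indicator_of_mem hω, one_mul]
      · rw [Set.indicator_of_notMem (by exact hω), Set.indicator_of_notMem hω, zero_mul]
    have hk : (0 : ℝ) < ((r + k : ℕ) : ℝ) := by exact_mod_cast (by omega : 0 < r + k)
    rw [h3, h3, ← add_assoc, h2, ENNReal.toReal_mul, ENNReal.toReal_ofReal (by positivity),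
      gammaRatio_succ hm (by omega), mul_div_mul_left _ _ (by positivity)]

theorem IsGrowth.integral_massRatio [IsProbabilityMeasure ν] [IsProbabilityMeasure μ]
    (h : IsGrowth ν X μ) (hν : ∀ᵐ t ∂ν, 0 ≤ t) (hi : Integrable (fun t : ℝ => t) ν)
    {i r : ℕ} (hi1 : 1 ≤ i) (hir : i ≤ r) (k : ℕ) :
    ∫ ω, massRatio ν X i r k ω ∂μ = (gammaRatio (∫ t, t ∂ν) r)⁻¹ := by
  have hm : 0 ≤ ∫ t, t ∂ν := integral_nonneg_of_ae hν
  have hr : 1 ≤ r := hi1.trans hir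
  have h1 := gammaRatio_pos hm hr
  have h2 := gammaRatio_pos hm (show 1 ≤ r + k by omega)
  unfold massRatio
  rw [integral_div, integral_eq_lintegral_of_nonneg_ae
    (ae_of_all _ fun ω => h.flowSum_nonneg ω i hr _)
    (h.measurable_flowSum _ r _).aestronglyMeasurable,
    h.lintegral_flowSum hν hi hi1 hir (by omega), ENNReal.toReal_ofReal (by positivity)]
  field_simp

/-- The almost sure limit of the normalized mass of the descendants of the vertex `i ≤ r`. -/
noncomputable def IsGrowth.limitMass (_ : IsGrowth ν X μ) (i r : ℕ) : Ω → ℝ :=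
  fun ω => limsup (fun k => massRatio ν X i r k ω) atTop

theorem IsGrowth.eLpNorm_massRatio [IsProbabilityMeasure ν] [IsProbabilityMeasure μ]
    (h : IsGrowth ν X μ) (hν : ∀ᵐ t ∂ν, 0 ≤ t) (hi : Integrable (fun t : ℝ => t) ν)
    {i r : ℕ} (hi1 : 1 ≤ i) (hir : i ≤ r) (k : ℕ) :
    eLpNorm (massRatio ν X i r k) 1 μ
      = (Real.toNNReal (gammaRatio (∫ t, t ∂ν) r)⁻¹ : NNReal) := by
  have hr : 1 ≤ r := hi1.trans hir
  rw [eLpNorm_one_eq_lintegral_enorm, ← h.integral_massRatio hν hi hi1 hir k]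
  have h1 : ∀ ω, ‖massRatio ν X i r k ω‖ₑ = ENNReal.ofReal (massRatio ν X i r k ω) := fun ω =>
    Real.enorm_of_nonneg (massRatio_nonneg h hν i hr k ω)
  rw [lintegral_congr h1, ← ofReal_integral_eq_lintegral_ofReal
    ((h.martingale_massRatio hν hi hi1 hir).integrable k)
    (ae_of_all _ fun ω => massRatio_nonneg h hν i hr k ω)]
  rfl

/-- Fatou: the norm of the limit is at most the lower limit of the norms. -/
theorem memLp_of_ae_tendsto {f : ℕ → Ω → ℝ} {L : Ω → ℝ} {q : ENNReal} {R : NNReal}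
    (hf : ∀ k, AEStronglyMeasurable (f k) μ) (hR : ∀ k, eLpNorm (f k) q μ ≤ R)
    (hL : ∀ᵐ ω ∂μ, Tendsto (fun k => f k ω) atTop (𝓝 (L ω))) : MemLp L q μ := by
  refine ⟨aestronglyMeasurable_of_tendsto_ae atTop hf hL,
    (Lp.eLpNorm_lim_le_liminf_eLpNorm hf L hL).trans_lt (lt_of_le_of_lt ?_ (ENNReal.coe_lt_top (r := R)))⟩
  exact (liminf_le_liminf (Eventually.of_forall hR)).trans_eq (liminf_const _)

theorem IsGrowth.tendsto_massRatio [IsProbabilityMeasure ν] [IsProbabilityMeasure μ]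
    (h : IsGrowth ν X μ) (hν : ∀ᵐ t ∂ν, 0 ≤ t) (hi : Integrable (fun t : ℝ => t) ν)
    {i r : ℕ} (hi1 : 1 ≤ i) (hir : i ≤ r) :
    ∀ᵐ ω ∂μ, Tendsto (fun k => massRatio ν X i r k ω) atTop (𝓝 (h.limitMass i r ω)) := by
  filter_upwards [(h.martingale_massRatio hν hi hi1 hir).submartingale.exists_ae_tendsto_of_bdd
    fun k => (h.eLpNorm_massRatio hν hi hi1 hir k).le] with ω hω
  obtain ⟨c, hc⟩ := hω
  have : h.limitMass i r ω = c := hc.limsup_eq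
  rwa [this]

theorem IsGrowth.integrable_limitMass [IsProbabilityMeasure ν] [IsProbabilityMeasure μ]
    (h : IsGrowth ν X μ) (hν : ∀ᵐ t ∂ν, 0 ≤ t) (hi : Integrable (fun t : ℝ => t) ν)
    {i r : ℕ} (hi1 : 1 ≤ i) (hir : i ≤ r) : Integrable (h.limitMass i r) μ :=
  memLp_one_iff_integrable.1 <| memLp_of_ae_tendsto
    (fun k => ((h.martingale_massRatio hν hi hi1 hir).integrable k).aestronglyMeasurable)
    (fun k => (h.eLpNorm_massRatio hν hi hi1 hir k).le) (h.tendsto_massRatio hν hi hi1 hir)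

theorem IsGrowth.limitMass_nonneg [IsProbabilityMeasure ν] [IsProbabilityMeasure μ]
    (h : IsGrowth ν X μ) (hν : ∀ᵐ t ∂ν, 0 ≤ t) (hi : Integrable (fun t : ℝ => t) ν)
    {i r : ℕ} (hi1 : 1 ≤ i) (hir : i ≤ r) : ∀ᵐ ω ∂μ, 0 ≤ h.limitMass i r ω := by
  filter_upwards [h.tendsto_massRatio hν hi hi1 hir] with ω hω
  exact ge_of_tendsto' hω fun k => massRatio_nonneg h hν i (hi1.trans hir) k ω

theorem IsGrowth.tendsto_flowSum [IsProbabilityMeasure ν] [IsProbabilityMeasure μ]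
    (h : IsGrowth ν X μ) (hν : ∀ᵐ t ∂ν, 0 ≤ t) (hi : Integrable (fun t : ℝ => t) ν)
    {i r : ℕ} (hi1 : 1 ≤ i) (hir : i ≤ r) :
    ∀ᵐ ω ∂μ, Tendsto (fun n : ℕ => flowSum (X ω) (Pi.single i 1) r n / (n : ℝ) ^ (∫ t, t ∂ν)) atTop
      (𝓝 (h.limitMass i r ω)) := by
  have hm : 0 ≤ ∫ t, t ∂ν := integral_nonneg_of_ae hν
  filter_upwards [h.tendsto_massRatio hν hi hi1 hir] with ω hω
  rw [← tendsto_add_atTop_iff_nat r]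
  have h1 := hω.mul ((tendsto_gammaRatio hm).comp (tendsto_add_atTop_nat r))
  rw [mul_one] at h1
  refine h1.congr fun k => ?_
  have := gammaRatio_pos hm (show 1 ≤ k + r by omega)
  simp only [massRatio, Function.comp]
  rw [add_comm r k]
  field_simp

end IsGrowth

/-! ### Martingales bounded in `L^γ` -/

section Martingale

variable {Ω : Type*} {m0 : MeasurableSpace Ω} {μ : Measure Ω}

/-- The conditional expectations of a function in `Lᵖ` are uniformly `p`-integrable. -/
theorem unifIntegrable_condExp_of_memLp [IsFiniteMeasure μ] {g : Ω → ℝ} {p : ENNReal} (hp : 1 ≤ p)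
    (hp' : p ≠ ⊤) (hg : MemLp g p μ) (ℱ : Filtration ℕ m0) :
    UnifIntegrable (fun n => μ[g | ℱ n]) p μ := by
  have hint : Integrable g μ := hg.integrable hp
  refine unifIntegrable_of hp hp'
    (fun n => (stronglyMeasurable_condExp.mono (ℱ.le n)).aestronglyMeasurable) fun ε hε => ?_
  obtain ⟨δ, hδ, h⟩ := hg.eLpNorm_indicator_le hp hp' hε
  set A : NNReal := (eLpNorm g 1 μ).toNNReal with hA
  have hA' : eLpNorm g 1 μ = A := (ENNReal.coe_toNNReal (memLp_one_iff_integrable.2 hint).2.ne).symm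
  -- By Markov, the set where the conditional expectation exceeds this level has measure at most
  -- `δ`, uniformly in `n`. The summand `1` keeps the level positive when `A = 0`.
  refine ⟨(A + 1) / δ.toNNReal, fun n => ?_⟩
  set D : NNReal := (A + 1) / δ.toNNReal
  have hδ0 : 0 < δ.toNNReal := Real.toNNReal_pos.2 hδ
  have hD : 0 < D := div_pos (by positivity) hδ0
  set s : Set Ω := {x | D ≤ ‖(μ[g | ℱ n]) x‖₊} with hs
  have hsm : MeasurableSet[ℱ n] s :=
    (stronglyMeasurable_condExp (μ := μ) (f := g) (m := ℱ n)).measurable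
      (measurableSet_le (measurable_const (a := D)) measurable_nnnorm)
  have hμ : μ s ≤ ENNReal.ofReal δ := by
    have h1 := mul_meas_ge_le_pow_eLpNorm μ (f := μ[g | ℱ n]) one_ne_zero ENNReal.one_ne_top
      (stronglyMeasurable_condExp.mono (ℱ.le n)).aestronglyMeasurable (D : ENNReal)
    simp only [ENNReal.toReal_one, ENNReal.rpow_one] at h1
    have h2 := h1.trans (eLpNorm_condExp_le_eLpNorm g le_rfl)
    have h3 : {x | (D : ENNReal) ≤ ‖(μ[g | ℱ n]) x‖ₑ} = s := by
      ext x; simp [hs, enorm_eq_nnnorm]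
    rw [h3, hA'] at h2
    have h4 : (D : ENNReal) * μ s ≤ D * ENNReal.ofReal δ := by
      refine h2.trans ?_
      rw [ENNReal.ofReal, ← ENNReal.coe_mul, div_mul_cancel₀ _ hδ0.ne']
      exact_mod_cast le_self_add
    exact (ENNReal.mul_le_mul_iff_right (by exact_mod_cast hD.ne') ENNReal.coe_ne_top).1 h4
  have h5 := h s (ℱ.le n s hsm) hμ
  refine le_trans ?_ h5
  -- The level set belongs to `ℱ n`, so its indicator moves inside the conditional expectation,
  -- which contracts `Lᵖ` norms.
  rw [← eLpNorm_congr_ae (condExp_indicator hint hsm)]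
  exact eLpNorm_condExp_le_eLpNorm _ hp

/-- A family bounded in `Lᵖ`, `p > 1`, is uniformly integrable. -/
theorem uniformIntegrable_one_of_eLpNorm_le [IsProbabilityMeasure μ] {ι : Type*} {f : ι → Ω → ℝ} {γ : ℝ} (hγ : 1 < γ)
    {R : NNReal} (hf : ∀ i, AEStronglyMeasurable (f i) μ)
    (hR : ∀ i, eLpNorm (f i) (ENNReal.ofReal γ) μ ≤ R) : UniformIntegrable f 1 μ := by
  have h1 : (1 : ENNReal) ≤ ENNReal.ofReal γ := by
    rw [← ENNReal.ofReal_one]; exact ENNReal.ofReal_le_ofReal hγ.le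
  refine ⟨hf, fun ε hε => ?_, R, fun i => (eLpNorm_le_eLpNorm_of_exponent_le h1 (hf i)).trans (hR i)⟩
  have hexp : 0 < 1 - 1 / γ := by
    have : 1 / γ < 1 := by rw [div_lt_one (by linarith)]; exact hγ
    linarith
  -- Hölder bounds the `L¹` norm on a set of measure at most `δ` by `R * δ ^ (1 - 1 / γ)`, which
  -- this choice makes at most `ε`; `R + 1` avoids a division by zero.
  set δ : ℝ := (ε / (R + 1)) ^ (1 - 1 / γ)⁻¹
  have hR1 : (0 : ℝ) < R + 1 := by positivity
  refine ⟨δ, by positivity, fun i s hs hμs => ?_⟩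
  rw [eLpNorm_indicator_eq_eLpNorm_restrict hs]
  have h2 := eLpNorm_le_eLpNorm_mul_rpow_measure_univ (μ := μ.restrict s) h1 ((hf i).restrict)
  refine h2.trans ?_
  rw [ENNReal.toReal_one, ENNReal.toReal_ofReal (by linarith), Measure.restrict_apply_univ, div_one]
  calc eLpNorm (f i) (ENNReal.ofReal γ) (μ.restrict s) * μ s ^ (1 - 1 / γ)
      ≤ R * ENNReal.ofReal δ ^ (1 - 1 / γ) :=
        mul_le_mul' ((eLpNorm_restrict_le _ _ _ _).trans (hR i))
          (ENNReal.rpow_le_rpow hμs hexp.le)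
    _ = ENNReal.ofReal (R * (ε / (R + 1))) := by
        rw [ENNReal.ofReal_rpow_of_nonneg (by positivity) hexp.le, ← Real.rpow_mul (by positivity),
          inv_mul_cancel₀ hexp.ne', Real.rpow_one, ENNReal.ofReal_mul (by positivity),
          ENNReal.ofReal_coe_nnreal]
    _ ≤ ENNReal.ofReal ε := by
        refine ENNReal.ofReal_le_ofReal ?_
        rw [mul_div_assoc', div_le_iff₀ hR1]
        nlinarith [R.2]

/-- A martingale bounded in `L^γ`, `γ > 1`, is closed by its limit, and converges in `L^γ`. -/
theorem Martingale.tendsto_eLpNorm_of_bdd [IsProbabilityMeasure μ] {ℱ : Filtration ℕ m0}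
    {f : ℕ → Ω → ℝ} (hf : Martingale f ℱ μ) {γ : ℝ} (hγ : 1 < γ) {R : NNReal}
    (hR : ∀ k, eLpNorm (f k) (ENNReal.ofReal γ) μ ≤ R) {L : Ω → ℝ}
    (hfL : ∀ᵐ ω ∂μ, Tendsto (fun k => f k ω) atTop (𝓝 (L ω))) :
    MemLp L (ENNReal.ofReal γ) μ ∧ (∀ k, f k =ᵐ[μ] μ[L | ℱ k]) ∧
    Tendsto (fun k => eLpNorm (f k - L) (ENNReal.ofReal γ) μ) atTop (𝓝 0) := by
  have h1 : (1 : ENNReal) ≤ ENNReal.ofReal γ := by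
    rw [← ENNReal.ofReal_one]; exact ENNReal.ofReal_le_ofReal hγ.le
  have hfm : ∀ k, AEStronglyMeasurable (f k) μ := fun k => (hf.integrable k).aestronglyMeasurable
  have hU := uniformIntegrable_one_of_eLpNorm_le hγ hfm hR
  have hL := memLp_of_ae_tendsto hfm hR hfL
  have hLi : Integrable L μ := hL.integrable h1
  have hc : ∀ k, f k =ᵐ[μ] μ[L | ℱ k] := by
    intro k
    have h2 := tendsto_Lp_finite_of_tendsto_ae le_rfl ENNReal.one_ne_top hfm (hL.mono_exponent h1)
      hU.2.1 hfL
    have h3 : eLpNorm (f k - μ[L | ℱ k]) 1 μ = 0 := by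
      refine le_antisymm (ge_of_tendsto h2 ?_) bot_le
      filter_upwards [eventually_ge_atTop k] with n hn
      -- For `n ≥ k` the martingale property turns the difference into the conditional expectation
      -- of `f n - L`, whose `L¹` norm tends to `0`.
      have h4 : f k - μ[L | ℱ k] =ᵐ[μ] μ[f n - L | ℱ k] :=
        ((hf.condExp_ae_eq hn).symm.sub (EventuallyEq.refl _ _)).trans
          (condExp_sub (hf.integrable n) hLi _).symm
      rw [eLpNorm_congr_ae h4]
      exact eLpNorm_condExp_le_eLpNorm _ le_rfl
    rw [eLpNorm_eq_zero_iff ((hfm k).sub integrable_condExp.aestronglyMeasurable) one_ne_zero] at h3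
    exact (sub_ae_eq_zero _ _).1 h3
  refine ⟨hL, hc, tendsto_Lp_finite_of_tendsto_ae h1 ENNReal.ofReal_ne_top hfm hL ?_ hfL⟩
  exact (unifIntegrable_condExp_of_memLp h1 ENNReal.ofReal_ne_top hL ℱ).ae_eq fun k => (hc k).symm

end Martingale

/-! ### Inequalities for powers and a discrete Gronwall bound -/

section RealAnalysis

/-- Bernoulli's inequality at `-x / (1 + x)`, multiplied by `(1 + x) ^ q`. -/
theorem one_add_rpow_le {x q : ℝ} (hx : 0 ≤ x) (hq : 1 ≤ q) :
    (1 + x) ^ q ≤ 1 + q * x * (1 + x) ^ (q - 1) := by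
  have h0 : 0 < 1 + x := by linarith
  have h1 : -1 ≤ -x / (1 + x) := by rw [le_div_iff₀ h0]; linarith
  have h2 := one_add_mul_self_le_rpow_one_add h1 hq
  have h3 : 1 + -x / (1 + x) = (1 + x)⁻¹ := by field_simp; ring
  rw [h3, Real.inv_rpow h0.le] at h2
  have h4 : 0 < (1 + x) ^ q := by positivity
  have h5 := mul_le_mul_of_nonneg_right h2 h4.le
  rw [inv_mul_cancel₀ h4.ne'] at h5
  have h6 : (1 + x) ^ (q - 1) = (1 + x) ^ q / (1 + x) := Real.rpow_sub_one h0.ne' q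
  rw [h6]
  have h7 : (1 + q * (-x / (1 + x))) * (1 + x) ^ q = (1 + x) ^ q - q * x * ((1 + x) ^ q / (1 + x)) := by
    field_simp; ring
  linarith

/-- For `b ≤ l s` the first-order bound applies with the small ratio `b / s ≤ l`; for `b > l s` the
sum is at most `(2 / l) b`. A small `l` brings the coefficient of the linear term close to its
optimal value `q`, at the price of a large one for `b ^ q`. -/
theorem add_rpow_le {s b q l : ℝ} (hs : 0 ≤ s) (hb : 0 ≤ b) (hq : 1 < q) (hl : 0 < l) (hl1 : l ≤ 1) :
    (s + b) ^ q ≤ s ^ q + q * (1 + l) ^ (q - 1) * (s ^ (q - 1) * b) + (2 / l) ^ q * b ^ q := by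
  rcases le_or_gt b (l * s) with h | h
  · rcases hs.eq_or_lt with rfl | hs
    · obtain rfl : b = 0 := by linarith
      simp [Real.zero_rpow (by linarith : q ≠ 0)]
    have hx : b / s ≤ l := by rw [div_le_iff₀ hs]; exact h
    have hx0 : 0 ≤ b / s := by positivity
    have h1 := one_add_rpow_le hx0 hq.le
    have h2 : (1 + b / s) ^ (q - 1) ≤ (1 + l) ^ (q - 1) :=
      Real.rpow_le_rpow (by positivity) (by linarith) (by linarith)
    have h3 : s + b = s * (1 + b / s) := by field_simp
    have h4 : s ^ (q - 1) = s ^ q / s := Real.rpow_sub_one hs.ne' q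
    rw [h3, Real.mul_rpow hs.le (by positivity), h4]
    have h5 : s ^ q * (1 + b / s) ^ q ≤ s ^ q * (1 + q * (b / s) * (1 + l) ^ (q - 1)) := by
      gcongr
      refine h1.trans ?_
      gcongr
    have h6 : 0 ≤ (2 / l) ^ q * b ^ q := by positivity
    have h7 : s ^ q * (1 + q * (b / s) * (1 + l) ^ (q - 1))
      = s ^ q + q * (1 + l) ^ (q - 1) * (s ^ q / s * b) := by field_simp
    linarith
  · have h1 : s + b ≤ 2 / l * b := by
      rw [div_mul_eq_mul_div, le_div_iff₀ hl]
      nlinarith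
    have h2 : (s + b) ^ q ≤ (2 / l * b) ^ q :=
      Real.rpow_le_rpow (by positivity) h1 (by linarith)
    rw [Real.mul_rpow (by positivity) hb] at h2
    have h3 : 0 ≤ s ^ q + q * (1 + l) ^ (q - 1) * (s ^ (q - 1) * b) := by positivity
    linarith

/-- Discrete Gronwall: since `1 + u n ≤ exp (u n)`, the accumulated factor is at most the
exponential of the sum of the `u n`. -/
theorem bounded_of_le_one_add_mul_add {y u v : ℕ → ℝ} (hu : ∀ n, 0 ≤ u n) (hv : ∀ n, 0 ≤ v n)
    (hus : Summable u) (hvs : Summable v) (hy : ∀ n, 0 ≤ y n)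
    (h : ∀ n, y (n + 1) ≤ (1 + u n) * y n + v n) : ∃ D, ∀ n, y n ≤ D := by
  have key : ∀ n, y n ≤ (y 0 + ∑ k ∈ Finset.range n, v k) * Real.exp (∑ k ∈ Finset.range n, u k) := by
    intro n
    induction n with
    | zero => simp
    | succ n ih =>
      rw [Finset.sum_range_succ, Finset.sum_range_succ, Real.exp_add]
      have h1 : 1 + u n ≤ Real.exp (u n) := by linarith [Real.add_one_le_exp (u n)]
      have h2 : 0 ≤ ∑ k ∈ Finset.range n, u k := Finset.sum_nonneg fun k _ => hu k
      have h3 : 1 ≤ Real.exp (∑ k ∈ Finset.range n, u k) * Real.exp (u n) := by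
        rw [← Real.exp_add]; exact Real.one_le_exp (by linarith [hu n])
      have h4 : (1 + u n) * y n ≤ Real.exp (u n) * ((y 0 + ∑ k ∈ Finset.range n, v k) *
          Real.exp (∑ k ∈ Finset.range n, u k)) := by gcongr; exact hy n
      have h5 := mul_le_mul_of_nonneg_left h3 (hv n)
      nlinarith [h n]
  refine ⟨(y 0 + ∑' k, v k) * Real.exp (∑' k, u k), fun n => (key n).trans ?_⟩
  have h1 := hvs.sum_le_tsum (Finset.range n) fun k _ => hv k
  have h2 := hus.sum_le_tsum (Finset.range n) fun k _ => hu k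
  have h3 : 0 ≤ ∑' k, v k := tsum_nonneg hv
  have := hy 0
  gcongr

theorem gammaRatio_bounds {z : ℝ} (hz : 0 ≤ z) : ∃ D : ℝ, 0 < D ∧ ∀ n : ℕ, 1 ≤ n →
    gammaRatio z n ≤ D * (n : ℝ) ^ z ∧ (n : ℝ) ^ z ≤ D * gammaRatio z n := by
  have h1 := tendsto_gammaRatio hz
  have h2 := h1.inv₀ one_ne_zero
  obtain ⟨A, hA⟩ := h1.bddAbove_range
  obtain ⟨B, hB⟩ := h2.bddAbove_range
  refine ⟨max (max A B) 1, by positivity, fun n hn => ?_⟩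
  have hn : (0 : ℝ) < n := by exact_mod_cast hn
  have hg := gammaRatio_pos hz (Nat.cast_pos.1 hn)
  have hp : 0 < (n : ℝ) ^ z := by positivity
  have h3 : gammaRatio z n / (n : ℝ) ^ z ≤ A := hA ⟨n, rfl⟩
  have h4 : (gammaRatio z n / (n : ℝ) ^ z)⁻¹ ≤ B := hB ⟨n, rfl⟩
  rw [inv_div, div_le_iff₀ hg] at h4
  rw [div_le_iff₀ hp] at h3
  constructor
  · refine h3.trans ?_
    gcongr
    exact (le_max_left A B).trans (le_max_left _ _)
  · refine h4.trans ?_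
    gcongr
    exact (le_max_right A B).trans (le_max_left _ _)

end RealAnalysis

/-! ### Moment bounds and convergence in `L^q` -/

section IsGrowth

variable {Ω : Type*} [MeasurableSpace Ω] {ν : Measure ℝ} {X : Ω → ℕ → ℝ × ℕ} {μ : Measure Ω}

theorem lintegral_rpow_eq (hν : ∀ᵐ t ∂ν, 0 ≤ t) {q : ℝ} (hi : Integrable (fun t : ℝ => t ^ q) ν) :
    ∫⁻ t, ENNReal.ofReal (t ^ q) ∂ν = ENNReal.ofReal (echoMoment ν q) :=
  (ofReal_integral_eq_lintegral_ofReal hi (hν.mono fun _ ht => Real.rpow_nonneg ht q)).symm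

theorem echoMoment_nonneg (hν : ∀ᵐ t ∂ν, 0 ≤ t) (q : ℝ) : 0 ≤ echoMoment ν q :=
  integral_nonneg_of_ae (hν.mono fun _ ht => Real.rpow_nonneg ht q)

theorem echoMoment_one : echoMoment ν 1 = ∫ t, t ∂ν := by simp [echoMoment]

/-- The expected sum of the `q`-th powers of the weights. -/
theorem IsGrowth.lintegral_sum_rpow [IsProbabilityMeasure ν] [IsProbabilityMeasure μ]
    (h : IsGrowth ν X μ) (hν : ∀ᵐ t ∂ν, 0 ≤ t) {q : ℝ} (hq : 0 < q)
    (hi : Integrable (fun t : ℝ => t ^ q) ν)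
    {i r n : ℕ} (hi1 : 1 ≤ i) (hir : i ≤ r) (hrn : r ≤ n) :
    ∫⁻ ω, ∑ j ∈ Finset.Icc 1 n, ENNReal.ofReal (flow (X ω) (Pi.single i 1) r j ^ q) ∂μ
      = ENNReal.ofReal (gammaRatio (echoMoment ν q) n / gammaRatio (echoMoment ν q) r) := by
  have hm : 0 ≤ echoMoment ν q := echoMoment_nonneg hν q
  have hr : 1 ≤ r := hi1.trans hir
  induction n, hrn using Nat.le_induction with
  | base =>
    have h1 : ∀ ω, ∑ j ∈ Finset.Icc 1 r, ENNReal.ofReal (flow (X ω) (Pi.single i 1) r j ^ q) = 1 := by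
      intro ω
      have h2 : ∀ j ∈ Finset.Icc 1 r, ENNReal.ofReal (flow (X ω) (Pi.single i 1) r j ^ q)
          = if j = i then 1 else 0 := by
        intro j hj
        rw [flow_of_le _ _ (Finset.mem_Icc.1 hj).2]
        by_cases hji : j = i
        · subst hji; simp
        · simp [hji, Real.zero_rpow hq.ne']
      rw [Finset.sum_congr rfl h2]
      simp [hi1, hir]
    simp only [h1]
    rw [div_self (gammaRatio_pos hm hr).ne']
    simp
  | succ n hrn ih =>
    have h1 := h.lintegral_flow_succ hν i hr hrn (F := fun _ => 1) measurable_const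
      (fun _ => rfl) q
    simp only [one_mul] at h1
    have hn : (0 : ℝ) < n := by exact_mod_cast hr.trans hrn
    have h2 : ∀ ω, ∑ j ∈ Finset.Icc 1 (n + 1), ENNReal.ofReal (flow (X ω) (Pi.single i 1) r j ^ q)
        = ∑ j ∈ Finset.Icc 1 n, ENNReal.ofReal (flow (X ω) (Pi.single i 1) r j ^ q)
          + ENNReal.ofReal (flow (X ω) (Pi.single i 1) r (n + 1) ^ q) := fun ω =>
      Finset.sum_Icc_succ_top (by omega) _
    rw [lintegral_congr h2, lintegral_add_right _ ((h.measurable_flow _ r _).pow_const q).ennreal_ofReal,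
      h1, ih, lintegral_rpow_eq hν hi, gammaRatio_succ hm (hr.trans hrn), mul_div_assoc, add_mul,
      one_mul]
    have h3 := gammaRatio_pos hm (hr.trans hrn)
    have h4 := gammaRatio_pos hm hr
    rw [ENNReal.ofReal_add (by positivity) (by positivity), ENNReal.ofReal_mul (by positivity),
      ENNReal.ofReal_div_of_pos hn, ENNReal.ofReal_natCast, div_eq_mul_inv (ENNReal.ofReal _),
      mul_comm (n : ENNReal)⁻¹]

/-- One step of the recursion for the `q`-th moment of the total mass. -/
theorem IsGrowth.lintegral_flowSum_rpow_succ_le [IsProbabilityMeasure ν] [IsProbabilityMeasure μ]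
    (h : IsGrowth ν X μ) (hν : ∀ᵐ t ∂ν, 0 ≤ t) (hint : Integrable (fun t : ℝ => t) ν)
    {q : ℝ} (hq : 1 < q) (hi : Integrable (fun t : ℝ => t ^ q) ν)
    {i r n : ℕ} (hi1 : 1 ≤ i) (hir : i ≤ r) (hrn : r ≤ n) {l : ℝ} (hl : 0 < l) (hl1 : l ≤ 1) :
    ∫⁻ ω, ENNReal.ofReal (flowSum (X ω) (Pi.single i 1) r (n + 1) ^ q) ∂μ
      ≤ ENNReal.ofReal (1 + q * (1 + l) ^ (q - 1) * ((∫ t, t ∂ν) / n)) *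
          ∫⁻ ω, ENNReal.ofReal (flowSum (X ω) (Pi.single i 1) r n ^ q) ∂μ
        + ENNReal.ofReal ((2 / l) ^ q * (echoMoment ν q / n) *
          (gammaRatio (echoMoment ν q) n / gammaRatio (echoMoment ν q) r)) := by
  have hm : 0 ≤ ∫ t, t ∂ν := integral_nonneg_of_ae hν
  have hmq : 0 ≤ echoMoment ν q := echoMoment_nonneg hν q
  have hr : 1 ≤ r := hi1.trans hir
  have hn : (0 : ℝ) < n := by exact_mod_cast hr.trans hrn
  set S : Ω → ℝ := fun ω => flowSum (X ω) (Pi.single i 1) r n with hS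
  set W : Ω → ℝ := fun ω => flow (X ω) (Pi.single i 1) r (n + 1) with hW
  have hSm : Measurable S := h.measurable_flowSum _ r n
  have hWm : Measurable W := h.measurable_flow _ r (n + 1)
  have hS0 : ∀ ω, 0 ≤ S ω := fun ω => h.flowSum_nonneg ω i hr n
  have hW0 : ∀ ω, 0 ≤ W ω := fun ω => h.flow_nonneg ω i hr _
  have h1 : ∀ ω, ENNReal.ofReal (flowSum (X ω) (Pi.single i 1) r (n + 1) ^ q)
      ≤ ENNReal.ofReal (S ω ^ q) + ENNReal.ofReal (q * (1 + l) ^ (q - 1)) *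
          (ENNReal.ofReal (S ω ^ (q - 1)) * ENNReal.ofReal (W ω ^ (1 : ℝ)))
        + ENNReal.ofReal ((2 / l) ^ q) * (1 * ENNReal.ofReal (W ω ^ q)) := by
    intro ω
    have := hS0 ω
    have := hW0 ω
    rw [flowSum_succ, one_mul, Real.rpow_one, ← ENNReal.ofReal_mul (by positivity),
      ← ENNReal.ofReal_mul (by positivity), ← ENNReal.ofReal_mul (by positivity),
      ← ENNReal.ofReal_add (by positivity) (by positivity),
      ← ENNReal.ofReal_add (by positivity) (by positivity)]
    exact ENNReal.ofReal_le_ofReal (add_rpow_le (hS0 ω) (hW0 ω) hq hl hl1)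
  have h2 := h.lintegral_flow_succ hν i hr hrn
    (F := fun x => ENNReal.ofReal (flowSum x (Pi.single i 1) r n ^ (q - 1)))
    ((_root_.measurable_flowSum _ r n).pow_const _).ennreal_ofReal
    (fun x => by simp only [flowSum_past hr x _ le_rfl]) 1
  have h3 := h.lintegral_flow_succ hν i hr hrn (F := fun _ => 1) measurable_const
    (fun _ => rfl) q
  simp only [one_mul] at h3
  rw [h.lintegral_sum_rpow hν (by linarith) hi hi1 hir hrn, lintegral_rpow_eq hν hi] at h3
  have h4 : ∀ ω, ENNReal.ofReal (flowSum (X ω) (Pi.single i 1) r n ^ (q - 1)) *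
      ∑ j ∈ Finset.Icc 1 n, ENNReal.ofReal (flow (X ω) (Pi.single i 1) r j ^ (1 : ℝ))
      = ENNReal.ofReal (S ω ^ q) := by
    intro ω
    simp only [Real.rpow_one]
    rw [← ENNReal.ofReal_sum_of_nonneg fun j _ => h.flow_nonneg ω i hr j,
      ← ENNReal.ofReal_mul (Real.rpow_nonneg (hS0 ω) _)]
    congr 1
    -- The linear term of the expansion reproduces the `q`-th power of the total, which is what
    -- closes the recursion.
    change S ω ^ (q - 1) * S ω = S ω ^ q
    rw [← Real.rpow_add_one' (hS0 ω) (by linarith)]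
    congr 1; ring
  rw [lintegral_congr h4, lintegral_rpow_one hν hint] at h2
  refine (lintegral_mono h1).trans ?_
  have hm1 : Measurable fun ω => ENNReal.ofReal (S ω ^ q) := (hSm.pow_const q).ennreal_ofReal
  have hm2 : Measurable fun ω => ENNReal.ofReal (S ω ^ (q - 1)) * ENNReal.ofReal (W ω ^ (1 : ℝ)) :=
    (hSm.pow_const _).ennreal_ofReal.mul (hWm.pow_const _).ennreal_ofReal
  have hm3 : Measurable fun ω => 1 * ENNReal.ofReal (W ω ^ q) :=
    (hWm.pow_const q).ennreal_ofReal.const_mul _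
  rw [lintegral_add_right _ (hm3.const_mul _), lintegral_add_left hm1, lintegral_const_mul _ hm2,
    lintegral_const_mul _ hm3]
  simp only [one_mul]
  rw [h2, h3, ENNReal.ofReal_add zero_le_one (by positivity), ENNReal.ofReal_one, add_mul, one_mul,
    ENNReal.ofReal_mul (p := q * (1 + l) ^ (q - 1)) (by positivity), ENNReal.ofReal_div_of_pos hn,
    ENNReal.ofReal_natCast, ENNReal.ofReal_mul (p := (2 / l) ^ q * (echoMoment ν q / n)) (by positivity),
    ENNReal.ofReal_mul (p := (2 / l) ^ q) (by positivity),
    ENNReal.ofReal_div_of_pos (x := echoMoment ν q) hn, ENNReal.ofReal_natCast]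
  refine le_of_eq ?_
  simp only [div_eq_mul_inv]
  ring

end IsGrowth

section IsGrowth

variable {Ω : Type*} [MeasurableSpace Ω] {ν : Measure ℝ} {X : Ω → ℕ → ℝ × ℕ} {μ : Measure Ω}

theorem one_add_rpow_sub_one_le {l q : ℝ} (hq : 1 < q) (hl : 0 < l) (hl1 : l ≤ 1) :
    (1 + l) ^ (q - 1) ≤ 1 + q * 2 ^ q * l := by
  have h1 : (1 + l) ^ (q - 1) ≤ (1 + l) ^ q :=
    Real.rpow_le_rpow_of_exponent_le (by linarith) (by linarith)
  have h2 : (1 + l) ^ (q - 1) ≤ 2 ^ q :=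
    h1.trans (Real.rpow_le_rpow (by linarith) (by linarith) (by linarith))
  have h3 := one_add_rpow_le hl.le hq.le
  have h4 : q * l * (1 + l) ^ (q - 1) ≤ q * l * 2 ^ q := by gcongr
  linarith

theorem IsGrowth.lintegral_flowSum_rpow_lt_top [IsProbabilityMeasure ν] [IsProbabilityMeasure μ]
    (h : IsGrowth ν X μ) (hν : ∀ᵐ t ∂ν, 0 ≤ t) (hint : Integrable (fun t : ℝ => t) ν)
    {q : ℝ} (hq : 1 < q) (hi : Integrable (fun t : ℝ => t ^ q) ν)
    {i r n : ℕ} (hi1 : 1 ≤ i) (hir : i ≤ r) (hrn : r ≤ n) :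
    ∫⁻ ω, ENNReal.ofReal (flowSum (X ω) (Pi.single i 1) r n ^ q) ∂μ < ⊤ := by
  induction n, hrn using Nat.le_induction with
  | base => simp [flowSum_single _ hi1 hir]
  | succ n hrn ih =>
    refine (h.lintegral_flowSum_rpow_succ_le hν hint hq hi hi1 hir hrn one_pos le_rfl).trans_lt ?_
    exact ENNReal.add_lt_top.2 ⟨ENNReal.mul_lt_top ENNReal.ofReal_lt_top ih, ENNReal.ofReal_lt_top⟩

/-- If `𝔼 ξ^q < q 𝔼 ξ`, the `q`-th moments of the normalized total masses are bounded. -/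
theorem IsGrowth.exists_lintegral_flowSum_rpow_le [IsProbabilityMeasure ν] [IsProbabilityMeasure μ]
    (h : IsGrowth ν X μ) (hν : ∀ᵐ t ∂ν, 0 ≤ t) (hint : Integrable (fun t : ℝ => t) ν)
    {q : ℝ} (hq : 1 < q) (hi : Integrable (fun t : ℝ => t ^ q) ν)
    (hlt : echoMoment ν q < q * ∫ t, t ∂ν)
    {i r : ℕ} (hi1 : 1 ≤ i) (hir : i ≤ r) : ∃ D : ℝ, ∀ k : ℕ,
      ∫⁻ ω, ENNReal.ofReal (flowSum (X ω) (Pi.single i 1) r (r + k) ^ q) ∂μ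
        ≤ ENNReal.ofReal (D * gammaRatio (q * ∫ t, t ∂ν) (r + k)) := by
  have hm : 0 ≤ ∫ t, t ∂ν := integral_nonneg_of_ae hν
  have hmq : 0 ≤ echoMoment ν q := echoMoment_nonneg hν q
  have hr : 1 ≤ r := hi1.trans hir
  set m := ∫ t, t ∂ν
  set θ := echoMoment ν q
  have hq0 : 0 < q := by linarith
  have hqm : 0 ≤ q * m := by positivity
  -- With `l = N ^ (-κ)` at time `N`, the excess in the linear coefficient is of order `N ^ (-1 -
  -- κ)`. Since `κ q` is half the gap `q m - θ`, the factor `(2 / l) ^ q` uses up only half of it,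
  -- and the normalized correction is of order `N ^ (-1 - (q m - θ) / 2)`. Both are summable.
  set κ := (q * m - θ) / (2 * q) with hκ
  have hκ0 : 0 < κ := div_pos (by linarith) (by linarith)
  obtain ⟨D₁, hD₁, hb₁⟩ := gammaRatio_bounds hqm
  obtain ⟨D₂, hD₂, hb₂⟩ := gammaRatio_bounds hmq
  set α : ℕ → ℝ := fun k =>
    (∫⁻ ω, ENNReal.ofReal (flowSum (X ω) (Pi.single i 1) r (r + k) ^ q) ∂μ).toReal with hα
  have hfin : ∀ k, ∫⁻ ω, ENNReal.ofReal (flowSum (X ω) (Pi.single i 1) r (r + k) ^ q) ∂μ ≠ ⊤ :=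
    fun k => (h.lintegral_flowSum_rpow_lt_top hν hint hq hi hi1 hir (by omega)).ne
  have hgpos : ∀ k, 0 < gammaRatio (q * m) (r + k) := fun k => gammaRatio_pos hqm (by omega)
  have hg2pos : ∀ k, 0 < gammaRatio θ (r + k) := fun k => gammaRatio_pos hmq (by omega)
  have hnpos : ∀ k, (0 : ℝ) < ((r + k : ℕ) : ℝ) := fun k => by
    exact_mod_cast (by omega : 0 < r + k)
  set u : ℕ → ℝ := fun k => q * m * (q * 2 ^ q) * ((r + k : ℕ) : ℝ) ^ (-1 - κ) with hu
  set v : ℕ → ℝ := fun k => 2 ^ q * θ * D₂ * D₁ / gammaRatio θ r *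
    ((r + k : ℕ) : ℝ) ^ (-1 - (q * m - θ) / 2) with hv
  have hsum : ∀ s : ℝ, s < -1 → Summable fun k : ℕ => ((r + k : ℕ) : ℝ) ^ s := by
    intro s hs
    have := (summable_nat_add_iff r).2 (Real.summable_nat_rpow.2 hs)
    simpa only [add_comm r] using this
  have hgr : 0 < gammaRatio θ r := gammaRatio_pos hmq hr
  have hrec : ∀ k, α (k + 1) / gammaRatio (q * m) (r + (k + 1))
      ≤ (1 + u k) * (α k / gammaRatio (q * m) (r + k)) + v k := by
    intro k
    set N : ℝ := ((r + k : ℕ) : ℝ) with hN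
    have hN0 : 0 < N := hnpos k
    have hN1 : 1 ≤ N := by rw [hN]; exact_mod_cast (by omega : 1 ≤ r + k)
    set l : ℝ := N ^ (-κ) with hl
    have hl0 : 0 < l := by positivity
    have hl1 : l ≤ 1 := Real.rpow_le_one_of_one_le_of_nonpos hN1 (by linarith)
    have h1 := h.lintegral_flowSum_rpow_succ_le hν hint hq hi hi1 hir (n := r + k) (by omega) hl0 hl1
    have hα0 : 0 ≤ α k := ENNReal.toReal_nonneg
    have hg := hgpos k
    have hg2 := hg2pos k
    have h2 : α (k + 1) ≤ (1 + q * (1 + l) ^ (q - 1) * (m / N)) * α k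
        + (2 / l) ^ q * (θ / N) * (gammaRatio θ (r + k) / gammaRatio θ r) := by
      have h3 := ENNReal.toReal_mono (ENNReal.add_ne_top.2
        ⟨ENNReal.mul_ne_top ENNReal.ofReal_ne_top (hfin k), ENNReal.ofReal_ne_top⟩) h1
      rw [ENNReal.toReal_add (ENNReal.mul_ne_top ENNReal.ofReal_ne_top (hfin k))
        ENNReal.ofReal_ne_top, ENNReal.toReal_mul, ENNReal.toReal_ofReal (by positivity),
        ENNReal.toReal_ofReal (by positivity)] at h3
      exact h3
    have hgs : gammaRatio (q * m) (r + (k + 1)) = (1 + q * m / N) * gammaRatio (q * m) (r + k) :=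
      gammaRatio_succ hqm (n := r + k) (by omega)
    have hgs0 : gammaRatio (q * m) (r + k) ≤ gammaRatio (q * m) (r + (k + 1)) := by
      rw [hgs]
      have : 0 ≤ q * m / N := by positivity
      nlinarith
    have h3 : 1 + q * (1 + l) ^ (q - 1) * (m / N) ≤ (1 + u k) * (1 + q * m / N) := by
      have h4 := one_add_rpow_sub_one_le hq hl0 hl1
      have h5 : N ^ (-1 - κ) = l / N := by
        rw [hl, show -1 - κ = -κ - 1 by ring, Real.rpow_sub_one hN0.ne']
      have h6 : q * (1 + l) ^ (q - 1) * (m / N) ≤ q * (1 + q * 2 ^ q * l) * (m / N) := by gcongr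
      have h7 : u k = q * m * (q * 2 ^ q) * (l / N) := by rw [← h5]
      have h8 : 0 ≤ u k * (q * m / N) := by rw [h7]; positivity
      have h9 : q * (1 + q * 2 ^ q * l) * (m / N) = q * m / N + u k := by rw [h7]; ring
      nlinarith
    have h4 : (2 / l) ^ q * (θ / N) * (gammaRatio θ (r + k) / gammaRatio θ r)
        ≤ v k * gammaRatio (q * m) (r + k) := by
      have h5 : (2 / l) ^ q = 2 ^ q * N ^ (κ * q) := by
        rw [Real.div_rpow zero_le_two hl0.le, hl, ← Real.rpow_mul hN0.le, neg_mul,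
          Real.rpow_neg hN0.le, div_inv_eq_mul]
      have h6 := (hb₂ (r + k) (by omega)).1
      have h7 := (hb₁ (r + k) (by omega)).2
      have h8 : N ^ (κ * q) * N ^ θ / N = N ^ (-1 - (q * m - θ) / 2) * N ^ (q * m) := by
        rw [← Real.rpow_add hN0, ← Real.rpow_add hN0, ← Real.rpow_sub_one hN0.ne']
        congr 1
        rw [hκ]; field_simp; ring
      calc (2 / l) ^ q * (θ / N) * (gammaRatio θ (r + k) / gammaRatio θ r)
          ≤ (2 / l) ^ q * (θ / N) * ((D₂ * N ^ θ) / gammaRatio θ r) := by gcongr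
        _ = 2 ^ q * θ * D₂ / gammaRatio θ r * (N ^ (κ * q) * N ^ θ / N) := by rw [h5]; ring
        _ = 2 ^ q * θ * D₂ / gammaRatio θ r * (N ^ (-1 - (q * m - θ) / 2) * N ^ (q * m)) := by rw [h8]
        _ ≤ 2 ^ q * θ * D₂ / gammaRatio θ r *
            (N ^ (-1 - (q * m - θ) / 2) * (D₁ * gammaRatio (q * m) (r + k))) := by gcongr
        _ = v k * gammaRatio (q * m) (r + k) := by simp only [hv]; ring
    have hv0 : 0 ≤ v k := by simp only [hv]; positivity
    rw [div_le_iff₀ (hgpos (k + 1))]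
    refine h2.trans ?_
    rw [add_mul ((1 + u k) * _)]
    refine add_le_add ?_ (h4.trans (mul_le_mul_of_nonneg_left hgs0 hv0))
    rw [hgs]
    refine (mul_le_mul_of_nonneg_right h3 hα0).trans (le_of_eq ?_)
    field_simp
  obtain ⟨D, hD⟩ := bounded_of_le_one_add_mul_add
    (y := fun k => α k / gammaRatio (q * m) (r + k)) (u := u) (v := v)
    (fun k => by simp only [hu]; positivity)
    (fun k => by simp only [hv]; positivity)
    ((hsum _ (by linarith)).mul_left _) ((hsum _ (by linarith)).mul_left _)
    (fun k => div_nonneg ENNReal.toReal_nonneg (hgpos k).le) hrec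
  refine ⟨D, fun k => ?_⟩
  rw [← ENNReal.ofReal_toReal (hfin k)]
  refine ENNReal.ofReal_le_ofReal ?_
  rw [← div_le_iff₀ (hgpos k)]
  exact hD k

theorem eLpNorm_ofReal_eq {f : Ω → ℝ} (hf : ∀ ω, 0 ≤ f ω) {q : ℝ} (hq : 0 < q) :
    eLpNorm f (ENNReal.ofReal q) μ = (∫⁻ ω, ENNReal.ofReal (f ω ^ q) ∂μ) ^ (1 / q) := by
  rw [eLpNorm_eq_lintegral_rpow_enorm_toReal (by simpa using hq) ENNReal.ofReal_ne_top,
    ENNReal.toReal_ofReal hq.le]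
  congr 1
  refine lintegral_congr fun ω => ?_
  rw [Real.enorm_of_nonneg (hf ω), ENNReal.ofReal_rpow_of_nonneg (hf ω) hq.le]

theorem IsGrowth.memLp_flowSum [IsProbabilityMeasure ν] [IsProbabilityMeasure μ]
    (h : IsGrowth ν X μ) (hν : ∀ᵐ t ∂ν, 0 ≤ t) (hint : Integrable (fun t : ℝ => t) ν)
    {q : ℝ} (hq : 1 < q) (hi : Integrable (fun t : ℝ => t ^ q) ν)
    {i r : ℕ} (hi1 : 1 ≤ i) (hir : i ≤ r) (n : ℕ) :
    MemLp (fun ω => flowSum (X ω) (Pi.single i 1) r n) (ENNReal.ofReal q) μ := by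
  rcases le_total r n with hn | hn
  · refine ⟨(h.measurable_flowSum _ r n).aestronglyMeasurable, ?_⟩
    rw [eLpNorm_ofReal_eq (fun ω => h.flowSum_nonneg ω i (hi1.trans hir) n) (by linarith)]
    exact ENNReal.rpow_lt_top_of_nonneg (by positivity)
      (h.lintegral_flowSum_rpow_lt_top hν hint hq hi hi1 hir hn).ne
  · have h1 : (fun ω => flowSum (X ω) (Pi.single i 1) r n)
        = fun _ => ∑ j ∈ Finset.Icc 1 n, (Pi.single i 1 : ℕ → ℝ) j := by
      funext ω
      exact Finset.sum_congr rfl fun j hj => flow_of_le _ _ ((Finset.mem_Icc.1 hj).2.trans hn)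
    rw [h1]
    exact memLp_const _

theorem IsGrowth.exists_eLpNorm_massRatio_le [IsProbabilityMeasure ν] [IsProbabilityMeasure μ]
    (h : IsGrowth ν X μ) (hν : ∀ᵐ t ∂ν, 0 ≤ t) (hint : Integrable (fun t : ℝ => t) ν)
    {q : ℝ} (hq : 1 < q) (hi : Integrable (fun t : ℝ => t ^ q) ν)
    (hlt : echoMoment ν q < q * ∫ t, t ∂ν)
    {i r : ℕ} (hi1 : 1 ≤ i) (hir : i ≤ r) : ∃ R : NNReal, ∀ k : ℕ,
      eLpNorm (massRatio ν X i r k) (ENNReal.ofReal q) μ ≤ R := by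
  have hm : 0 ≤ ∫ t, t ∂ν := integral_nonneg_of_ae hν
  have hr : 1 ≤ r := hi1.trans hir
  have hq0 : 0 < q := by linarith
  obtain ⟨D, hD⟩ := h.exists_lintegral_flowSum_rpow_le hν hint hq hi hlt hi1 hir
  obtain ⟨D₁, hD₁, hb₁⟩ := gammaRatio_bounds hm
  obtain ⟨D₂, hD₂, hb₂⟩ := gammaRatio_bounds (show 0 ≤ q * ∫ t, t ∂ν by positivity)
  refine ⟨(ENNReal.ofReal (max D 0 * D₂ * D₁ ^ q) ^ (1 / q)).toNNReal, fun k => ?_⟩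
  rw [ENNReal.coe_toNNReal
    (ENNReal.rpow_lt_top_of_nonneg (by positivity) ENNReal.ofReal_ne_top).ne,
    eLpNorm_ofReal_eq (fun ω => massRatio_nonneg h hν i hr k ω) hq0]
  refine ENNReal.rpow_le_rpow ?_ (by positivity)
  have hg := gammaRatio_pos hm (show 1 ≤ r + k by omega)
  have h1 : ∀ ω, ENNReal.ofReal (massRatio ν X i r k ω ^ q)
      = ENNReal.ofReal (flowSum (X ω) (Pi.single i 1) r (r + k) ^ q) *
        ENNReal.ofReal ((gammaRatio (∫ t, t ∂ν) (r + k) ^ q)⁻¹) := by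
    intro ω
    have h2 := h.flowSum_nonneg ω i hr (r + k)
    rw [← ENNReal.ofReal_mul (by positivity), massRatio, Real.div_rpow h2 hg.le, div_eq_mul_inv]
  rw [lintegral_congr h1, lintegral_mul_const _ ((h.measurable_flowSum _ r _).pow_const q).ennreal_ofReal]
  refine (mul_le_mul_left (hD k) _).trans ?_
  have hN : (0 : ℝ) < ((r + k : ℕ) : ℝ) := by exact_mod_cast (by omega : 0 < r + k)
  rw [← ENNReal.ofReal_mul' (by positivity)]
  refine ENNReal.ofReal_le_ofReal ?_
  rw [← div_eq_mul_inv, div_le_iff₀ (by positivity)]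
  have h3 := (hb₂ (r + k) (by omega)).1
  have h4 := Real.rpow_le_rpow (by positivity) (hb₁ (r + k) (by omega)).2 hq0.le
  rw [Real.mul_rpow hD₁.le hg.le, ← Real.rpow_mul hN.le, mul_comm _ q] at h4
  have hg2 := gammaRatio_pos (show 0 ≤ q * ∫ t, t ∂ν by positivity) (show 1 ≤ r + k by omega)
  calc D * gammaRatio (q * ∫ t, t ∂ν) (r + k)
      ≤ max D 0 * (D₂ * (D₁ ^ q * gammaRatio (∫ t, t ∂ν) (r + k) ^ q)) := by
        refine mul_le_mul (le_max_left _ _) (h3.trans ?_) hg2.le (le_max_right _ _)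
        gcongr
    _ = max D 0 * D₂ * D₁ ^ q * gammaRatio (∫ t, t ∂ν) (r + k) ^ q := by ring

/-- `L^q` convergence of the normalized masses to a limit that closes the martingale. -/
theorem IsGrowth.memLp_limitMass_and_tendsto [IsProbabilityMeasure ν] [IsProbabilityMeasure μ]
    (h : IsGrowth ν X μ) (hν : ∀ᵐ t ∂ν, 0 ≤ t) (hint : Integrable (fun t : ℝ => t) ν)
    {q : ℝ} (hq : 1 < q) (hi : Integrable (fun t : ℝ => t ^ q) ν)
    (hlt : echoMoment ν q < q * ∫ t, t ∂ν)
    {i r : ℕ} (hi1 : 1 ≤ i) (hir : i ≤ r) :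
    MemLp (h.limitMass i r) (ENNReal.ofReal q) μ ∧
    (∀ k, massRatio ν X i r k =ᵐ[μ] μ[h.limitMass i r | h.filtration r k]) ∧
    Tendsto (fun k => eLpNorm (massRatio ν X i r k - h.limitMass i r) (ENNReal.ofReal q) μ)
      atTop (𝓝 0) := by
  obtain ⟨R, hR⟩ := h.exists_eLpNorm_massRatio_le hν hint hq hi hlt hi1 hir
  exact Martingale.tendsto_eLpNorm_of_bdd (h.martingale_massRatio hν hint hi1 hir) hq hR
    (h.tendsto_massRatio hν hint hi1 hir)

theorem IsGrowth.integral_limitMass [IsProbabilityMeasure ν] [IsProbabilityMeasure μ]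
    (h : IsGrowth ν X μ) (hν : ∀ᵐ t ∂ν, 0 ≤ t) (hint : Integrable (fun t : ℝ => t) ν)
    {q : ℝ} (hq : 1 < q) (hi : Integrable (fun t : ℝ => t ^ q) ν)
    (hlt : echoMoment ν q < q * ∫ t, t ∂ν)
    {i r : ℕ} (hi1 : 1 ≤ i) (hir : i ≤ r) :
    ∫ ω, h.limitMass i r ω ∂μ = (gammaRatio (∫ t, t ∂ν) r)⁻¹ := by
  have h1 := (h.memLp_limitMass_and_tendsto hν hint hq hi hlt hi1 hir).2.1 0
  rw [← h.integral_massRatio hν hint hi1 hir 0, integral_congr_ae h1, integral_condExp]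

theorem eLpNorm_const_smul_real (c : ℝ) (f : Ω → ℝ) (p : ENNReal) :
    eLpNorm (fun ω => c * f ω) p μ = ENNReal.ofReal |c| * eLpNorm f p μ := by
  have := eLpNorm_const_smul c f p μ
  rw [Real.enorm_eq_ofReal_abs] at this
  exact this

theorem IsGrowth.tendsto_eLpNorm_flowSum [IsProbabilityMeasure ν] [IsProbabilityMeasure μ]
    (h : IsGrowth ν X μ) (hν : ∀ᵐ t ∂ν, 0 ≤ t) (hint : Integrable (fun t : ℝ => t) ν)
    {q : ℝ} (hq : 1 < q) (hi : Integrable (fun t : ℝ => t ^ q) ν)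
    (hlt : echoMoment ν q < q * ∫ t, t ∂ν)
    {i r : ℕ} (hi1 : 1 ≤ i) (hir : i ≤ r) :
    Tendsto (fun n : ℕ => eLpNorm (fun ω => flowSum (X ω) (Pi.single i 1) r n / (n : ℝ) ^ (∫ t, t ∂ν)
      - h.limitMass i r ω) (ENNReal.ofReal q) μ) atTop (𝓝 0) := by
  have hm : 0 ≤ ∫ t, t ∂ν := integral_nonneg_of_ae hν
  obtain ⟨hL, -, ht⟩ := h.memLp_limitMass_and_tendsto hν hint hq hi hlt hi1 hir
  have h1 : (1 : ENNReal) ≤ ENNReal.ofReal q := by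
    rw [← ENNReal.ofReal_one]; exact ENNReal.ofReal_le_ofReal hq.le
  rw [← tendsto_add_atTop_iff_nat r]
  set c : ℕ → ℝ := fun k => gammaRatio (∫ t, t ∂ν) (k + r) / ((k + r : ℕ) : ℝ) ^ (∫ t, t ∂ν)
  have hc : Tendsto c atTop (𝓝 1) := (tendsto_gammaRatio hm).comp (tendsto_add_atTop_nat r)
  have h2 : ∀ k : ℕ, (fun ω => flowSum (X ω) (Pi.single i 1) r (k + r) /
        ((k + r : ℕ) : ℝ) ^ (∫ t, t ∂ν) - h.limitMass i r ω)
      = (fun ω => c k * (massRatio ν X i r k - h.limitMass i r) ω)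
        + fun ω => (c k - 1) * h.limitMass i r ω := by
    intro k
    funext ω
    have := gammaRatio_pos hm (show 1 ≤ k + r by omega)
    simp only [massRatio, c, Pi.add_apply, Pi.sub_apply]
    rw [add_comm r k]
    field_simp
    ring
  have h3 : Tendsto (fun k => ENNReal.ofReal |c k| *
      eLpNorm (massRatio ν X i r k - h.limitMass i r) (ENNReal.ofReal q) μ
      + ENNReal.ofReal |c k - 1| * eLpNorm (h.limitMass i r) (ENNReal.ofReal q) μ) atTop (𝓝 0) := by
    have h4 := ENNReal.Tendsto.mul (ENNReal.tendsto_ofReal hc.abs) (Or.inr ENNReal.zero_ne_top) ht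
      (Or.inr ENNReal.ofReal_ne_top)
    have h5 := ENNReal.Tendsto.mul_const (b := eLpNorm (h.limitMass i r) (ENNReal.ofReal q) μ)
      (ENNReal.tendsto_ofReal (hc.sub_const 1).abs) (Or.inr hL.2.ne)
    have := h4.add h5
    simpa using this
  refine tendsto_of_tendsto_of_tendsto_of_le_of_le tendsto_const_nhds h3 (fun _ => zero_le) fun k => ?_
  have hmr := ((h.martingale_massRatio hν hint hi1 hir).integrable k).aestronglyMeasurable
  simp only
  rw [h2, ← eLpNorm_const_smul_real, ← eLpNorm_const_smul_real]
  exact eLpNorm_add_le ((hmr.sub hL.1).const_mul _) (hL.1.const_mul _) h1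

end IsGrowth

/-! ### Descendants of a vertex and their weights -/

/-- The same tree, with all echo variables equal to `1`. -/
noncomputable def unitEcho (x : ℕ → ℝ × ℕ) (n : ℕ) : ℝ × ℕ := (1, (x n).2)

open scoped Classical in
/-- The descendants, at time `n`, of the vertex `i ≤ r` through vertices larger than `r`. -/
noncomputable def descendants (x : ℕ → ℝ × ℕ) (i r n : ℕ) : Finset ℕ :=
  (Finset.Icc 1 n).filter fun j => flow (unitEcho x) (Pi.single i 1) r j ≠ 0

/-- The multiset of the weights of the descendants of the vertex `i`. -/
noncomputable def population (x : ℕ → ℝ × ℕ) (i r n : ℕ) : Multiset ℝ :=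
  (descendants x i r n).val.map (flow x (Pi.single i 1) r)

theorem IsRecursive.unitEcho {x : ℕ → ℝ × ℕ} (hx : IsRecursive x) : IsRecursive (unitEcho x) := hx

theorem mem_descendants {x : ℕ → ℝ × ℕ} {i r n j : ℕ} : j ∈ descendants x i r n ↔
    (1 ≤ j ∧ j ≤ n) ∧ flow (unitEcho x) (Pi.single i 1) r j ≠ 0 := by
  simp [descendants]

theorem descendants_succ {x : ℕ → ℝ × ℕ} (hx : IsRecursive x) (i : ℕ) {r n : ℕ} (hr : 1 ≤ r)
    (hrn : r ≤ n) : descendants x i r (n + 1) = if (x (n + 1)).2 ∈ descendants x i r n then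
      insert (n + 1) (descendants x i r n) else descendants x i r n := by
  have hU := hx (n + 1) (by omega)
  have h1 : flow (unitEcho x) (Pi.single i 1) r (n + 1)
      = flow (unitEcho x) (Pi.single i 1) r (x (n + 1)).2 := by
    rw [flow_of_lt hx.unitEcho _ hr (by omega)]
    exact one_mul _
  have h2 : (x (n + 1)).2 ∈ descendants x i r n ↔
      flow (unitEcho x) (Pi.single i 1) r (n + 1) ≠ 0 := by
    rw [mem_descendants, h1]
    exact and_iff_right ⟨hU.1, by omega⟩
  ext j
  by_cases h : (x (n + 1)).2 ∈ descendants x i r n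
  · rw [if_pos h, Finset.mem_insert, mem_descendants, mem_descendants]
    have h3 := h2.1 h
    constructor
    · rintro ⟨h4, h5⟩
      by_cases hj : j = n + 1
      · exact Or.inl hj
      · exact Or.inr ⟨⟨h4.1, by omega⟩, h5⟩
    · rintro (rfl | ⟨h4, h5⟩)
      · exact ⟨⟨by omega, le_rfl⟩, h3⟩
      · exact ⟨⟨h4.1, by omega⟩, h5⟩
  · rw [if_neg h, mem_descendants, mem_descendants]
    constructor
    · rintro ⟨h4, h5⟩
      have hj : j ≠ n + 1 := by
        rintro rfl
        exact h (h2.2 h5)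
      exact ⟨⟨h4.1, by omega⟩, h5⟩
    · rintro ⟨h4, h5⟩
      exact ⟨⟨h4.1, by omega⟩, h5⟩

theorem population_succ {x : ℕ → ℝ × ℕ} (hx : IsRecursive x) (i : ℕ) {r n : ℕ} (hr : 1 ≤ r)
    (hrn : r ≤ n) : population x i r (n + 1) = if (x (n + 1)).2 ∈ descendants x i r n then
      ((x (n + 1)).1 * flow x (Pi.single i 1) r (x (n + 1)).2) ::ₘ population x i r n
      else population x i r n := by
  rw [population, descendants_succ hx i hr hrn]
  split_ifs
  · rw [Finset.insert_val_of_notMem (by simp [mem_descendants]), Multiset.map_cons,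
      flow_of_lt hx _ hr (by omega), population]
  · rw [population]

theorem card_population (x : ℕ → ℝ × ℕ) (i r n : ℕ) :
    Multiset.card (population x i r n) = (descendants x i r n).card := by
  simp [population]

/-- Descendants are defined by genealogy alone, so a population may contain zero weights, but no
mass lies outside it. -/
theorem flow_eq_zero_of_unitEcho {x : ℕ → ℝ × ℕ} {i r j : ℕ}
    (h : flow (unitEcho x) (Pi.single i 1) r j = 0) : flow x (Pi.single i 1) r j = 0 := by
  induction j using Nat.strong_induction_on with
  | _ j ih =>
    rw [flow] at h ⊢
    have h1 : (unitEcho x j).2 = (x j).2 := rfl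
    rw [h1] at h
    split_ifs at h ⊢ with h2
    · rw [unitEcho, one_mul] at h
      rw [ih _ h2.2 h, mul_zero]
    · exact h

theorem sum_population (x : ℕ → ℝ × ℕ) (i r n : ℕ) :
    (population x i r n).sum = flowSum x (Pi.single i 1) r n := by
  classical
  rw [population, flowSum]
  change ∑ j ∈ descendants x i r n, flow x (Pi.single i 1) r j = _
  rw [descendants, Finset.sum_filter]
  refine Finset.sum_congr rfl fun j _ => ?_
  split_ifs with h
  · rfl
  · exact (flow_eq_zero_of_unitEcho (not_not.1 h)).symm

theorem card_descendants (x : ℕ → ℝ × ℕ) (i : ℕ) {r : ℕ} (hr : 1 ≤ r) (n : ℕ) :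
    ((descendants x i r n).card : ℝ) = flowSum (unitEcho x) (Pi.single i 1) r n := by
  classical
  rw [descendants, flowSum, Finset.card_filter, Nat.cast_sum]
  refine Finset.sum_congr rfl fun j _ => ?_
  rcases flow_single_mem_zero_one (x := unitEcho x) (fun _ _ => rfl) i hr j with h | h <;> simp [h]

theorem descendants_single (x : ℕ → ℝ × ℕ) {i r : ℕ} (hi1 : 1 ≤ i) (hir : i ≤ r) :
    descendants x i r r = {i} := by
  ext j
  rw [mem_descendants, Finset.mem_singleton]
  constructor
  · rintro ⟨h1, h2⟩
    rw [flow_of_le _ _ h1.2] at h2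
    by_contra h
    simp [h] at h2
  · rintro rfl
    exact ⟨⟨hi1, hir⟩, by rw [flow_of_le _ _ hir]; simp⟩

theorem population_single (x : ℕ → ℝ × ℕ) {i r : ℕ} (hi1 : 1 ≤ i) (hir : i ≤ r) :
    population x i r r = {1} := by
  rw [population, descendants_single x hi1 hir]
  simp [flow_of_le _ _ hir]

theorem card_descendants_one {x : ℕ → ℝ × ℕ} (hx : IsRecursive x) (n : ℕ) :
    (descendants x 1 1 n).card = n := by
  have h1 : ∀ j, 1 ≤ j → flow (unitEcho x) (Pi.single 1 1) 1 j = 1 := by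
    intro j
    induction j using Nat.strong_induction_on with
    | _ j ih =>
      intro hj
      by_cases h : j = 1
      · subst h; rw [flow_of_le _ _ le_rfl]; simp
      · have h2 := hx j (by omega)
        rw [flow_of_lt hx.unitEcho _ le_rfl (by omega)]
        rw [show (unitEcho x j).2 = (x j).2 from rfl, ih _ h2.2 h2.1]
        simp [unitEcho]
  have h2 : descendants x 1 1 n = Finset.Icc 1 n := by
    ext j
    rw [mem_descendants, Finset.mem_Icc]
    exact ⟨fun h => h.1, fun h => ⟨h, by rw [h1 j h.1]; exact one_ne_zero⟩⟩
  simp [h2]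

/-! ### Measurability of symmetric functionals of a population -/

/-- Symmetric functions of finitely many weights, measurable in each number of weights. -/
def IsSymmMeasurable (φ : Multiset ℝ → ENNReal) : Prop :=
  ∀ s : Finset ℕ, Measurable fun w : ℕ → ℝ => φ (s.val.map w)

theorem IsSymmMeasurable.cons {φ : Multiset ℝ → ENNReal} (hφ : IsSymmMeasurable φ) (s : Finset ℕ) :
    Measurable fun q : ℝ × (ℕ → ℝ) => φ (q.1 ::ₘ s.val.map q.2) := by
  -- A fresh index `j` stores the added weight, which makes the enlarged multiset again the image of
  -- a finite set of indices.
  obtain ⟨j, hj⟩ := Infinite.exists_notMem_finset s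
  have h1 : ∀ q : ℝ × (ℕ → ℝ), q.1 ::ₘ s.val.map q.2
      = (insert j s).val.map (Function.update q.2 j q.1) := by
    intro q
    rw [Finset.insert_val_of_notMem hj, Multiset.map_cons, Function.update_self]
    congr 1
    refine Multiset.map_congr rfl fun k hk => ?_
    rw [Function.update_of_ne]
    rintro rfl
    exact hj hk
  simp only [h1]
  refine (hφ (insert j s)).comp (measurable_pi_iff.2 fun k => ?_)
  by_cases hk : k = j
  · subst hk; simp only [Function.update_self]; exact measurable_fst
  · simp only [Function.update_of_ne hk]
    exact (measurable_pi_apply k).comp measurable_snd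

/-- The (unnormalized) expected effect of adding a child to a uniformly chosen individual. -/
noncomputable def birth (ν : Measure ℝ) (φ : Multiset ℝ → ENNReal) (M : Multiset ℝ) : ENNReal :=
  (M.map fun w => ∫⁻ t, φ ((t * w) ::ₘ M) ∂ν).sum

theorem IsSymmMeasurable.birth {ν : Measure ℝ} [SFinite ν] {φ : Multiset ℝ → ENNReal}
    (hφ : IsSymmMeasurable φ) : IsSymmMeasurable (birth ν φ) := by
  intro s
  have h1 : (fun w : ℕ → ℝ => _root_.birth ν φ (s.val.map w))
      = fun w => ∑ i ∈ s, ∫⁻ t, φ ((t * w i) ::ₘ s.val.map w) ∂ν := by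
    funext w
    rw [_root_.birth, Multiset.map_map]
    rfl
  rw [h1]
  refine Finset.measurable_fun_sum _ fun i _ => ?_
  refine Measurable.lintegral_prod_right' (f := fun q : (ℕ → ℝ) × ℝ =>
    φ ((q.2 * q.1 i) ::ₘ s.val.map q.1)) ?_
  have h2 : Measurable fun q : (ℕ → ℝ) × ℝ => (q.2 * q.1 i, q.1) :=
    (measurable_snd.mul ((measurable_pi_apply i).comp measurable_fst)).prodMk measurable_fst
  exact (hφ.cons s).comp h2

theorem IsSymmMeasurable.add {φ ψ : Multiset ℝ → ENNReal} (hφ : IsSymmMeasurable φ)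
    (hψ : IsSymmMeasurable ψ) : IsSymmMeasurable fun M => φ M + ψ M := fun s => (hφ s).add (hψ s)

theorem IsSymmMeasurable.card_mul {φ : Multiset ℝ → ENNReal} (hφ : IsSymmMeasurable φ)
    (f : ℕ → ENNReal) : IsSymmMeasurable fun M => f (Multiset.card M) * φ M := fun s => by
  simp only [Multiset.card_map]
  exact (hφ s).const_mul _

theorem isSymmMeasurable_card (f : ℕ → ENNReal) :
    IsSymmMeasurable fun M => f (Multiset.card M) := fun s => by
  simp only [Multiset.card_map]
  exact measurable_const

theorem isSymmMeasurable_sum {f : ℝ → ENNReal} (hf : Measurable f) :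
    IsSymmMeasurable fun M => f M.sum := fun s =>
  hf.comp (Finset.measurable_fun_sum s fun j _ => measurable_pi_apply j)

/-- The set of descendants is a measurable function with values in a countable type, so it is enough
to treat each of its values separately. -/
theorem measurable_comp_descendants {β : Type*} [MeasurableSpace β] (i r n : ℕ)
    {g : Finset ℕ → (ℕ → ℝ × ℕ) × β → ENNReal} (hg : ∀ s, Measurable (g s)) :
    Measurable fun q : (ℕ → ℝ × ℕ) × β => g (descendants q.1 i r n) q := by
  let _ : MeasurableSpace (Finset ℕ) := ⊤
  have : DiscreteMeasurableSpace (Finset ℕ) := ⟨fun _ => trivial⟩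
  have h1 : Measurable fun x : ℕ → ℝ × ℕ => descendants x i r n := by
    refine measurable_to_countable' fun s => ?_
    have h2 : (fun x : ℕ → ℝ × ℕ => descendants x i r n) ⁻¹' {s}
        = ⋂ j : ℕ, {x | j ∈ descendants x i r n ↔ j ∈ s} := by
      ext x; simp [Finset.ext_iff]
    rw [h2]
    refine MeasurableSet.iInter fun j => ?_
    have h3 : MeasurableSet {x : ℕ → ℝ × ℕ | j ∈ descendants x i r n} := by
      have h4 : Measurable fun x : ℕ → ℝ × ℕ => flow (unitEcho x) (Pi.single i 1) r j := by
        refine (measurable_flow _ r j).comp (measurable_pi_iff.2 fun k => ?_)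
        exact measurable_const.prodMk (measurable_pi_apply k).snd
      simp only [mem_descendants]
      exact (MeasurableSet.const _).inter (h4 (measurableSet_singleton 0)).compl
    by_cases hj : j ∈ s
    · simpa [hj] using h3
    · have h4 : {x : ℕ → ℝ × ℕ | j ∈ descendants x i r n ↔ j ∈ s}
          = {x | j ∈ descendants x i r n}ᶜ := by ext x; simp [hj]
      rw [h4]
      exact h3.compl
  have h5 : Measurable fun q : Finset ℕ × ((ℕ → ℝ × ℕ) × β) => g q.1 q.2 :=
    measurable_from_prod_countable_right fun s => hg s
  exact h5.comp ((h1.comp measurable_fst).prodMk measurable_id)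

theorem measurable_flow_pi (a : ℕ → ℝ) (r : ℕ) :
    Measurable fun (x : ℕ → ℝ × ℕ) (j : ℕ) => flow x a r j :=
  measurable_pi_iff.2 fun j => measurable_flow a r j

theorem IsSymmMeasurable.measurable_population {φ : Multiset ℝ → ENNReal} (hφ : IsSymmMeasurable φ)
    (i r n : ℕ) : Measurable fun x : ℕ → ℝ × ℕ => φ (population x i r n) := by
  have := measurable_comp_descendants (β := Unit) i r n
    (g := fun s q => φ (s.val.map (flow q.1 (Pi.single i 1) r)))
    fun s => (hφ s).comp ((measurable_flow_pi _ r).comp measurable_fst)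
  exact this.comp (measurable_id.prodMk (measurable_const (a := ())))

theorem descendants_past {n r : ℕ} (hr : 1 ≤ r) (x : ℕ → ℝ × ℕ) (i : ℕ) :
    descendants (past n x) i r n = descendants x i r n := by
  ext j
  rw [mem_descendants, mem_descendants]
  refine and_congr_right fun hj => ?_
  rw [flow_congr (Pi.single i 1) hr (x := unitEcho (past n x)) (y := unitEcho x)]
  intro k hk hkj
  rw [unitEcho, unitEcho, past_apply x hk (hkj.trans hj.2)]

theorem population_past {n r : ℕ} (hr : 1 ≤ r) (x : ℕ → ℝ × ℕ) (i : ℕ) :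
    population (past n x) i r n = population x i r n := by
  rw [population, population, descendants_past hr]
  exact Multiset.map_congr rfl fun j hj => flow_past hr x _ (mem_descendants.1 hj).1.2

/-! ### The law of a population given its size -/

section IsGrowth

variable {Ω : Type*} [MeasurableSpace Ω] {ν : Measure ℝ} {X : Ω → ℕ → ℝ × ℕ} {μ : Measure Ω}
  {Ω' : Type*} [MeasurableSpace Ω'] {X' : Ω' → ℕ → ℝ × ℕ} {μ' : Measure Ω'}

/-- One step of a Markov chain: if the uniform parent is a descendant, its weight times a fresh echo
is added; each of the other `n - card` parents leaves the population as it is. -/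
theorem IsGrowth.lintegral_population_succ [IsProbabilityMeasure ν] [IsProbabilityMeasure μ]
    (h : IsGrowth ν X μ) (i : ℕ) {r n : ℕ} (hr : 1 ≤ r) (hrn : r ≤ n)
    {φ : Multiset ℝ → ENNReal} (hφ : IsSymmMeasurable φ) :
    ∫⁻ ω, φ (population (X ω) i r (n + 1)) ∂μ = (n : ENNReal)⁻¹ *
      ∫⁻ ω, (birth ν φ (population (X ω) i r n) +
        ((n - Multiset.card (population (X ω) i r n) : ℕ) : ENNReal) *
          φ (population (X ω) i r n)) ∂μ := by
  classical
  let g : ℕ → (ℕ → ℝ × ℕ) → ℝ → ENNReal := fun k x t =>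
    if k ∈ descendants x i r n then φ ((t * flow x (Pi.single i 1) r k) ::ₘ population x i r n)
    else φ (population x i r n)
  have hg : ∀ k, Measurable fun q : (ℕ → ℝ × ℕ) × ℝ => g k q.1 q.2 := by
    intro k
    refine measurable_comp_descendants i r n (g := fun s q => if k ∈ s then
      φ ((q.2 * flow q.1 (Pi.single i 1) r k) ::ₘ s.val.map (flow q.1 (Pi.single i 1) r))
      else φ (s.val.map (flow q.1 (Pi.single i 1) r))) fun s => ?_
    split_ifs
    · exact (hφ.cons s).comp ((measurable_snd.mul
        ((_root_.measurable_flow _ r k).comp measurable_fst)).prodMk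
        ((measurable_flow_pi _ r).comp measurable_fst))
    · exact (hφ s).comp ((measurable_flow_pi _ r).comp measurable_fst)
  have h1 : ∀ ω, φ (population (X ω) i r (n + 1)) = g (X ω (n + 1)).2 (X ω) (X ω (n + 1)).1 := by
    intro ω
    rw [population_succ (h.recursive ω) i hr hrn]
    simp only [g]
    split_ifs <;> rfl
  rw [lintegral_congr h1, h.lintegral_succ (hr.trans hrn) g hg]
  · have hm : ∀ k, Measurable fun ω => ∫⁻ t, g k (X ω) t ∂ν := fun k =>
      ((hg k).lintegral_prod_right').comp h.measurable
    rw [← lintegral_finsetSum _ fun k _ => hm k]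
    congr 1
    refine lintegral_congr fun ω => ?_
    have hsub : descendants (X ω) i r n ⊆ Finset.Icc 1 n := Finset.filter_subset _ _
    rw [← Finset.sum_sdiff hsub, add_comm]
    congr 1
    · rw [birth, population, Multiset.map_map]
      refine Finset.sum_congr rfl fun k hk => ?_
      simp only [g, if_pos hk, Function.comp, population]
    · rw [Finset.sum_congr rfl (g := fun _ => φ (population (X ω) i r n)) fun k hk => by
        simp only [g, if_neg (Finset.mem_sdiff.1 hk).2, lintegral_const, measure_univ, mul_one]]
      rw [Finset.sum_const, nsmul_eq_mul, Finset.card_sdiff_of_subset hsub, card_population,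
        Nat.card_Icc, Nat.add_sub_cancel]
  · intro k hk x t
    simp only [g, descendants_past hr, population_past hr, flow_past hr x _ (Finset.mem_Icc.1 hk).2]

theorem birth_card [IsProbabilityMeasure ν] (f : ℕ → ENNReal) (M : Multiset ℝ) :
    birth ν (fun M => f (Multiset.card M)) M = (Multiset.card M : ENNReal) * f (Multiset.card M + 1) := by
  simp [birth]

/-- The weights of the descendants of a vertex are, given their number `k`, distributed as the
weights of the first `k` vertices of a whole tree. -/
theorem IsGrowth.lintegral_population [IsProbabilityMeasure ν] [IsProbabilityMeasure μ]
    [IsProbabilityMeasure μ'] (h : IsGrowth ν X μ) (h' : IsGrowth ν X' μ') {i r n : ℕ}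
    (hi1 : 1 ≤ i) (hir : i ≤ r) (hrn : r ≤ n) {φ : Multiset ℝ → ENNReal} (hφ : IsSymmMeasurable φ) :
    ∫⁻ ω, φ (population (X ω) i r n) ∂μ
      = ∫⁻ ω, ∫⁻ ω', φ (population (X' ω') 1 1 (Multiset.card (population (X ω) i r n))) ∂μ' ∂μ := by
  have hr : 1 ≤ r := hi1.trans hir
  -- The induction runs over all symmetric `φ` at once, because one step of growth replaces `φ` by
  -- another such functional.
  induction n, hrn using Nat.le_induction generalizing φ with
  | base => simp [population_single _ hi1 hir, population_single _ le_rfl]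
  | succ n hrn ih =>
    have hcard : ∀ k ω', Multiset.card (population (X' ω') 1 1 k) = k := fun k ω' => by
      rw [card_population, card_descendants_one (h'.recursive ω')]
    rw [h.lintegral_population_succ i hr hrn hφ, ih (hφ.birth.add (hφ.card_mul fun k => ((n - k : ℕ) : ENNReal))),
      h.lintegral_population_succ i hr hrn
        (isSymmMeasurable_card fun k => ∫⁻ ω', φ (population (X' ω') 1 1 k) ∂μ')]
    congr 1
    refine lintegral_congr fun ω => ?_
    set k := Multiset.card (population (X ω) i r n)
    have hpm : ∀ {ψ : Multiset ℝ → ENNReal}, IsSymmMeasurable ψ →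
        Measurable fun ω' => ψ (population (X' ω') 1 1 k) := fun hψ =>
      (hψ.measurable_population 1 1 k).comp h'.measurable
    simp only [hcard]
    rw [birth_card fun k => ∫⁻ ω', φ (population (X' ω') 1 1 k) ∂μ', lintegral_add_left (hpm hφ.birth), lintegral_const_mul _ (hpm hφ)]
    congr 1
    rcases Nat.eq_zero_or_pos k with hk | hk
    · have h2 : ∀ ω', population (X' ω') 1 1 k = 0 := fun ω' =>
        Multiset.card_eq_zero.1 (by rw [hcard, hk])
      simp only [h2, birth, Multiset.map_zero, Multiset.sum_zero, lintegral_zero]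
      change 0 = (k : ENNReal) * _
      rw [hk, Nat.cast_zero, zero_mul]
    -- In the whole tree every vertex is a descendant of `1`, so the next vertex always enlarges the
    -- population. The one-step formula then expresses the mean of `birth` at size `k` as `k` times
    -- the mean of `φ` at size `k + 1`. The value `k = 0` was set apart because `k` is cancelled.
    · have h2 := h'.lintegral_population_succ 1 le_rfl hk hφ
      simp only [hcard, Nat.sub_self, Nat.cast_zero, zero_mul, add_zero] at h2
      change _ = (k : ENNReal) * _
      rw [h2, ← mul_assoc, ENNReal.mul_inv_cancel (by exact_mod_cast hk.ne') (ENNReal.natCast_ne_top k),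
        one_mul]

theorem measurable_card_descendants (i r n : ℕ) :
    Measurable fun x : ℕ → ℝ × ℕ => (descendants x i r n).card := by
  have h := (isSymmMeasurable_card fun k => (k : ENNReal)).measurable_population i r n
  simp only [card_population] at h
  refine measurable_to_countable' fun k => ?_
  convert h (measurableSet_singleton (k : ENNReal)) using 1
  ext x
  simp

theorem measurable_flowSum_card (a : ℕ → ℝ) (s i r n : ℕ) :
    Measurable fun q : (ℕ → ℝ × ℕ) × (ℕ → ℝ × ℕ) => flowSum q.2 a s (descendants q.1 i r n).card := by
  have h1 : Measurable fun q : ℕ × (ℕ → ℝ × ℕ) => flowSum q.2 a s q.1 :=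
    measurable_from_prod_countable_right fun k => by
      show Measurable fun x : ℕ → ℝ × ℕ => flowSum x a s k
      exact measurable_flowSum a s k
  have h2 : Measurable fun q : (ℕ → ℝ × ℕ) × (ℕ → ℝ × ℕ) => ((descendants q.1 i r n).card, q.2) :=
    ((measurable_card_descendants i r n).comp measurable_fst).prodMk measurable_snd
  have h3 := h1.comp h2
  exact h3

theorem IsGrowth.map_flowSum [IsProbabilityMeasure ν] [IsProbabilityMeasure μ]
    [IsProbabilityMeasure μ'] (h : IsGrowth ν X μ) (h' : IsGrowth ν X' μ') {i r n : ℕ}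
    (hi1 : 1 ≤ i) (hir : i ≤ r) (hrn : r ≤ n) :
    IdentDistrib (fun ω => flowSum (X ω) (Pi.single i 1) r n)
      (fun q : Ω × Ω' => flowSum (X' q.2) (Pi.single 1 1) 1 (descendants (X q.1) i r n).card)
      μ (μ.prod μ') := by
  have hm : Measurable fun q : Ω × Ω' =>
      flowSum (X' q.2) (Pi.single 1 1) 1 (descendants (X q.1) i r n).card := by
    have h1 : Measurable fun q : Ω × Ω' => (X q.1, X' q.2) :=
      (h.measurable.comp measurable_fst).prodMk (h'.measurable.comp measurable_snd)
    have h2 := (measurable_flowSum_card (Pi.single 1 1) 1 i r n).comp h1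
    exact h2
  refine ⟨(h.measurable_flowSum _ r n).aemeasurable, hm.aemeasurable, ?_⟩
  refine Measure.ext_of_lintegral _ fun f hf => ?_
  have hm2 := hf.comp hm
  rw [lintegral_map hf (h.measurable_flowSum _ r n), lintegral_map hf hm,
    lintegral_prod (fun q : Ω × Ω' =>
      f (flowSum (X' q.2) (Pi.single 1 1) 1 (descendants (X q.1) i r n).card)) hm2.aemeasurable]
  have := h.lintegral_population h' hi1 hir hrn (isSymmMeasurable_sum hf)
  simpa only [sum_population, card_population] using this

end IsGrowth

/-! ### Identification of limit laws; Beta moments -/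

section Limits

variable {Ω Ω' : Type*} [MeasurableSpace Ω] [MeasurableSpace Ω'] {μ : Measure Ω} {μ' : Measure Ω'}

/-- Almost sure limits are limits in distribution, and weak limits of probability measures are
unique. -/
theorem identDistrib_of_tendsto [IsProbabilityMeasure μ] [IsProbabilityMeasure μ']
    {S : ℕ → Ω → ℝ} {T : ℕ → Ω' → ℝ} {A : Ω → ℝ} {B : Ω' → ℝ}
    (hST : ∀ n, IdentDistrib (S n) (T n) μ μ')
    (hA : ∀ᵐ ω ∂μ, Tendsto (fun n => S n ω) atTop (𝓝 (A ω)))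
    (hB : ∀ᵐ ω ∂μ', Tendsto (fun n => T n ω) atTop (𝓝 (B ω))) : IdentDistrib A B μ μ' := by
  have hAm : AEMeasurable A μ :=
    aemeasurable_of_tendsto_metrizable_ae atTop (fun n => (hST n).aemeasurable_fst) hA
  have hBm : AEMeasurable B μ' :=
    aemeasurable_of_tendsto_metrizable_ae atTop (fun n => (hST n).aemeasurable_snd) hB
  refine ⟨hAm, hBm, ?_⟩
  have h1 := (tendstoInDistribution_of_ae_tendsto (fun n => (hST n).aemeasurable_fst) hAm hA).tendsto
  have h2 := (tendstoInDistribution_of_ae_tendsto (fun n => (hST n).aemeasurable_snd) hBm hB).tendsto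
  have h3 : (⟨μ.map A, Measure.isProbabilityMeasure_map hAm⟩ : ProbabilityMeasure ℝ)
      = ⟨μ'.map B, Measure.isProbabilityMeasure_map hBm⟩ := by
    refine tendsto_nhds_unique (X := ProbabilityMeasure ℝ) (Filter.Tendsto.congr
      (β := ProbabilityMeasure ℝ) (fun n => ?_) h1) h2
    exact Subtype.ext (hST n).map_eq
  exact congrArg Subtype.val h3

/-- Two probability measures on `[0, 1]` with the same moments are equal. -/
theorem measure_eq_of_integral_pow_eq {P Q : Measure ℝ} [IsProbabilityMeasure P]
    [IsProbabilityMeasure Q] (hP : ∀ᵐ x ∂P, x ∈ Set.Icc (0 : ℝ) 1)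
    (hQ : ∀ᵐ x ∂Q, x ∈ Set.Icc (0 : ℝ) 1) (h : ∀ j : ℕ, ∫ x, x ^ j ∂P = ∫ x, x ^ j ∂Q) : P = Q := by
  have hint : ∀ (ρ : Measure ℝ) [IsProbabilityMeasure ρ], (∀ᵐ x ∂ρ, x ∈ Set.Icc (0 : ℝ) 1) →
      ∀ f : ℝ → ℝ, Continuous f → Integrable f ρ := by
    intro ρ _ hρ f hf
    obtain ⟨D, hD⟩ := isCompact_Icc.exists_bound_of_continuousOn (hf.continuousOn (s := Set.Icc (0:ℝ) 1))
    exact Integrable.of_bound hf.aestronglyMeasurable D (hρ.mono fun x hx => hD x hx)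
  have hpoly : ∀ p : Polynomial ℝ, ∫ x, p.eval x ∂P = ∫ x, p.eval x ∂Q := by
    intro p
    simp only [Polynomial.eval_eq_sum_range]
    rw [integral_finsetSum _ fun j _ => (hint P hP _ (continuous_pow j)).const_mul _,
      integral_finsetSum _ fun j _ => (hint Q hQ _ (continuous_pow j)).const_mul _]
    simp only [integral_const_mul, h]
  refine ext_of_forall_integral_eq_of_IsFiniteMeasure fun f => ?_
  refine eq_of_forall_dist_le fun e he => ?_
  rw [Real.dist_eq]
  -- Weierstrass: on `[0, 1]` a polynomial approximates the test function within `e / 2`, and each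
  -- of the two measures costs one such error.
  obtain ⟨p, hp⟩ := exists_polynomial_near_of_continuousOn 0 1 f f.continuous.continuousOn (e / 2)
    (by positivity)
  have hb : ∀ (ρ : Measure ℝ) [IsProbabilityMeasure ρ], (∀ᵐ x ∂ρ, x ∈ Set.Icc (0 : ℝ) 1) →
      |∫ x, p.eval x ∂ρ - ∫ x, f x ∂ρ| ≤ e / 2 := by
    intro ρ _ hρ
    rw [← integral_sub (hint ρ hρ _ p.continuous) (hint ρ hρ _ f.continuous)]
    have := norm_integral_le_of_norm_le_const (μ := ρ) (f := fun x => p.eval x - f x) (C := e / 2)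
      (hρ.mono fun x hx => (hp x hx).le)
    simpa using this
  have h1 := hb P hP
  have h2 := hb Q hQ
  rw [hpoly p] at h1
  rw [abs_le] at *
  constructor <;> linarith [h1.1, h1.2, h2.1, h2.2]

/-- Multiplying the density of `Beta(1, b)` by `x ^ s` gives a multiple of the density of `Beta(1 +
s, b)`, which integrates to `1`. -/
theorem lintegral_rpow_betaMeasure {b s : ℝ} (hb : 0 < b) (hs : 0 ≤ s) :
    ∫⁻ x, ENNReal.ofReal (x ^ s) ∂(betaMeasure 1 b) = ENNReal.ofReal (beta (1 + s) b / beta 1 b) := by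
  have h1 : 0 < beta 1 b := beta_pos one_pos hb
  have h2 : 0 < beta (1 + s) b := beta_pos (by linarith) hb
  have hm : Measurable (betaPDF 1 b) := (measurable_betaPDFReal 1 b).ennreal_ofReal
  rw [betaMeasure, lintegral_withDensity_eq_lintegral_mul _ hm (by fun_prop)]
  have h3 : ∀ x, (betaPDF 1 b * fun x => ENNReal.ofReal (x ^ s)) x
      = ENNReal.ofReal (beta (1 + s) b / beta 1 b) * betaPDF (1 + s) b x := by
    intro x
    rw [Pi.mul_apply, betaPDF_eq, betaPDF_eq]
    split_ifs with hx
    · have hx1 : 0 < 1 - x := by linarith [hx.2]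
      have hx0 := hx.1
      rw [← ENNReal.ofReal_mul (by positivity), ← ENNReal.ofReal_mul (by positivity)]
      congr 1
      rw [sub_self, Real.rpow_zero, add_sub_cancel_left]
      field_simp
    · simp
  have hm' : Measurable (betaPDF (1 + s) b) := (measurable_betaPDFReal _ b).ennreal_ofReal
  rw [lintegral_congr h3, lintegral_const_mul _ hm',
    lintegral_betaPDF_eq_one (by linarith) hb, mul_one]

theorem betaMeasure_ae_mem {b : ℝ} : ∀ᵐ x ∂(betaMeasure 1 b), x ∈ Set.Ioo (0 : ℝ) 1 := by
  have hm : Measurable (betaPDF 1 b) := (measurable_betaPDFReal 1 b).ennreal_ofReal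
  rw [betaMeasure, ae_withDensity_iff hm]
  refine ae_of_all _ fun x hx => ?_
  by_contra h
  rw [Set.mem_Ioo, not_and_or, not_lt, not_lt] at h
  rcases h with h | h
  · exact hx (betaPDF_eq_zero_of_nonpos h)
  · exact hx (betaPDF_eq_zero_of_one_le h)

theorem integral_rpow_betaMeasure {b s : ℝ} (hb : 0 < b) (hs : 0 ≤ s) :
    ∫ x, x ^ s ∂(betaMeasure 1 b) = beta (1 + s) b / beta 1 b := by
  have h1 : 0 < beta 1 b := beta_pos one_pos hb
  have h2 : 0 < beta (1 + s) b := beta_pos (by linarith) hb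
  rw [integral_eq_lintegral_of_nonneg_ae, lintegral_rpow_betaMeasure hb hs,
    ENNReal.toReal_ofReal (by positivity)]
  · exact betaMeasure_ae_mem.mono fun x hx => Real.rpow_nonneg hx.1.le s
  · exact (by fun_prop : Measurable fun x : ℝ => x ^ s).aestronglyMeasurable

end Limits

/-! ### The Pólya urn and the law of the limit masses -/

section IsGrowth

variable {Ω : Type*} [MeasurableSpace Ω] {ν : Measure ℝ} {X : Ω → ℕ → ℝ × ℕ} {μ : Measure Ω}
  {Ω' : Type*} [MeasurableSpace Ω'] {X' : Ω' → ℕ → ℝ × ℕ} {μ' : Measure Ω'}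

theorem isProbabilityMeasure_uniformOn_Icc {n : ℕ} (hn : 2 ≤ n) :
    IsProbabilityMeasure (uniformOn (Set.Icc 1 (n - 1))) :=
  isProbabilityMeasure_uniformOn (Set.finite_Icc 1 (n - 1)) ⟨1, by simp; omega⟩

theorem IsGrowth.unitEcho [IsProbabilityMeasure ν] (h : IsGrowth ν X μ) :
    IsGrowth (Measure.dirac 1) (fun ω => unitEcho (X ω)) μ where
  measurable := measurable_pi_iff.2 fun n =>
    measurable_const.prodMk (measurable_pi_iff.1 h.measurable n).snd
  recursive ω := (h.recursive ω).unitEcho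
  nonneg ω n _ := (zero_le_one : (0 : ℝ) ≤ 1)
  law n hn := by
    have := isProbabilityMeasure_uniformOn_Icc hn
    have h1 : Measurable fun q : ℝ × ℕ => ((1 : ℝ), q.2) := by fun_prop
    have h2 : (fun ω => _root_.unitEcho (X ω) n) = (fun q : ℝ × ℕ => ((1 : ℝ), q.2)) ∘ fun ω => X ω n := rfl
    rw [h2, ← Measure.map_map h1 (measurable_pi_iff.1 h.measurable n), h.law n hn]
    have h3 : (fun q : ℝ × ℕ => ((1 : ℝ), q.2)) = Prod.map (fun _ => 1) id := rfl
    rw [h3, ← Measure.map_prod_map _ _ measurable_const measurable_id, Measure.map_const]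
    simp
  indep := h.indep.comp (fun _ q => ((1 : ℝ), q.2)) fun _ => by fun_prop

theorem dirac_one_nonneg : ∀ᵐ t : ℝ ∂(Measure.dirac 1), 0 ≤ t := by
  rw [ae_dirac_eq]; exact (zero_le_one : (0 : ℝ) ≤ 1)

theorem card_descendants_le (x : ℕ → ℝ × ℕ) (i r n : ℕ) : (descendants x i r n).card ≤ n := by
  have : descendants x i r n ⊆ Finset.Icc 1 n := Finset.filter_subset _ _
  simpa using Finset.card_le_card this

/-- Rising factorials are eigenfunctions of the urn. With `k` descendants among `n` vertices, `k (k
+ 1)^(j) + (n - k) k^(j) = (n + j) k^(j)`, where `k^(j) = k (k + 1) ⋯ (k + j - 1)`, because `k (k +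
1)^(j) = (k + j) k^(j)`. -/
theorem IsGrowth.lintegral_ascFactorial [IsProbabilityMeasure ν] [IsProbabilityMeasure μ]
    (h : IsGrowth ν X μ) {i r n : ℕ} (hi1 : 1 ≤ i) (hir : i ≤ r) (hrn : r ≤ n) (j : ℕ) :
    ∫⁻ ω, (((descendants (X ω) i r n).card.ascFactorial j : ℕ) : ENNReal) ∂μ
      = ENNReal.ofReal (j.factorial * (gammaRatio j n / gammaRatio j r)) := by
  have hr : 1 ≤ r := hi1.trans hir
  induction n, hrn using Nat.le_induction with
  | base =>
    simp only [descendants_single _ hi1 hir, Finset.card_singleton, Nat.one_ascFactorial,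
      lintegral_const, measure_univ, mul_one]
    rw [div_self (gammaRatio_pos (Nat.cast_nonneg j) hr).ne', mul_one, ENNReal.ofReal_natCast]
  | succ n hrn ih =>
    have h1 := h.lintegral_population_succ i hr hrn
      (isSymmMeasurable_card fun k => ((k.ascFactorial j : ℕ) : ENNReal))
    simp only [card_population] at h1
    rw [h1]
    have h2 : ∀ ω, birth ν (fun M => ((Multiset.card M).ascFactorial j : ENNReal))
        (population (X ω) i r n) + ((n - (descendants (X ω) i r n).card : ℕ) : ENNReal) *
          ((descendants (X ω) i r n).card.ascFactorial j : ENNReal)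
        = ((n + j : ℕ) : ENNReal) * ((descendants (X ω) i r n).card.ascFactorial j : ENNReal) := by
      intro ω
      rw [birth_card fun k => ((k.ascFactorial j : ℕ) : ENNReal), card_population]
      have h3 := Nat.succ_ascFactorial (descendants (X ω) i r n).card j
      have h4 := card_descendants_le (X ω) i r n
      rw [Nat.succ_eq_add_one] at h3
      rw [← Nat.cast_mul, h3, ← Nat.cast_mul, ← Nat.cast_add, ← Nat.cast_mul, ← add_mul]
      congr 2
      omega
    have hn : (0 : ℝ) < n := by exact_mod_cast hr.trans hrn
    rw [lintegral_congr h2, lintegral_const_mul' _ _ (ENNReal.natCast_ne_top _), ih, ← mul_assoc,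
      gammaRatio_succ (Nat.cast_nonneg j) (hr.trans hrn)]
    have h5 : (n : ENNReal)⁻¹ * ((n + j : ℕ) : ENNReal) = ENNReal.ofReal (1 + (j : ℝ) / n) := by
      have h6 : 1 + (j : ℝ) / n = ((n + j : ℕ) : ℝ) / n := by push_cast; field_simp
      rw [h6, ENNReal.ofReal_div_of_pos hn, ENNReal.ofReal_natCast, ENNReal.ofReal_natCast,
        div_eq_mul_inv, mul_comm]
    rw [h5, ← ENNReal.ofReal_mul (by positivity)]
    congr 1
    ring

/-- The asymptotic proportion of the descendants of the vertex `i`. -/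
noncomputable def IsGrowth.proportion [IsProbabilityMeasure ν] (h : IsGrowth ν X μ) (i r : ℕ) :
    Ω → ℝ := h.unitEcho.limitMass i r

theorem IsGrowth.tendsto_proportion [IsProbabilityMeasure ν] [IsProbabilityMeasure μ]
    (h : IsGrowth ν X μ) {i r : ℕ} (hi1 : 1 ≤ i) (hir : i ≤ r) :
    ∀ᵐ ω ∂μ, Tendsto (fun n : ℕ => ((descendants (X ω) i r n).card : ℝ) / n) atTop
      (𝓝 (h.proportion i r ω)) := by
  have h1 := h.unitEcho.tendsto_flowSum dirac_one_nonneg (integrable_dirac (by simp)) hi1 hir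
  filter_upwards [h1] with ω hω
  simp only [integral_dirac, Real.rpow_one] at hω
  simpa only [card_descendants _ _ (hi1.trans hir), IsGrowth.proportion] using hω

theorem tendsto_ascFactorial_div {N : ℕ → ℕ} {b : ℝ}
    (h : Tendsto (fun n => (N n : ℝ) / n) atTop (𝓝 b)) (j : ℕ) :
    Tendsto (fun n : ℕ => ((N n).ascFactorial j : ℝ) / (n : ℝ) ^ j) atTop (𝓝 (b ^ j)) := by
  induction j with
  | zero => simp
  | succ j ih =>
    have h1 : Tendsto (fun n : ℕ => (N n : ℝ) / n + (j : ℝ) / n) atTop (𝓝 (b + 0)) :=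
      h.add (tendsto_const_div_atTop_nhds_zero_nat _)
    have h2 := h1.mul ih
    rw [add_zero] at h2
    rw [pow_succ']
    refine h2.congr fun n => ?_
    rw [Nat.ascFactorial_succ, Nat.cast_mul, Nat.cast_add, ← add_div, div_mul_div_comm, pow_succ']

theorem ascFactorial_le_of_le {N n : ℕ} (h : N ≤ n) (hn : 1 ≤ n) (j : ℕ) :
    N.ascFactorial j ≤ (j + 1) ^ j * n ^ j := by
  have h1 : ∀ l, l ≤ j → N.ascFactorial l ≤ (j + 1) ^ l * n ^ l := by
    intro l
    induction l with
    | zero => simp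
    | succ l ih =>
      intro hl
      rw [Nat.ascFactorial_succ, pow_succ', pow_succ']
      calc (N + l) * N.ascFactorial l ≤ ((j + 1) * n) * ((j + 1) ^ l * n ^ l) :=
            Nat.mul_le_mul (by nlinarith) (ih (by omega))
        _ = _ := by ring
  exact h1 j le_rfl

theorem IsGrowth.aemeasurable_proportion [IsProbabilityMeasure ν] [IsProbabilityMeasure μ]
    (h : IsGrowth ν X μ) {i r : ℕ} (hi1 : 1 ≤ i) (hir : i ≤ r) : AEMeasurable (h.proportion i r) μ :=
  (h.unitEcho.integrable_limitMass dirac_one_nonneg (integrable_dirac (by simp)) hi1 hir).aemeasurable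

theorem IsGrowth.proportion_mem [IsProbabilityMeasure ν] [IsProbabilityMeasure μ]
    (h : IsGrowth ν X μ) {i r : ℕ} (hi1 : 1 ≤ i) (hir : i ≤ r) :
    ∀ᵐ ω ∂μ, h.proportion i r ω ∈ Set.Icc (0 : ℝ) 1 := by
  filter_upwards [h.tendsto_proportion hi1 hir] with ω hω
  refine isClosed_Icc.mem_of_tendsto hω (Eventually.of_forall fun n => ⟨by positivity, ?_⟩)
  exact div_le_one_of_le₀ (by exact_mod_cast card_descendants_le _ _ _ _) (by positivity)

/-- The rising factorial of the number of descendants, divided by `n ^ j`, tends to the `j`-th power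
of the proportion and is bounded by `(j + 1) ^ j`; dominated convergence passes the exact urn
moments to the limit. -/
theorem IsGrowth.integral_proportion_pow [IsProbabilityMeasure ν] [IsProbabilityMeasure μ]
    (h : IsGrowth ν X μ) {i r : ℕ} (hi1 : 1 ≤ i) (hir : i ≤ r) (j : ℕ) :
    ∫ ω, h.proportion i r ω ^ j ∂μ = j.factorial / gammaRatio j r := by
  have hr : 1 ≤ r := hi1.trans hir
  have hmeas : ∀ n, Measurable fun ω => (((descendants (X ω) i r n).card.ascFactorial j : ℕ) : ℝ) :=
    fun n => (measurable_from_top (f := fun k : ℕ => ((k.ascFactorial j : ℕ) : ℝ))).comp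
      ((measurable_card_descendants i r n).comp h.measurable)
  have h1 : Tendsto (fun n : ℕ => ∫ ω, ((descendants (X ω) i r n).card.ascFactorial j : ℝ) /
      (n : ℝ) ^ j ∂μ) atTop (𝓝 (∫ ω, h.proportion i r ω ^ j ∂μ)) := by
    refine tendsto_integral_of_dominated_convergence (fun _ => ((j : ℝ) + 1) ^ j)
      (fun n => ((hmeas n).div_const _).aestronglyMeasurable) (integrable_const _) (fun n => ?_) ?_
    · refine ae_of_all _ fun ω => ?_
      rw [Real.norm_of_nonneg (by positivity)]
      rcases Nat.eq_zero_or_pos n with rfl | hn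
      · have : (descendants (X ω) i r 0).card = 0 := Nat.le_zero.1 (card_descendants_le _ _ _ _)
        rcases Nat.eq_zero_or_pos j with rfl | hj
        · simp
        · obtain ⟨k, rfl⟩ := Nat.exists_eq_succ_of_ne_zero hj.ne'
          rw [this, Nat.zero_ascFactorial]
          simp
          positivity
      · have hn' : (0 : ℝ) < n := by exact_mod_cast hn
        rw [div_le_iff₀ (by positivity)]
        exact_mod_cast ascFactorial_le_of_le (card_descendants_le (X ω) i r n) hn j
    · filter_upwards [h.tendsto_proportion hi1 hir] with ω hω
      exact tendsto_ascFactorial_div hω j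
  have h2 : Tendsto (fun n : ℕ => ∫ ω, ((descendants (X ω) i r n).card.ascFactorial j : ℝ) /
      (n : ℝ) ^ j ∂μ) atTop (𝓝 (j.factorial / gammaRatio j r * 1)) := by
    refine ((tendsto_gammaRatio (Nat.cast_nonneg j)).const_mul _).congr' ?_
    filter_upwards [eventually_ge_atTop r] with n hn
    have hg := gammaRatio_pos (Nat.cast_nonneg j) (hr.trans hn)
    have hg' := gammaRatio_pos (Nat.cast_nonneg j) hr
    rw [integral_div, integral_eq_lintegral_of_nonneg_ae (ae_of_all _ fun ω => by positivity)
      (hmeas n).aestronglyMeasurable]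
    simp only [ENNReal.ofReal_natCast]
    rw [h.lintegral_ascFactorial hi1 hir hn, ENNReal.toReal_ofReal (by positivity), Real.rpow_natCast]
    field_simp
  rw [mul_one] at h2
  exact tendsto_nhds_unique h1 h2

/-- The proportion of the descendants of a vertex `i ≤ r` has the law `Beta(1, r - 1)`. -/
theorem IsGrowth.map_proportion [IsProbabilityMeasure ν] [IsProbabilityMeasure μ]
    (h : IsGrowth ν X μ) {i r : ℕ} (hi1 : 1 ≤ i) (hir : i ≤ r) (hr : 2 ≤ r) :
    μ.map (h.proportion i r) = betaMeasure 1 ((r : ℝ) - 1) := by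
  have hb : (0 : ℝ) < (r : ℝ) - 1 := by
    have : (2 : ℝ) ≤ r := by exact_mod_cast hr
    linarith
  have hm := h.aemeasurable_proportion hi1 hir
  have := isProbabilityMeasureBeta one_pos hb
  have := Measure.isProbabilityMeasure_map hm
  refine measure_eq_of_integral_pow_eq ?_ ?_ fun j => ?_
  · exact (ae_map_iff hm measurableSet_Icc).2 (h.proportion_mem hi1 hir)
  · exact betaMeasure_ae_mem.mono fun x hx => ⟨hx.1.le, hx.2.le⟩
  · rw [integral_map hm (by fun_prop : Measurable fun x : ℝ => x ^ j).aestronglyMeasurable,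
      h.integral_proportion_pow hi1 hir j]
    have h1 := integral_rpow_betaMeasure hb (Nat.cast_nonneg j)
    simp only [Real.rpow_natCast] at h1
    rw [h1, gammaRatio, beta, beta]
    have h2 := (Real.Gamma_pos_of_pos hb).ne'
    have h3 : (0 : ℝ) < r := by linarith
    have h4 := (Real.Gamma_pos_of_pos h3).ne'
    have h5 := (Real.Gamma_pos_of_pos (show (0 : ℝ) < r + j by positivity)).ne'
    rw [show (1 : ℝ) + j + (r - 1) = r + j by ring, show (1 : ℝ) + (r - 1) = r by ring,
      Real.Gamma_one, add_comm (1 : ℝ) j, Real.Gamma_nat_eq_factorial]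
    field_simp

theorem IsGrowth.identDistrib_limitMass_one [IsProbabilityMeasure ν] [IsProbabilityMeasure μ]
    [IsProbabilityMeasure μ'] (h : IsGrowth ν X μ) (h' : IsGrowth ν X' μ')
    (hν : ∀ᵐ t ∂ν, 0 ≤ t) (hint : Integrable (fun t : ℝ => t) ν) :
    IdentDistrib (h.limitMass 1 1) (h'.limitMass 1 1) μ μ' := by
  refine identDistrib_of_tendsto (fun n => ?_) ((h.tendsto_flowSum hν hint le_rfl le_rfl).mono
    fun ω hω => (tendsto_add_atTop_iff_nat 1).2 hω) ((h'.tendsto_flowSum hν hint le_rfl le_rfl).mono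
    fun ω hω => (tendsto_add_atTop_iff_nat 1).2 hω)
  -- With `i = r = 1` all vertices are descendants, so both totals are compared with the second
  -- factor of a product space, where only the law of `X'` matters.
  have h1 := h.map_flowSum h' (n := n + 1) (le_refl 1) le_rfl (by omega)
  have h2 := h'.map_flowSum h' (n := n + 1) (le_refl 1) le_rfl (by omega)
  simp only [card_descendants_one (h.recursive _)] at h1
  simp only [card_descendants_one (h'.recursive _)] at h2
  have h3 : IdentDistrib (fun q : Ω × Ω' => flowSum (X' q.2) (Pi.single 1 1) 1 (n + 1))
      (fun q : Ω' × Ω' => flowSum (X' q.2) (Pi.single 1 1) 1 (n + 1)) (μ.prod μ') (μ'.prod μ') := by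
    refine ⟨h1.aemeasurable_snd, h2.aemeasurable_snd, ?_⟩
    have hm := h'.measurable_flowSum (Pi.single 1 1) 1 (n + 1)
    have h4 := Measure.map_map (μ := μ.prod μ') hm measurable_snd
    have h5 := Measure.map_map (μ := μ'.prod μ') hm measurable_snd
    rw [Measure.map_snd_prod, measure_univ, one_smul] at h4 h5
    exact h4.symm.trans h5
  exact ((h1.trans h3).trans h2.symm).div_const _

/-- The limit mass of the descendants of a vertex `i ≤ r` is distributed as the product of the limit
mass of the whole tree with an independent power of a `Beta(1, r - 1)` variable. -/
theorem IsGrowth.identDistrib_limitMass [IsProbabilityMeasure ν] [IsProbabilityMeasure μ]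
    [IsProbabilityMeasure μ'] (h : IsGrowth ν X μ) (h' : IsGrowth ν X' μ')
    (hν : ∀ᵐ t ∂ν, 0 ≤ t) (hint : Integrable (fun t : ℝ => t) ν)
    {i r : ℕ} (hi1 : 1 ≤ i) (hir : i ≤ r) (hr : 2 ≤ r) :
    IdentDistrib (h.limitMass i r) (fun q : ℝ × ℝ => q.1 * q.2 ^ (∫ t, t ∂ν)) μ
      ((μ'.map (h'.limitMass 1 1)).prod (betaMeasure 1 ((r : ℝ) - 1))) := by
  set m := ∫ t, t ∂ν
  have hZ := (h'.integrable_limitMass hν hint le_rfl le_rfl).aemeasurable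
  have hB := h.aemeasurable_proportion hi1 hir
  have h1 : IdentDistrib (h.limitMass i r)
      (fun q : Ω × Ω' => h'.limitMass 1 1 q.2 * h.proportion i r q.1 ^ m) μ (μ.prod μ') := by
    refine identDistrib_of_tendsto (fun n => ((h.map_flowSum h' hi1 hir
      (show r ≤ n + r by omega)).div_const (((n + r : ℕ) : ℝ) ^ m)))
      ((h.tendsto_flowSum hν hint hi1 hir).mono
        fun ω hω => (tendsto_add_atTop_iff_nat r).2 hω) ?_
    -- The number of descendants must tend to infinity for the limit of the second tree to appear.
    -- This needs a positive proportion, which the Beta law provides.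
    have hpos : ∀ᵐ ω ∂μ, 0 < h.proportion i r ω := by
      have h2 : ∀ᵐ x ∂(μ.map (h.proportion i r)), 0 < x := by
        rw [h.map_proportion hi1 hir hr]
        exact betaMeasure_ae_mem.mono fun x hx => hx.1
      exact ae_of_ae_map hB h2
    have e1 := (Measure.quasiMeasurePreserving_fst (μ := μ) (ν := μ')).ae hpos
    have e2 := (Measure.quasiMeasurePreserving_fst (μ := μ) (ν := μ')).ae (h.tendsto_proportion hi1 hir)
    have e3 := (Measure.quasiMeasurePreserving_snd (μ := μ) (ν := μ')).ae
      (h'.tendsto_flowSum hν hint le_rfl le_rfl)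
    filter_upwards [e1, e2, e3] with q q1 q2 q3
    refine (tendsto_add_atTop_iff_nat (f := fun n : ℕ => flowSum (X' q.2) (Pi.single 1 1) 1
      (descendants (X q.1) i r n).card / (n : ℝ) ^ m) r).2 ?_
    have hN : Tendsto (fun n => (descendants (X q.1) i r n).card) atTop atTop := by
      have h3 : Tendsto (fun n : ℕ => ((descendants (X q.1) i r n).card : ℝ) / n * n) atTop atTop :=
        q2.pos_mul_atTop q1 tendsto_natCast_atTop_atTop
      refine tendsto_natCast_atTop_iff.1 (h3.congr' ?_)
      filter_upwards [eventually_ge_atTop 1] with n hn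
      have : (n : ℝ) ≠ 0 := by positivity
      field_simp
    -- Here `n ^ m` is split into the normalization `N ^ m` of a tree with `N` vertices and the
    -- power `(N / n) ^ m` of the proportion.
    have h4 := (q3.comp hN).mul (q2.rpow_const (p := m) (Or.inl q1.ne'))
    refine h4.congr' ?_
    filter_upwards [hN.eventually_ge_atTop 1, eventually_ge_atTop 1] with n hn1 hn
    have hn0 : (0 : ℝ) < n := by exact_mod_cast hn
    have hn2 : (0 : ℝ) < (descendants (X q.1) i r n).card := by exact_mod_cast hn1
    simp only [Function.comp]
    rw [Real.div_rpow hn2.le hn0.le]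
    have : (0 : ℝ) < ((descendants (X q.1) i r n).card : ℝ) ^ m := by positivity
    rw [div_mul_div_comm, mul_comm _ (_ ^ m), mul_div_mul_left _ _ this.ne']
  refine h1.trans ?_
  have hg : Measurable fun q : ℝ × ℝ => q.1 * q.2 ^ m := by fun_prop
  have hpair : AEMeasurable (fun q : Ω × Ω' => (h'.limitMass 1 1 q.2, h.proportion i r q.1))
      (μ.prod μ') := hZ.comp_snd.prodMk hB.comp_fst
  refine ⟨h1.aemeasurable_snd, hg.aemeasurable, ?_⟩
  have h5 : (μ.prod μ').map (fun q : Ω × Ω' => (h'.limitMass 1 1 q.2, h.proportion i r q.1))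
      = (μ'.map (h'.limitMass 1 1)).prod (betaMeasure 1 ((r : ℝ) - 1)) := by
    have h6 := (indepFun_iff_map_prod_eq_prod_map_map hZ.comp_snd hB.comp_fst).1
      (indepFun_prod₀ hB hZ).symm
    have h7 := AEMeasurable.map_map_of_aemeasurable (μ := μ.prod μ')
      (by simpa using hZ) measurable_snd.aemeasurable
    have h8 := AEMeasurable.map_map_of_aemeasurable (μ := μ.prod μ')
      (by simpa using hB) measurable_fst.aemeasurable
    rw [Measure.map_snd_prod, measure_univ, one_smul] at h7
    rw [Measure.map_fst_prod, measure_univ, one_smul] at h8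
    rw [h6, ← h.map_proportion hi1 hir hr, h7, h8]
    rfl
  rw [← h5, AEMeasurable.map_map_of_aemeasurable hg.aemeasurable hpair]
  rfl

end IsGrowth

/-! ### The moment function near `1` and the smoothing equation -/

section Moments

variable {ν : Measure ℝ}

theorem integrable_rpow_comp_of_le {Ω : Type*} [MeasurableSpace Ω] {μ : Measure Ω}
    [IsFiniteMeasure μ] {f : Ω → ℝ} (hfm : AEMeasurable f μ) (hf : ∀ᵐ ω ∂μ, 0 ≤ f ω) {a q : ℝ}
    (hq : 0 ≤ q) (hqa : q ≤ a) (hi : Integrable (fun ω => f ω ^ a) μ) :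
    Integrable (fun ω => f ω ^ q) μ := by
  refine ((integrable_const (1 : ℝ)).add hi).mono' (hfm.pow_const q).aestronglyMeasurable
    (hf.mono fun ω hω => ?_)
  rw [Real.norm_of_nonneg (Real.rpow_nonneg hω q), Pi.add_apply]
  rcases le_total (f ω) 1 with h | h
  · linarith [Real.rpow_le_one hω h hq, Real.rpow_nonneg hω a]
  · linarith [Real.rpow_le_rpow_of_exponent_le h hqa]

theorem integrable_rpow_of_le [IsFiniteMeasure ν] (hν : ∀ᵐ t ∂ν, 0 ≤ t) {a q : ℝ} (hq : 0 ≤ q)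
    (hqa : q ≤ a) (hi : Integrable (fun t : ℝ => t ^ a) ν) : Integrable (fun t : ℝ => t ^ q) ν :=
  integrable_rpow_comp_of_le aemeasurable_id hν hq hqa hi

/-- Below `1` the logarithm is absorbed by `t ^ q`, with bound `1 / q ≤ 2`; above `1`, by the spare
power `t ^ (a - q)`. The restriction `1 / 2 ≤ q` makes the estimate uniform near `q = 1`, as
differentiation under the integral requires. -/
theorem abs_rpow_mul_log_le {t q a : ℝ} (ht : 0 < t) (hq : 1 / 2 ≤ q) (hqa : q < a) :
    |t ^ q * Real.log t| ≤ 2 + t ^ a / (a - q) := by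
  have h0 : 0 < a - q := by linarith
  rcases le_total t 1 with h | h
  · have h1 := (Real.abs_log_mul_self_rpow_lt t q ht h (by linarith)).le
    have h2 : 1 / q ≤ 2 := by rw [div_le_iff₀ (by linarith)]; linarith
    rw [mul_comm]
    have h3 : 0 ≤ t ^ a / (a - q) := by positivity
    linarith
  · have h1 := Real.log_le_rpow_div ht.le h0
    rw [abs_of_nonneg (mul_nonneg (by positivity) (Real.log_nonneg h))]
    calc t ^ q * Real.log t ≤ t ^ q * (t ^ (a - q) / (a - q)) := by gcongr
      _ = t ^ a / (a - q) := by rw [mul_div_assoc', ← Real.rpow_add ht]; congr 2; ring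
      _ ≤ _ := by linarith

theorem integrable_mul_log [IsFiniteMeasure ν] (hν : ∀ᵐ t ∂ν, 0 ≤ t) {a : ℝ} (ha : 1 < a)
    (hi : Integrable (fun t : ℝ => t ^ a) ν) : Integrable (fun x : ℝ => x * Real.log x) ν := by
  refine ((integrable_const (2 : ℝ)).add (hi.div_const (a - 1))).mono'
    (by fun_prop : Measurable fun t : ℝ => t * Real.log t).aestronglyMeasurable (hν.mono fun t ht => ?_)
  rcases ht.eq_or_lt with rfl | ht
  · simp [Real.zero_rpow (by linarith : a ≠ 0)]
  · simpa using abs_rpow_mul_log_le ht (by norm_num) ha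

theorem hasDerivAt_const_rpow_of_nonneg {t q : ℝ} (ht : 0 ≤ t) (hq : 0 < q) :
    HasDerivAt (fun s : ℝ => t ^ s) (t ^ q * Real.log t) q := by
  rcases ht.eq_or_lt with rfl | ht
  · rw [Real.log_zero, mul_zero]
    refine (hasDerivAt_const q (0 : ℝ)).congr_of_eventuallyEq ?_
    filter_upwards [lt_mem_nhds hq] with s hs
    exact Real.zero_rpow hs.ne'
  · exact (Real.hasStrictDerivAt_const_rpow ht q).hasDerivAt

theorem hasDerivAt_echoMoment_one [IsFiniteMeasure ν] (hν : ∀ᵐ t ∂ν, 0 ≤ t) {a : ℝ} (ha : 1 < a)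
    (hi : Integrable (fun t : ℝ => t ^ a) ν) :
    HasDerivAt (echoMoment ν) (∫ x, x * Real.log x ∂ν) 1 := by
  have hb : 1 < (1 + a) / 2 := by linarith
  have h := (hasDerivAt_integral_of_dominated_loc_of_deriv_le (μ := ν) (𝕜 := ℝ)
    (F := fun q x => x ^ q) (F' := fun q x => x ^ q * Real.log x) (x₀ := 1)
    (bound := fun x => 2 + x ^ a / ((a - 1) / 2)) (s := Set.Ioo (1 / 2) ((1 + a) / 2))
    (Ioo_mem_nhds (by norm_num) hb)
    (Eventually.of_forall fun q => (by fun_prop : Measurable fun t : ℝ => t ^ q).aestronglyMeasurable)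
    (integrable_rpow_of_le hν zero_le_one ha.le hi)
    (by fun_prop : Measurable fun t : ℝ => t ^ (1 : ℝ) * Real.log t).aestronglyMeasurable
    (hν.mono fun t ht q hq => ?_) ((integrable_const _).add (hi.div_const _))
    (hν.mono fun t ht q hq => hasDerivAt_const_rpow_of_nonneg ht (by linarith [hq.1]))).2
  · have h' : HasDerivAt (echoMoment ν) _ 1 := h
    simpa only [Real.rpow_one] using h'
  · have h0 : 0 < (a - 1) / 2 := by linarith
    rcases ht.eq_or_lt with rfl | ht
    · rw [Real.log_zero, mul_zero, norm_zero]
      have := Real.rpow_nonneg (le_refl (0 : ℝ)) a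
      positivity
    · refine (abs_rpow_mul_log_le (a := a) ht hq.1.le (by linarith [hq.2])).trans ?_
      gcongr
      linarith [hq.2]

/-- The function `q ↦ m_q - q m_1` vanishes at `1` and has there the derivative `𝔼[ξ log ξ] - m_1 <
0`, so it is negative just to the right of `1`. -/
theorem exists_echoMoment_lt [IsFiniteMeasure ν] (hν : ∀ᵐ t ∂ν, 0 ≤ t) {a : ℝ} (ha : 1 < a)
    (hi : Integrable (fun t : ℝ => t ^ a) ν) (hlog : ∫ x, x * Real.log x ∂ν < ∫ t, t ∂ν) :
    ∃ q : ℝ, 1 < q ∧ Integrable (fun t : ℝ => t ^ q) ν ∧ echoMoment ν q < q * ∫ t, t ∂ν := by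
  set m := ∫ t, t ∂ν
  have h1 := (hasDerivAt_echoMoment_one hν ha hi).sub ((hasDerivAt_id (1 : ℝ)).mul_const m)
  have h2 := (hasDerivAt_iff_tendsto_slope.1 h1).mono_left
    (nhdsWithin_mono _ (fun x hx => (Set.mem_Ioi.1 hx).ne' : Set.Ioi (1 : ℝ) ⊆ {1}ᶜ))
  have h3 := h2.eventually_lt_const (u := 0) (by linarith)
  obtain ⟨q, hq, hq1, hqa⟩ := (h3.and (Ioo_mem_nhdsGT ha)).exists
  refine ⟨q, hq1, integrable_rpow_of_le hν (by linarith) hqa.le hi, ?_⟩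
  have hq0 : 0 < q - 1 := by linarith
  simp only [slope_def_field, Pi.sub_apply, id, echoMoment_one, one_mul] at hq
  rw [div_lt_iff₀ hq0, zero_mul] at hq
  change echoMoment ν q - q * m - (m - m) < 0 at hq
  linarith

/-- If `∫ x log x ≥ ∫ x`, then `q ↦ m_q - q m_1` cannot decrease linearly at `1`. -/
theorem not_le_echoMoment_sub [IsFiniteMeasure ν] (hν : ∀ᵐ t ∂ν, 0 ≤ t) {a : ℝ} (ha : 1 < a)
    (hi : Integrable (fun t : ℝ => t ^ a) ν) (hlog : ∫ t, t ∂ν ≤ ∫ x, x * Real.log x ∂ν)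
    {c : ℝ} (hc : 0 < c) :
    ¬ ∀ q : ℝ, 0 < q → q < 1 → c * (1 - q) ≤ echoMoment ν q - q * ∫ t, t ∂ν := by
  intro h
  set m := ∫ t, t ∂ν
  have h1 := (hasDerivAt_echoMoment_one hν ha hi).sub ((hasDerivAt_id (1 : ℝ)).mul_const m)
  have h2 := (hasDerivAt_iff_tendsto_slope.1 h1).mono_left
    (nhdsWithin_mono _ (fun x hx => (Set.mem_Iio.1 hx).ne : Set.Iio (1 : ℝ) ⊆ {1}ᶜ))
  have h3 := h2.eventually_const_lt (u := -c) (by linarith)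
  obtain ⟨q, hq, hq0, hq1⟩ := (h3.and (Ioo_mem_nhdsLT (show (0 : ℝ) < 1 by norm_num))).exists
  have hq' : q - 1 < 0 := by linarith
  simp only [slope_def_field, Pi.sub_apply, id, echoMoment_one, one_mul] at hq
  rw [lt_div_iff_of_neg hq'] at hq
  change echoMoment ν q - q * m - (m - m) < _ at hq
  linarith [h q hq0 hq1]

/-- The moments of a non-negative random variable cannot be `m_q = q m_1` for all `q`. -/
theorem exists_echoMoment_ne [IsFiniteMeasure ν] (hν : ∀ᵐ t ∂ν, 0 ≤ t)
    (hi : Integrable (fun t : ℝ => t) ν) (hm : 0 < ∫ t, t ∂ν) :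
    ∃ q : ℝ, 0 < q ∧ q < 1 ∧ echoMoment ν q ≠ q * ∫ t, t ∂ν := by
  by_contra! h
  set m := ∫ t, t ∂ν
  have hi1 : Integrable (fun t : ℝ => t ^ (1 : ℝ)) ν := by simpa using hi
  have i1 := integrable_rpow_of_le hν (q := 1 / 4) (by norm_num) (by norm_num) hi1
  have i2 := integrable_rpow_of_le hν (q := 1 / 2) (by norm_num) (by norm_num) hi1
  have i3 := integrable_rpow_of_le hν (q := 3 / 4) (by norm_num) (by norm_num) hi1
  -- The integrand is `t ^ (1/4) * (t ^ (1/4) - 2) ^ 2 ≥ 0`, whereas `m_q = q m` would give it the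
  -- integral `(3/4 - 2 + 1) m = -m / 4`.
  have h1 : 0 ≤ ∫ t, (t ^ (3 / 4 : ℝ) - 4 * t ^ (1 / 2 : ℝ) + 4 * t ^ (1 / 4 : ℝ)) ∂ν := by
    refine integral_nonneg_of_ae (hν.mono fun t ht => ?_)
    have e2 : t ^ (1 / 2 : ℝ) = (t ^ (1 / 4 : ℝ)) ^ 2 := by
      rw [← Real.rpow_natCast, ← Real.rpow_mul ht]; norm_num
    have e3 : t ^ (3 / 4 : ℝ) = (t ^ (1 / 4 : ℝ)) ^ 3 := by
      rw [← Real.rpow_natCast, ← Real.rpow_mul ht]; norm_num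
    have e0 := Real.rpow_nonneg ht (1 / 4)
    change 0 ≤ t ^ (3 / 4 : ℝ) - 4 * t ^ (1 / 2 : ℝ) + 4 * t ^ (1 / 4 : ℝ)
    rw [e2, e3]
    nlinarith [mul_nonneg e0 (sq_nonneg (t ^ (1 / 4 : ℝ) - 2))]
  rw [integral_add (f := fun t => t ^ (3 / 4 : ℝ) - 4 * t ^ (1 / 2 : ℝ))
    (i3.sub (i2.const_mul 4)) (i1.const_mul 4), integral_sub i3 (i2.const_mul 4),
    integral_const_mul, integral_const_mul] at h1
  have e1 := h (1 / 4) (by norm_num) (by norm_num)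
  have e2 := h (1 / 2) (by norm_num) (by norm_num)
  have e3 := h (3 / 4) (by norm_num) (by norm_num)
  simp only [echoMoment] at e1 e2 e3
  rw [e1, e2, e3] at h1
  linarith

/-- For `y ≤ x`, concavity gives `(x + y) ^ q ≤ x ^ q + q x ^ (q - 1) y`, and `x ^ (q - 1) y ≤ y ^
q`. The gain over plain subadditivity is linear in `1 - q`, the order needed to contradict the
derivative at `1`. -/
theorem add_rpow_le_sub_min {x y q : ℝ} (hx : 0 ≤ x) (hy : 0 ≤ y) (hq : 0 < q) (hq1 : q < 1) :
    (x + y) ^ q ≤ x ^ q + y ^ q - (1 - q) * min x y ^ q := by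
  wlog hyx : y ≤ x generalizing x y
  · have := this hy hx (le_of_not_ge hyx)
    rw [add_comm x, min_comm]
    linarith
  rw [min_eq_right hyx]
  rcases hy.eq_or_lt with rfl | hy
  · simp [Real.zero_rpow hq.ne']
  have hx : 0 < x := hy.trans_le hyx
  have h1 := rpow_one_add_le_one_add_mul_self (s := y / x) (by linarith [div_nonneg hy.le hx.le])
    hq.le hq1.le
  have h2 : (x + y) ^ q = x ^ q * (1 + y / x) ^ q := by
    rw [← Real.mul_rpow hx.le (by positivity)]
    congr 1
    field_simp
  have h3 : x ^ q * (y / x) ≤ y ^ q := by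
    have h4 : (y / x) ^ (1 : ℝ) ≤ (y / x) ^ q :=
      Real.rpow_le_rpow_of_exponent_ge (by positivity) (div_le_one_of_le₀ hyx hx.le) hq1.le
    rw [Real.rpow_one, Real.div_rpow hy.le hx.le, le_div_iff₀ (by positivity)] at h4
    linarith
  rw [h2]
  have h5 : 0 < x ^ q := by positivity
  nlinarith [mul_le_mul_of_nonneg_left h1 h5.le]

/-- A solution `L = A + T B` of the smoothing equation vanishes if the law of `T` is critical or
supercritical. -/
theorem ae_eq_zero_of_smoothing {Ω : Type*} [MeasurableSpace Ω] {μ : Measure Ω}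
    [IsProbabilityMeasure μ] [IsProbabilityMeasure ν] (hν : ∀ᵐ t ∂ν, 0 ≤ t) {a : ℝ} (ha : 1 < a)
    (hi : Integrable (fun t : ℝ => t ^ a) ν) (hlog : ∫ t, t ∂ν ≤ ∫ x, x * Real.log x ∂ν)
    (hm : 0 < ∫ t, t ∂ν) {A B T L : Ω → ℝ} (hT : AEMeasurable T μ) (hTν : μ.map T = ν)
    (hA : Integrable A μ) (hB : Integrable B μ) (hL : Integrable L μ)
    (hA0 : ∀ᵐ ω ∂μ, 0 ≤ A ω) (hB0 : ∀ᵐ ω ∂μ, 0 ≤ B ω) (hLAB : ∀ᵐ ω ∂μ, L ω = A ω + T ω * B ω)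
    (hTB : IndepFun T B μ)
    (hAq : ∀ q : ℝ, 0 < q → q < 1 → ∫ ω, A ω ^ q ∂μ = (∫ ω, L ω ^ q ∂μ) / (1 + q * ∫ t, t ∂ν))
    (hBq : ∀ q : ℝ, 0 < q → q < 1 → ∫ ω, B ω ^ q ∂μ = (∫ ω, L ω ^ q ∂μ) / (1 + q * ∫ t, t ∂ν)) :
    ∀ᵐ ω ∂μ, L ω = 0 := by
  set m := ∫ t, t ∂ν
  have hT0 : ∀ᵐ ω ∂μ, 0 ≤ T ω := ae_of_ae_map hT (hTν ▸ hν)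
  have hL0 : ∀ᵐ ω ∂μ, 0 ≤ L ω := by
    filter_upwards [hA0, hB0, hT0, hLAB] with ω h1 h2 h3 h4
    rw [h4]; positivity
  have hi1 : Integrable (fun t : ℝ => t) ν := by
    simpa using integrable_rpow_of_le hν zero_le_one ha.le hi
  have hTi : Integrable T μ := by
    rw [← hTν] at hi1
    exact hi1.comp_aemeasurable hT
  have hTBi : Integrable (fun ω => T ω * B ω) μ := hTB.integrable_mul hTi hB
  have hTB0 : ∀ᵐ ω ∂μ, 0 ≤ T ω * B ω := by
    filter_upwards [hB0, hT0] with ω h1 h2 using mul_nonneg h2 h1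
  have hpow : ∀ f : Ω → ℝ, Integrable f μ → (∀ᵐ ω ∂μ, 0 ≤ f ω) → ∀ q : ℝ, 0 < q → q < 1 →
      Integrable (fun ω => f ω ^ q) μ := fun f hf hf0 q hq hq1 =>
    integrable_rpow_comp_of_le hf.aemeasurable hf0 hq.le hq1.le (by simpa only [Real.rpow_one] using hf)
  have hTBq : ∀ q : ℝ, 0 < q → q < 1 →
      ∫ ω, (T ω * B ω) ^ q ∂μ = echoMoment ν q * ∫ ω, B ω ^ q ∂μ := by
    intro q hq hq1
    have hmq : Measurable fun t : ℝ => t ^ q := by fun_prop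
    have h1 : ∫ ω, (T ω * B ω) ^ q ∂μ = ∫ ω, T ω ^ q * B ω ^ q ∂μ :=
      integral_congr_ae (by filter_upwards [hB0, hT0] with ω h1 h2 using Real.mul_rpow h2 h1)
    have h2 : ∫ ω, T ω ^ q * B ω ^ q ∂μ = (∫ ω, T ω ^ q ∂μ) * ∫ ω, B ω ^ q ∂μ :=
      (hTB.comp hmq hmq).integral_fun_mul_eq_mul_integral
        (hpow T hTi hT0 q hq hq1).aestronglyMeasurable (hpow B hB hB0 q hq hq1).aestronglyMeasurable
    rw [h1, h2, echoMoment, ← hTν, integral_map hT hmq.aestronglyMeasurable]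
  have hmin : Integrable (fun ω => min (A ω) (T ω * B ω)) μ := hA.inf hTBi
  have hmin0 : ∀ᵐ ω ∂μ, 0 ≤ min (A ω) (T ω * B ω) := by
    filter_upwards [hA0, hTB0] with ω h1 h2 using le_min h1 h2
  by_contra hne
  have hLpos : ∀ q : ℝ, 0 < q → q < 1 → 0 < ∫ ω, L ω ^ q ∂μ := by
    intro q hq hq1
    have h0 : 0 ≤ᵐ[μ] fun ω => L ω ^ q := hL0.mono fun ω hω => Real.rpow_nonneg hω q
    refine lt_of_le_of_ne (integral_nonneg_of_ae h0) fun h => hne ?_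
    have h1 := (integral_eq_zero_iff_of_nonneg_ae h0 (hpow L hL hL0 q hq hq1)).1 h.symm
    filter_upwards [h1, hL0] with ω h2 h3
    exact (Real.rpow_eq_zero h3 hq.ne').1 h2
  -- If `A` and `T B` are almost surely never positive together, then `L ^ q = A ^ q + (T B) ^ q`,
  -- which forces `m_q = q m` for all `q < 1`. Otherwise subadditivity has a strict gain.
  by_cases hz : ∀ᵐ ω ∂μ, min (A ω) (T ω * B ω) = 0
  · obtain ⟨q, hq, hq1, hqne⟩ := exists_echoMoment_ne hν hi1 hm
    refine hqne ?_
    have h1 : ∫ ω, L ω ^ q ∂μ = ∫ ω, (A ω ^ q + (T ω * B ω) ^ q) ∂μ := by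
      refine integral_congr_ae ?_
      filter_upwards [hLAB, hz, hA0, hTB0] with ω h1 h2 h3 h4
      rw [h1]
      rcases le_total (A ω) (T ω * B ω) with h | h
      · rw [min_eq_left h] at h2; simp [h2, Real.zero_rpow hq.ne']
      · rw [min_eq_right h] at h2; simp [h2, Real.zero_rpow hq.ne']
    rw [integral_add (hpow A hA hA0 q hq hq1) (hpow _ hTBi hTB0 q hq hq1), hTBq q hq hq1,
      hAq q hq hq1, hBq q hq hq1] at h1
    have h2 := hLpos q hq hq1
    have h3 : 0 < 1 + q * m := by positivity
    field_simp at h1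
    linarith
  -- Truncation at `1` bounds `𝔼[min(A, T B) ^ q]` below by a constant that does not depend on `q`;
  -- likewise `𝔼[L ^ q] ≤ 1 + 𝔼 L`. The quotient of the two constants is the slope to be
  -- contradicted.
  · have hc : 0 < ∫ ω, min (min (A ω) (T ω * B ω)) 1 ∂μ := by
      have h0 : 0 ≤ᵐ[μ] fun ω => min (min (A ω) (T ω * B ω)) 1 :=
        hmin0.mono fun ω hω => le_min hω zero_le_one
      refine lt_of_le_of_ne (integral_nonneg_of_ae h0) fun h => hz ?_
      have h1 := (integral_eq_zero_iff_of_nonneg_ae h0 (hmin.inf (integrable_const 1))).1 h.symm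
      filter_upwards [h1] with ω h2
      rcases min_choice (min (A ω) (T ω * B ω)) 1 with h3 | h3
      · exact h3.symm.trans h2
      · exact absurd (h3.symm.trans h2) one_ne_zero
    set c := ∫ ω, min (min (A ω) (T ω * B ω)) 1 ∂μ
    have hM : 0 < 1 + ∫ ω, L ω ∂μ := by linarith [integral_nonneg_of_ae hL0]
    refine not_le_echoMoment_sub hν ha hi hlog (div_pos hc hM) fun q hq hq1 => ?_
    have hκ : c ≤ ∫ ω, min (A ω) (T ω * B ω) ^ q ∂μ := by
      refine integral_mono_ae (hmin.inf (integrable_const 1)) (hpow _ hmin hmin0 q hq hq1) ?_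
      filter_upwards [hmin0] with ω hω
      rcases le_total (min (A ω) (T ω * B ω)) 1 with h | h
      · rw [min_eq_left h]
        simpa using Real.rpow_le_rpow_of_exponent_ge' hω h hq.le hq1.le
      · rw [min_eq_right h]
        exact Real.one_le_rpow h hq.le
    have hℓ : ∫ ω, L ω ^ q ∂μ ≤ 1 + ∫ ω, L ω ∂μ := by
      have h1 : ∫ ω, L ω ^ q ∂μ ≤ ∫ ω, (1 + L ω) ∂μ := by
        refine integral_mono_ae (hpow L hL hL0 q hq hq1) ((integrable_const 1).add hL) ?_
        filter_upwards [hL0] with ω hω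
        rcases le_total (L ω) 1 with h | h
        · linarith [Real.rpow_le_one hω h hq.le]
        · have := Real.rpow_le_rpow_of_exponent_le h hq1.le
          rw [Real.rpow_one] at this
          linarith
      rw [integral_add (integrable_const 1) hL] at h1
      simpa using h1
    have hmain : ∫ ω, L ω ^ q ∂μ ≤ ∫ ω, A ω ^ q ∂μ + ∫ ω, (T ω * B ω) ^ q ∂μ
        - (1 - q) * ∫ ω, min (A ω) (T ω * B ω) ^ q ∂μ := by
      have i1 := hpow A hA hA0 q hq hq1
      have i2 := hpow _ hTBi hTB0 q hq hq1
      have i3 := (hpow _ hmin hmin0 q hq hq1).const_mul (1 - q)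
      have i12 : Integrable (fun ω => A ω ^ q + (T ω * B ω) ^ q) μ := i1.add i2
      rw [← integral_add i1 i2, ← integral_const_mul, ← integral_sub i12 i3]
      refine integral_mono_ae (hpow L hL hL0 q hq hq1) (i12.sub i3) ?_
      filter_upwards [hLAB, hA0, hTB0] with ω h1 h2 h3
      rw [h1]
      exact add_rpow_le_sub_min h2 h3 hq hq1
    rw [hTBq q hq hq1, hAq q hq hq1, hBq q hq hq1] at hmain
    have h2 := hLpos q hq hq1
    have h3 : 0 < 1 + q * m := by positivity
    set ℓ := ∫ ω, L ω ^ q ∂μ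
    set κ := ∫ ω, min (A ω) (T ω * B ω) ^ q ∂μ
    have h4 : (1 - q) * κ * (1 + q * m) ≤ ℓ * (echoMoment ν q - q * m) := by
      have h5 : ℓ / (1 + q * m) + echoMoment ν q * (ℓ / (1 + q * m)) - (1 - q) * κ
          = (ℓ + echoMoment ν q * ℓ - (1 - q) * κ * (1 + q * m)) / (1 + q * m) := by
        field_simp
      rw [h5, le_div_iff₀ h3] at hmain
      linarith
    have hq1' : 0 < 1 - q := by linarith
    have h6 : (1 - q) * c ≤ ℓ * (echoMoment ν q - q * m) := by
      refine le_trans ?_ h4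
      have : 0 < κ := hc.trans_le hκ
      have h7 : (1 - q) * c ≤ (1 - q) * κ := by gcongr
      have h8 : 0 ≤ (1 - q) * κ * (q * m) := by positivity
      linarith
    have h9 : 0 < echoMoment ν q - q * m := by
      have : 0 < ℓ * (echoMoment ν q - q * m) := lt_of_lt_of_le (by positivity) h6
      exact pos_of_mul_pos_right this h2.le
    rw [div_mul_eq_mul_div, div_le_iff₀ hM]
    have h10 := mul_le_mul_of_nonneg_right hℓ h9.le
    linarith

end Moments

/-! ### Vanishing and non-degeneracy of the limit masses -/

section IsGrowth

variable {Ω : Type*} [MeasurableSpace Ω] {ν : Measure ℝ} {X : Ω → ℕ → ℝ × ℕ} {μ : Measure Ω}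

/-- The limit mass as a function of the inputs. -/
noncomputable def limitFlow (m : ℝ) (i r : ℕ) (x : ℕ → ℝ × ℕ) : ℝ :=
  limsup (fun n : ℕ => flowSum x (Pi.single i 1) r n / (n : ℝ) ^ m) atTop

theorem measurable_limitFlow (m : ℝ) (i r : ℕ) : Measurable (limitFlow m i r) :=
  Measurable.limsup fun n => (measurable_flowSum _ r n).div_const _

/-- The flow from `r` reads only the inputs after `r`; hence the limit is independent of the echo
and of the percolation variable at `r`. -/
theorem limitFlow_congr (m : ℝ) (i : ℕ) {r : ℕ} {x y : ℕ → ℝ × ℕ} (h : ∀ j, r < j → x j = y j) :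
    limitFlow m i r x = limitFlow m i r y := by
  unfold limitFlow
  simp only [flowSum_congr_of_lt (Pi.single i 1) fun j h1 _ => h j h1]

theorem IsGrowth.limitMass_ae_eq [IsProbabilityMeasure ν] [IsProbabilityMeasure μ]
    (h : IsGrowth ν X μ) (hν : ∀ᵐ t ∂ν, 0 ≤ t) (hi : Integrable (fun t : ℝ => t) ν)
    {i r : ℕ} (hi1 : 1 ≤ i) (hir : i ≤ r) :
    h.limitMass i r =ᵐ[μ] fun ω => limitFlow (∫ t, t ∂ν) i r (X ω) := by
  filter_upwards [h.tendsto_flowSum hν hi hi1 hir] with ω hω using hω.limsup_eq.symm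

theorem IsGrowth.map_fst [IsProbabilityMeasure ν] (h : IsGrowth ν X μ) {n : ℕ} (hn : 2 ≤ n) :
    μ.map (fun ω => (X ω n).1) = ν := by
  have := isProbabilityMeasure_uniformOn_Icc hn
  have h1 := Measure.map_map (μ := μ) measurable_fst (measurable_pi_iff.1 h.measurable n)
  rw [h.law n hn, Measure.map_fst_prod, measure_univ, one_smul] at h1
  exact h1.symm

theorem IsGrowth.map_snd [IsProbabilityMeasure ν] (h : IsGrowth ν X μ) {n : ℕ} (hn : 2 ≤ n) :
    μ.map (fun ω => (X ω n).2) = uniformOn (Set.Icc 1 (n - 1)) := by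
  have h1 := Measure.map_map (μ := μ) measurable_snd (measurable_pi_iff.1 h.measurable n)
  rw [h.law n hn, Measure.map_snd_prod, measure_univ, one_smul] at h1
  exact h1.symm

theorem IsGrowth.limitMass_one_ae_eq [IsProbabilityMeasure ν] [IsProbabilityMeasure μ]
    (h : IsGrowth ν X μ) (hν : ∀ᵐ t ∂ν, 0 ≤ t) (hi : Integrable (fun t : ℝ => t) ν) :
    ∀ᵐ ω ∂μ, h.limitMass 1 1 ω = h.limitMass 1 2 ω + (X ω 2).1 * h.limitMass 2 2 ω := by
  filter_upwards [h.tendsto_flowSum hν hi le_rfl le_rfl,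
    h.tendsto_flowSum hν hi (i := 1) (r := 2) le_rfl one_le_two,
    h.tendsto_flowSum hν hi (i := 2) (r := 2) one_le_two le_rfl] with ω h1 h2 h3
  refine tendsto_nhds_unique h1 ((h2.add (h3.const_mul (X ω 2).1)).congr fun n => ?_)
  rw [flowSum_eq_add (h.recursive ω)]
  ring

theorem beta_one_add_one_div {s : ℝ} (hs : 0 ≤ s) : beta (1 + s) 1 / beta 1 1 = 1 / (1 + s) := by
  have h1 : 0 < 1 + s := by linarith
  have h2 := (Real.Gamma_pos_of_pos h1).ne'
  rw [beta, beta, Real.Gamma_one, Real.Gamma_add_one h1.ne', Real.Gamma_add_one one_ne_zero,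
    Real.Gamma_one]
  field_simp

theorem IsGrowth.integral_limitMass_rpow [IsProbabilityMeasure ν] [IsProbabilityMeasure μ]
    (h : IsGrowth ν X μ) (hν : ∀ᵐ t ∂ν, 0 ≤ t) (hint : Integrable (fun t : ℝ => t) ν)
    {i r : ℕ} (hi1 : 1 ≤ i) (hir : i ≤ r) (hr : 2 ≤ r) {q : ℝ} (hq : 0 ≤ q) :
    ∫ ω, h.limitMass i r ω ^ q ∂μ = (∫ ω, h.limitMass 1 1 ω ^ q ∂μ) *
      (beta (1 + q * ∫ t, t ∂ν) ((r : ℝ) - 1) / beta 1 ((r : ℝ) - 1)) := by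
  set m := ∫ t, t ∂ν
  have hm : 0 ≤ m := integral_nonneg_of_ae hν
  have hb : (0 : ℝ) < (r : ℝ) - 1 := by
    have : (2 : ℝ) ≤ r := by exact_mod_cast hr
    linarith
  have hZ := (h.integrable_limitMass hν hint le_rfl le_rfl).aemeasurable
  have := Measure.isProbabilityMeasure_map hZ
  have := isProbabilityMeasureBeta one_pos hb
  have hmq : Measurable fun t : ℝ => t ^ q := by fun_prop
  have h1 := ((h.identDistrib_limitMass h hν hint hi1 hir hr).comp hmq).integral_eq
  simp only [Function.comp_def] at h1
  have hZ0 : ∀ᵐ z ∂(μ.map (h.limitMass 1 1)), 0 ≤ z :=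
    (ae_map_iff hZ measurableSet_Ici).2 (h.limitMass_nonneg hν hint le_rfl le_rfl)
  have h2 : ∫ z : ℝ × ℝ, (z.1 * z.2 ^ m) ^ q ∂((μ.map (h.limitMass 1 1)).prod
      (betaMeasure 1 ((r : ℝ) - 1))) = ∫ z : ℝ × ℝ, z.1 ^ q * z.2 ^ (q * m)
        ∂((μ.map (h.limitMass 1 1)).prod (betaMeasure 1 ((r : ℝ) - 1))) := by
    refine integral_congr_ae ?_
    filter_upwards [Measure.quasiMeasurePreserving_fst.ae hZ0,
      Measure.quasiMeasurePreserving_snd.ae betaMeasure_ae_mem] with z h3 h4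
    rw [Real.mul_rpow h3 (Real.rpow_nonneg h4.1.le m), ← Real.rpow_mul h4.1.le, mul_comm m]
  rw [h1, h2, integral_prod_mul (fun z : ℝ => z ^ q) (fun b : ℝ => b ^ (q * m)),
    integral_rpow_betaMeasure hb (mul_nonneg hq hm), integral_map hZ hmq.aestronglyMeasurable]

theorem IsGrowth.indepFun_limitMass_two [IsProbabilityMeasure ν] [IsProbabilityMeasure μ]
    (h : IsGrowth ν X μ) (hν : ∀ᵐ t ∂ν, 0 ≤ t) (hint : Integrable (fun t : ℝ => t) ν) :
    IndepFun (fun ω => (X ω 2).1) (h.limitMass 2 2) μ := by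
  have h1 := indepFun_mask h.measurable h.indep (S := {2}) (T := Set.Ici 3) (by simp)
    (Set.Ici_subset_Ici.2 (by norm_num)) (by simp) 0
  have hg : Measurable fun x : ℕ → ℝ × ℕ => (x 2).1 := (measurable_pi_apply 2).fst
  have h2 := h1.comp hg (measurable_limitFlow (∫ t, t ∂ν) 2 2)
  refine h2.congr (ae_of_all _ fun ω => by simp [mask]) ?_
  filter_upwards [h.limitMass_ae_eq hν hint (i := 2) (r := 2) one_le_two le_rfl] with ω hω
  rw [hω]
  exact limitFlow_congr _ _ fun j hj => if_pos hj

/-- The limit masses vanish if the echo law is critical or supercritical. -/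
theorem IsGrowth.limitMass_eq_zero [IsProbabilityMeasure ν] [IsProbabilityMeasure μ]
    (h : IsGrowth ν X μ) (hν : ∀ᵐ t ∂ν, 0 ≤ t) {a : ℝ} (ha : 1 < a)
    (hi : Integrable (fun t : ℝ => t ^ a) ν) (hm : 0 < ∫ t, t ∂ν)
    (hlog : ∫ t, t ∂ν ≤ ∫ x, x * Real.log x ∂ν) {i r : ℕ} (hi1 : 1 ≤ i) (hir : i ≤ r) :
    ∀ᵐ ω ∂μ, h.limitMass i r ω = 0 := by
  have hint : Integrable (fun t : ℝ => t) ν := by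
    simpa using integrable_rpow_of_le hν zero_le_one ha.le hi
  have hone : ∀ᵐ ω ∂μ, h.limitMass 1 1 ω = 0 := by
    have hq : ∀ i, 1 ≤ i → i ≤ 2 → ∀ q : ℝ, 0 < q → q < 1 → ∫ ω, h.limitMass i 2 ω ^ q ∂μ
        = (∫ ω, h.limitMass 1 1 ω ^ q ∂μ) / (1 + q * ∫ t, t ∂ν) := by
      intro i h1 h2 q hq hq1
      -- For `r = 2` the proportion is uniform on `[0, 1]`, and its moment of order `q m` is `1 / (1
      -- + q m)`.
      rw [h.integral_limitMass_rpow hν hint h1 h2 le_rfl hq.le]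
      norm_num only [Nat.cast_ofNat]
      rw [beta_one_add_one_div (by positivity), mul_one_div]
    exact ae_eq_zero_of_smoothing hν ha hi hlog hm
      (measurable_pi_iff.1 h.measurable 2).fst.aemeasurable (h.map_fst le_rfl)
      (h.integrable_limitMass hν hint le_rfl one_le_two)
      (h.integrable_limitMass hν hint one_le_two le_rfl)
      (h.integrable_limitMass hν hint le_rfl le_rfl)
      (h.limitMass_nonneg hν hint le_rfl one_le_two)
      (h.limitMass_nonneg hν hint one_le_two le_rfl)
      (h.limitMass_one_ae_eq hν hint) (h.indepFun_limitMass_two hν hint)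
      (hq 1 le_rfl one_le_two) (hq 2 one_le_two le_rfl)
  rcases (hi1.trans hir).eq_or_lt with rfl | hr
  · obtain rfl : i = 1 := le_antisymm hir hi1
    exact hone
  have h0 : 0 ≤ᵐ[μ] h.limitMass i r := h.limitMass_nonneg hν hint hi1 hir
  -- For `r ≥ 2` the mean of the nonnegative limit is a multiple of the mean for the whole tree,
  -- which is `0`.
  have h1 := h.integral_limitMass_rpow hν hint hi1 hir hr zero_le_one
  have h2 : ∫ ω, h.limitMass 1 1 ω ∂μ = 0 := by simp [integral_congr_ae hone]
  simp only [Real.rpow_one, h2, zero_mul] at h1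
  exact (integral_eq_zero_iff_of_nonneg_ae h0 (h.integrable_limitMass hν hint hi1 hir)).1 h1

theorem flowSum_one_two {x : ℕ → ℝ × ℕ} (hx : IsRecursive x) :
    flowSum x (Pi.single 1 1) 1 2 = 1 + (x 2).1 := by
  have h2 := hx 2 le_rfl
  have h3 : flow x (Pi.single 1 1) 1 2 = (x 2).1 := by
    rw [flow_of_lt hx _ le_rfl one_lt_two, show (x 2).2 = 1 by omega, flow_of_le _ _ le_rfl,
      Pi.single_eq_same, mul_one]
  rw [flowSum_succ, flowSum_single _ le_rfl le_rfl, h3]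

theorem flowSum_one_three {x : ℕ → ℝ × ℕ} (hx : IsRecursive x) :
    flowSum x (Pi.single 1 1) 1 3
      = 1 + (x 2).1 + (x 3).1 * if (x 3).2 = 1 then 1 else (x 2).1 := by
  have h2 := hx 2 le_rfl
  have h3 := hx 3 (by norm_num)
  rw [flowSum_succ, flowSum_one_two hx, flow_of_lt hx _ le_rfl (by norm_num)]
  split_ifs with h
  · rw [h, flow_of_le _ _ le_rfl, Pi.single_eq_same]
  · rw [show (x 3).2 = 2 by omega, flow_of_lt hx _ le_rfl one_lt_two,
      show (x 2).2 = 1 by omega, flow_of_le _ _ le_rfl, Pi.single_eq_same, mul_one]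

theorem forall_mem_of_ae_uniformOn {s : Set ℕ} (hs : s.Finite) {P : ℕ → Prop}
    (h : ∀ᵐ u ∂(uniformOn s), P u) : ∀ u ∈ s, P u := by
  intro u hu
  by_contra hP
  have h1 := (uniformOn_eq_zero_iff hs).1 (ae_iff.1 h)
  exact Set.notMem_empty u (h1 ▸ ⟨hu, hP⟩)

/-- The limit mass is deterministic only if the echo variables are equal to `1`. -/
theorem IsGrowth.ae_eq_one_of_limitMass_const [IsProbabilityMeasure ν] [IsProbabilityMeasure μ]
    (h : IsGrowth ν X μ) (hν : ∀ᵐ t ∂ν, 0 ≤ t) (hint : Integrable (fun t : ℝ => t) ν)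
    (hm : 0 < ∫ t, t ∂ν) {q : ℝ} (hq : 1 < q) (hi : Integrable (fun t : ℝ => t ^ q) ν)
    (hlt : echoMoment ν q < q * ∫ t, t ∂ν) {c : ℝ} (hc : h.limitMass 1 1 =ᵐ[μ] fun _ => c) :
    ∀ᵐ t ∂ν, t = 1 := by
  set m := ∫ t, t ∂ν with hm_def
  -- The limit closes the martingale, so if it is constant, the total mass is deterministic at every
  -- time.
  have hk : ∀ k, ∀ᵐ ω ∂μ, flowSum (X ω) (Pi.single 1 1) 1 (1 + k) = c * gammaRatio m (1 + k) := by
    intro k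
    have h1 := (h.memLp_limitMass_and_tendsto hν hint hq hi hlt (le_refl 1) le_rfl).2.1 k
    have h2 := h1.trans (condExp_congr_ae hc)
    rw [condExp_const ((h.filtration 1).le k)] at h2
    filter_upwards [h2] with ω hω
    rw [← hω, massRatio, div_mul_cancel₀ _ (gammaRatio_pos hm.le (by omega)).ne']
  have hX : ∀ n, 2 ≤ n → AEMeasurable (fun ω => (X ω n).1) μ := fun n _ =>
    (measurable_pi_iff.1 h.measurable n).fst.aemeasurable
  obtain ⟨d, hd⟩ : ∃ d, ∀ᵐ t ∂ν, t = d := by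
    refine ⟨c * gammaRatio m (1 + 1) - 1, ?_⟩
    rw [← h.map_fst le_rfl]
    refine (ae_map_iff (hX 2 le_rfl) (measurableSet_singleton (c * gammaRatio m (1 + 1) - 1))).2 ?_
    filter_upwards [hk 1] with ω hω
    have := hω
    rw [flowSum_one_two (h.recursive ω)] at this
    change (X ω 2).1 = c * gammaRatio m (1 + 1) - 1
    linarith
  have hdm : m = d := by
    rw [hm_def, integral_congr_ae hd]; simp
  have hXd : ∀ n, 2 ≤ n → ∀ᵐ ω ∂μ, (X ω n).1 = d := fun n hn =>
    ae_of_ae_map (hX n hn) (by rw [h.map_fst hn]; exact hd)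
  -- With all echoes equal to `d`, the total at time `3` is `1 + 2 d` or `1 + d + d ^ 2` according
  -- to the parent of vertex `3`. Both parents have positive probability, so `d = d ^ 2`.
  have h3 : ∀ᵐ u ∂(uniformOn (Set.Icc 1 (3 - 1))),
      1 + d + d * (if u = 1 then 1 else d) = c * gammaRatio m (1 + 2) := by
    rw [← h.map_snd (show 2 ≤ 3 by norm_num), ae_map_iff
      (measurable_pi_iff.1 h.measurable 3).snd.aemeasurable (Set.to_countable _).measurableSet]
    filter_upwards [hk 2, hXd 2 le_rfl, hXd 3 (by norm_num)] with ω h1 h2 h3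
    have := h1
    rwa [flowSum_one_three (h.recursive ω), h2, h3] at this
  have h4 := forall_mem_of_ae_uniformOn (Set.finite_Icc 1 (3 - 1)) h3
  have h5 := h4 1 (by simp)
  have h6 := h4 2 (by simp)
  simp only [if_true, OfNat.ofNat_ne_one, if_false] at h5 h6
  have h7 : d * (d - 1) = 0 := by linarith
  have h8 : d = 1 := by
    rcases mul_eq_zero.1 h7 with h8 | h8 <;> linarith
  rwa [h8] at hd

end IsGrowth

/-! ### The echo law of the product `ε ξ` -/

section Thinning

variable {p : unitInterval} {ν : Measure ℝ}

theorem thinnedEchoLaw_eq [IsProbabilityMeasure ν] :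
    thinnedEchoLaw p ν = unitInterval.toNNReal p • ν
      + unitInterval.toNNReal (unitInterval.symm p) • Measure.dirac 0 := by
  have hm : Measurable fun q : ℝ × ℝ => q.1 * q.2 := by fun_prop
  have h1 : ν.map (fun x => (1 : ℝ) * x) = ν := by simp
  have h0 : ν.map (fun x => (0 : ℝ) * x) = Measure.dirac 0 := by simp
  rw [thinnedEchoLaw, bernoulliMeasure_def, Measure.add_prod, Measure.prod_smul_left,
    Measure.prod_smul_left, Measure.map_add _ _ hm, Measure.map_smul, Measure.map_smul,
    Measure.dirac_prod, Measure.dirac_prod, Measure.map_map hm (by fun_prop),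
    Measure.map_map hm (by fun_prop)]
  exact congrArg₂ (· + ·) (congrArg _ h1) (congrArg _ h0)

theorem isProbabilityMeasure_thinnedEchoLaw [IsProbabilityMeasure ν] :
    IsProbabilityMeasure (thinnedEchoLaw p ν) :=
  Measure.isProbabilityMeasure_map (by fun_prop : Measurable fun q : ℝ × ℝ => q.1 * q.2).aemeasurable

theorem thinnedEchoLaw_one [IsProbabilityMeasure ν] : thinnedEchoLaw 1 ν = ν := by
  simp [thinnedEchoLaw_eq]

theorem ae_thinnedEchoLaw_nonneg [IsProbabilityMeasure ν] (hν : ∀ᵐ t ∂ν, 0 ≤ t) :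
    ∀ᵐ t ∂(thinnedEchoLaw p ν), 0 ≤ t := by
  rw [thinnedEchoLaw_eq, ae_add_measure_iff]
  refine ⟨Measure.ae_smul_measure hν _, Measure.ae_smul_measure ?_ _⟩
  rw [ae_dirac_eq]
  exact le_refl (0 : ℝ)

theorem integrable_thinnedEchoLaw [IsProbabilityMeasure ν] {f : ℝ → ℝ} (hf : Integrable f ν) :
    Integrable f (thinnedEchoLaw p ν) := by
  rw [thinnedEchoLaw_eq]
  exact hf.smul_measure_nnreal.add_measure (integrable_dirac (by simp)).smul_measure_nnreal

/-- The atom at `0` is invisible to functions that vanish there. Applied to `t ^ q` and `t log t`,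
this multiplies both sides of each threshold inequality by `p`. -/
theorem integral_thinnedEchoLaw [IsProbabilityMeasure ν] {f : ℝ → ℝ} (hf : Integrable f ν)
    (h0 : f 0 = 0) : ∫ x, f x ∂(thinnedEchoLaw p ν) = p * ∫ x, f x ∂ν := by
  rw [thinnedEchoLaw_eq, integral_add_measure hf.smul_measure_nnreal
    (integrable_dirac (by simp)).smul_measure_nnreal]
  simp [h0, NNReal.smul_def]

end Thinning

/-! ### A measurable version of the inputs -/

section Model

variable {Ω : Type*} [MeasurableSpace Ω] {μ : Measure Ω} {p : unitInterval} {ν : Measure ℝ}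
  {ε ξ : ℕ → Ω → ℝ} {U : ℕ → Ω → ℕ}

/-- A measurable version of the inputs of the echo model, with values in the expected ranges for
every outcome. -/
structure IsVersion (p : unitInterval) (ν : Measure ℝ) (ε ξ : ℕ → Ω → ℝ) (U : ℕ → Ω → ℕ)
    (μ : Measure Ω) (Y : Ω → ℕ → ℝ × ℝ × ℕ) : Prop where
  measurable : Measurable Y
  keep : ∀ ω n, 2 ≤ n → (Y ω n).1 = 0 ∨ (Y ω n).1 = 1
  nonneg : ∀ ω n, 2 ≤ n → 0 ≤ (Y ω n).2.1
  parent : ∀ ω n, 2 ≤ n → 1 ≤ (Y ω n).2.2 ∧ (Y ω n).2.2 < n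
  law : ∀ n, 2 ≤ n → μ.map (fun ω => Y ω n)
    = (bernoulliMeasure (1 : ℝ) 0 p).prod (ν.prod (uniformOn (Set.Icc 1 (n - 1))))
  indep : iIndepFun (fun (n : Set.Ici (2 : ℕ)) ω => Y ω n) μ
  ae_eq : ∀ᵐ ω ∂μ, ∀ n, 2 ≤ n → (ε n ω, ξ n ω, U n ω) = Y ω n

/-- Move a triple of inputs of the vertex `n` to the expected ranges. -/
noncomputable def clampInput (n : ℕ) (y : ℝ × ℝ × ℕ) : ℝ × ℝ × ℕ :=
  (if y.1 = 1 then 1 else 0, max y.2.1 0, if 1 ≤ y.2.2 ∧ y.2.2 < n then y.2.2 else 1)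

theorem measurable_clampInput (n : ℕ) : Measurable (clampInput n) := by
  refine Measurable.prodMk ?_ (Measurable.prodMk (by fun_prop) ?_)
  · exact Measurable.ite (measurable_fst (measurableSet_singleton 1)) measurable_const measurable_const
  · exact (measurable_from_top (f := fun u : ℕ => if 1 ≤ u ∧ u < n then u else 1)).comp
      measurable_snd.snd

theorem ae_mem_uniformOn_Icc (n : ℕ) : ∀ᵐ u ∂(uniformOn (Set.Icc 1 (n - 1))), u ∈ Set.Icc 1 (n - 1) :=
  ae_cond_mem (Set.to_countable _).measurableSet

theorem ae_clampInput_eq [IsProbabilityMeasure ν] (hν : ∀ᵐ t ∂ν, 0 ≤ t) {n : ℕ} (hn : 2 ≤ n) :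
    ∀ᵐ y ∂((bernoulliMeasure (1 : ℝ) 0 p).prod (ν.prod (uniformOn (Set.Icc 1 (n - 1))))),
      clampInput n y = y := by
  have := isProbabilityMeasure_uniformOn_Icc hn
  have h1 : ∀ᵐ e ∂(bernoulliMeasure (1 : ℝ) 0 p), e = 1 ∨ e = 0 := by
    rw [bernoulliMeasure_def, ae_add_measure_iff]
    refine ⟨Measure.ae_smul_measure ?_ _, Measure.ae_smul_measure ?_ _⟩ <;> simp [ae_dirac_eq]
  filter_upwards [Measure.quasiMeasurePreserving_fst.ae h1, Measure.quasiMeasurePreserving_snd.ae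
    (Measure.quasiMeasurePreserving_fst.ae hν), Measure.quasiMeasurePreserving_snd.ae
    (Measure.quasiMeasurePreserving_snd.ae (ae_mem_uniformOn_Icc n))] with y h1 h2 h3
  have h4 : 1 ≤ y.2.2 ∧ y.2.2 < n := ⟨h3.1, by have := h3.2; omega⟩
  rw [clampInput, if_pos h4, max_eq_left h2]
  refine Prod.ext ?_ rfl
  rcases h1 with h1 | h1 <;> simp [h1]

/-- The model gives ranges and measurability only almost everywhere. Taking measurable
representatives and clamping them into range changes nothing almost surely, and the identities for
flows then hold at every outcome. -/
theorem IsEchoModel.exists_isVersion [IsProbabilityMeasure ν] (h : IsEchoModel p ν ε ξ U μ)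
    (hν : ∀ᵐ t ∂ν, 0 ≤ t) : ∃ Y, IsVersion p ν ε ξ U μ Y := by
  classical
  have hmk : ∀ n, 2 ≤ n → ∃ f : Ω → ℝ × ℝ × ℕ, Measurable f ∧
      (fun ω => (ε n ω, ξ n ω, U n ω)) =ᵐ[μ] f := fun n hn =>
    ⟨(h.law n hn).aemeasurable.mk _, (h.law n hn).aemeasurable.measurable_mk,
      (h.law n hn).aemeasurable.ae_eq_mk⟩
  choose! f hf hfe using hmk
  have hYe : ∀ n, 2 ≤ n → (fun ω => (ε n ω, ξ n ω, U n ω)) =ᵐ[μ] fun ω => clampInput n (f n ω) := by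
    intro n hn
    have h1 : ∀ᵐ ω ∂μ, clampInput n (ε n ω, ξ n ω, U n ω) = (ε n ω, ξ n ω, U n ω) := by
      refine ae_of_ae_map (p := fun y => clampInput n y = y) (h.law n hn).aemeasurable ?_
      rw [(h.law n hn).map_eq]
      exact ae_clampInput_eq hν hn
    filter_upwards [h1, hfe n hn] with ω h1 h2
    rw [← h2, h1]
  refine ⟨fun ω n => if 2 ≤ n then clampInput n (f n ω) else 0, ?_, ?_, ?_, ?_, ?_, ?_, ?_⟩
  · refine measurable_pi_iff.2 fun n => ?_
    by_cases hn : 2 ≤ n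
    · simp only [hn, if_true]
      exact (measurable_clampInput n).comp (hf n hn)
    · simp only [hn, if_false]
      exact measurable_const
  · intro ω n hn
    simp only [hn, if_true, clampInput]
    split_ifs <;> simp
  · intro ω n hn
    simp only [hn, if_true, clampInput]
    exact le_max_right _ _
  · intro ω n hn
    simp only [hn, if_true, clampInput]
    split_ifs with h1
    · exact h1
    · exact ⟨le_rfl, by omega⟩
  · intro n hn
    simp only [hn, if_true]
    rw [← (h.law n hn).map_eq]
    exact (Measure.map_congr (hYe n hn)).symm
  · refine h.indep.congr fun n => ?_
    have hn : 2 ≤ (n : ℕ) := n.2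
    simp only [hn, if_true]
    exact hYe n hn
  · refine ae_all_iff.2 fun n => ?_
    by_cases hn : 2 ≤ n
    · filter_upwards [hYe n hn] with ω hω _
      simpa only [hn, if_true] using hω
    · exact ae_of_all _ fun _ h => absurd h hn

/-- The echo `ε ξ` and the parent of every vertex. -/
noncomputable def growthInput (y : ℕ → ℝ × ℝ × ℕ) (n : ℕ) : ℝ × ℕ :=
  ((y n).1 * (y n).2.1, (y n).2.2)

theorem measurable_growthInput : Measurable growthInput :=
  measurable_pi_iff.2 fun n => by
    unfold growthInput
    fun_prop

theorem IsVersion.isGrowth [IsProbabilityMeasure ν] {Y : Ω → ℕ → ℝ × ℝ × ℕ}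
    (h : IsVersion p ν ε ξ U μ Y) :
    IsGrowth (thinnedEchoLaw p ν) (fun ω => growthInput (Y ω)) μ where
  measurable := measurable_growthInput.comp h.measurable
  recursive ω n hn := h.parent ω n hn
  nonneg ω n hn := mul_nonneg (by rcases h.keep ω n hn with h | h <;> simp [h]) (h.nonneg ω n hn)
  law n hn := by
    have := isProbabilityMeasure_uniformOn_Icc hn
    have hm : Measurable fun q : ℝ × ℝ => q.1 * q.2 := by fun_prop
    have h1 : Measurable fun y : ℝ × ℝ × ℕ => (y.1 * y.2.1, y.2.2) := by fun_prop
    have h2 := Measure.map_map (μ := μ) h1 (measurable_pi_iff.1 h.measurable n)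
    have h3 : (fun y : (ℝ × ℝ) × ℕ => (y.1.1 * y.1.2, y.2))
      = (fun y : ℝ × ℝ × ℕ => (y.1 * y.2.1, y.2.2)) ∘ MeasurableEquiv.prodAssoc := rfl
    rw [h.law n hn, ← Measure.prodAssoc_prod, Measure.map_map h1 (MeasurableEquiv.measurable _),
      ← h3] at h2
    refine h2.symm.trans ?_
    have h4 := Measure.map_prod_map ((bernoulliMeasure (1 : ℝ) 0 p).prod ν)
      (uniformOn (Set.Icc 1 (n - 1))) hm measurable_id
    rw [Measure.map_id] at h4
    exact h4.symm
  indep := h.indep.comp (fun _ y => (y.1 * y.2.1, y.2.2)) fun _ => by fun_prop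

end Model

/-! ### The limit weights of the percolation subtrees -/

section Model

variable {Ω : Type*} [MeasurableSpace Ω] {μ : Measure Ω} {p : unitInterval} {ν : Measure ℝ}
  {ε ξ : ℕ → Ω → ℝ} {U : ℕ → Ω → ℕ} {Y : Ω → ℕ → ℝ × ℝ × ℕ}

/-- The indicator that the vertex `r` is the root of a percolation subtree. -/
noncomputable def rootIndicator (r : ℕ) (y : ℕ → ℝ × ℝ × ℕ) : ℝ := if r = 1 then 1 else 1 - (y r).1

theorem measurable_rootIndicator (r : ℕ) : Measurable (rootIndicator r) := by
  unfold rootIndicator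
  split_ifs <;> fun_prop

theorem IsVersion.abs_rootIndicator_le (h : IsVersion p ν ε ξ U μ Y) {r : ℕ} (hr : 1 ≤ r) (ω : Ω) :
    |rootIndicator r (Y ω)| ≤ 1 := by
  unfold rootIndicator
  split_ifs with h1
  · simp
  · rcases h.keep ω r (by omega) with h | h <;> simp [h]

theorem IsVersion.subtreeWeight_eq (h : IsVersion p ν ε ξ U μ Y) :
    ∀ᵐ ω ∂μ, ∀ r n, 1 ≤ r → subtreeWeight (ε · ω) (ξ · ω) (U · ω) r n
      = rootIndicator r (Y ω) * flowSum (growthInput (Y ω)) (Pi.single r 1) r n := by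
  filter_upwards [h.ae_eq] with ω hω r n hr
  have h1 : ∀ n, 2 ≤ n → ε n ω = (Y ω n).1 ∧ ξ n ω = (Y ω n).2.1 ∧ U n ω = (Y ω n).2.2 := by
    intro n hn
    simp [← hω n hn]
  rw [subtreeWeight_congr h1, subtreeWeight_eq_flowSum (h.keep ω) (h.parent ω) hr]
  rfl

theorem IsVersion.treeWeight_eq [IsProbabilityMeasure ν] (h : IsVersion 1 ν ε ξ U μ Y) :
    ∀ᵐ ω ∂μ, ∀ n, treeWeight (ε · ω) (ξ · ω) (U · ω) n
      = flowSum (growthInput (Y ω)) (Pi.single 1 1) 1 n := by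
  have h2 : ∀ᵐ ω ∂μ, ∀ n, 2 ≤ n → (Y ω n).1 = 1 := by
    refine ae_all_iff.2 fun n => ?_
    by_cases hn : 2 ≤ n
    · have := isProbabilityMeasure_uniformOn_Icc hn
      have h3 : ∀ᵐ y ∂(μ.map fun ω => Y ω n), y.1 = 1 := by
        rw [h.law n hn]
        refine Measure.quasiMeasurePreserving_fst.ae (p := fun e : ℝ => e = 1) ?_
        rw [bernoulliMeasure_one, ae_dirac_eq]
        exact rfl
      filter_upwards [ae_of_ae_map (measurable_pi_iff.1 h.measurable n).aemeasurable h3] with ω hω _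
        using hω
    · exact ae_of_all _ fun _ h => absurd h hn
  filter_upwards [h.ae_eq, h2] with ω hω h2 n
  have h1 : ∀ n, 2 ≤ n → ε n ω = (Y ω n).1 ∧ ξ n ω = (Y ω n).2.1 ∧ U n ω = (Y ω n).2.2 := by
    intro n hn
    simp [← hω n hn]
  rw [treeWeight_congr h1, treeWeight_eq_flowSum h2 (h.parent ω)]
  rfl

theorem IsVersion.map_keep [IsProbabilityMeasure ν] (h : IsVersion p ν ε ξ U μ Y) {n : ℕ}
    (hn : 2 ≤ n) : μ.map (fun ω => (Y ω n).1) = bernoulliMeasure (1 : ℝ) 0 p := by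
  have := isProbabilityMeasure_uniformOn_Icc hn
  have h1 := Measure.map_map (μ := μ) measurable_fst (measurable_pi_iff.1 h.measurable n)
  rw [h.law n hn, Measure.map_fst_prod, measure_univ, one_smul] at h1
  exact h1.symm

theorem IsVersion.indepFun_keep_limitMass [IsProbabilityMeasure ν] [IsProbabilityMeasure μ]
    (h : IsVersion p ν ε ξ U μ Y) (hν : ∀ᵐ t ∂ν, 0 ≤ t) (hint : Integrable (fun t : ℝ => t) ν)
    {r : ℕ} (hr : 2 ≤ r) : IndepFun (fun ω => (Y ω r).1) (h.isGrowth.limitMass r r) μ := by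
  have := isProbabilityMeasure_thinnedEchoLaw (p := p) (ν := ν)
  have h1 := indepFun_mask h.measurable h.indep (S := {r}) (T := Set.Ici (r + 1)) (by simpa using hr)
    (Set.Ici_subset_Ici.2 (by omega)) (by simp) 0
  have hg : Measurable fun y : ℕ → ℝ × ℝ × ℕ => (y r).1 := (measurable_pi_apply r).fst
  have h2 := h1.comp hg ((measurable_limitFlow (∫ t, t ∂(thinnedEchoLaw p ν)) r r).comp
    measurable_growthInput)
  refine h2.congr (ae_of_all _ fun ω => by simp [mask]) ?_
  filter_upwards [h.isGrowth.limitMass_ae_eq (ae_thinnedEchoLaw_nonneg hν)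
    (integrable_thinnedEchoLaw hint) (i := r) (r := r) (by omega) le_rfl] with ω hω
  rw [hω]
  refine limitFlow_congr _ _ fun j hj => ?_
  have : mask (Set.Ici (r + 1)) 0 (Y ω) j = Y ω j := if_pos hj
  simp only [growthInput, this]

theorem integral_thinnedEchoLaw_id [IsProbabilityMeasure ν] (hint : Integrable (fun t : ℝ => t) ν) :
    ∫ t, t ∂(thinnedEchoLaw p ν) = p * echoMoment ν 1 := by
  rw [integral_thinnedEchoLaw hint rfl, echoMoment_one]

theorem echoMoment_thinnedEchoLaw [IsProbabilityMeasure ν] {q : ℝ} (hq : 0 < q)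
    (hi : Integrable (fun t : ℝ => t ^ q) ν) :
    echoMoment (thinnedEchoLaw p ν) q = p * echoMoment ν q :=
  integral_thinnedEchoLaw hi (Real.zero_rpow hq.ne')

theorem eq_one_of_ae_thinnedEchoLaw [IsProbabilityMeasure ν] (hp : 0 < p)
    (h : ∀ᵐ t ∂(thinnedEchoLaw p ν), t = 1) : p = 1 ∧ ν {1} = 1 := by
  rw [thinnedEchoLaw_eq, ae_add_measure_iff] at h
  constructor
  · by_contra hp1
    have h1 : unitInterval.toNNReal (unitInterval.symm p) ≠ 0 := by
      intro h1
      have h2 := congrArg NNReal.toReal h1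
      simp only [unitInterval.coe_toNNReal, unitInterval.coe_symm_eq, NNReal.coe_zero] at h2
      exact hp1 (Subtype.ext (sub_eq_zero.1 h2).symm)
    have h2 := (Measure.ae_ennreal_smul_measure_iff (by simpa using h1)).1 h.2
    rw [ae_dirac_eq] at h2
    exact zero_ne_one (α := ℝ) h2
  · have h1 : unitInterval.toNNReal p ≠ 0 := by
      intro h1
      have h2 := congrArg NNReal.toReal h1
      simp only [unitInterval.coe_toNNReal, NNReal.coe_zero] at h2
      exact hp.ne' (Subtype.ext h2)
    have h2 := (Measure.ae_ennreal_smul_measure_iff (by simpa using h1)).1 h.1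
    exact (prob_compl_eq_zero_iff (measurableSet_singleton 1)).1 h2

theorem integral_pos_of_measure_zero_lt_one [IsProbabilityMeasure ν] (hν : ∀ᵐ t ∂ν, 0 ≤ t)
    (hint : Integrable (fun t : ℝ => t) ν) (h0 : ν {0} < 1) : 0 < ∫ t, t ∂ν := by
  refine lt_of_le_of_ne (integral_nonneg_of_ae hν) fun h => h0.ne ?_
  have h1 := (integral_eq_zero_iff_of_nonneg_ae hν hint).1 h.symm
  exact (prob_compl_eq_zero_iff (measurableSet_singleton 0)).1 h1

/-- The limit of the normalized weight of the percolation subtree rooted at `r`. -/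
noncomputable def IsVersion.limitWeight [IsProbabilityMeasure ν] (h : IsVersion p ν ε ξ U μ Y)
    (r : ℕ) (ω : Ω) : ℝ := rootIndicator r (Y ω) * h.isGrowth.limitMass r r ω

theorem IsVersion.integrable_limitWeight [IsProbabilityMeasure ν] [IsProbabilityMeasure μ]
    (h : IsVersion p ν ε ξ U μ Y) (hν : ∀ᵐ t ∂ν, 0 ≤ t) (hint : Integrable (fun t : ℝ => t) ν)
    {r : ℕ} (hr : 1 ≤ r) : Integrable (h.limitWeight r) μ := by
  have := isProbabilityMeasure_thinnedEchoLaw (p := p) (ν := ν)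
  exact (h.isGrowth.integrable_limitMass (ae_thinnedEchoLaw_nonneg hν)
    (integrable_thinnedEchoLaw hint) hr le_rfl).bdd_mul
    ((measurable_rootIndicator r).comp h.measurable).aestronglyMeasurable
    (ae_of_all _ (h.abs_rootIndicator_le hr))

theorem IsVersion.tendsto_subtreeWeight [IsProbabilityMeasure ν] [IsProbabilityMeasure μ]
    (h : IsVersion p ν ε ξ U μ Y) (hν : ∀ᵐ t ∂ν, 0 ≤ t) (hint : Integrable (fun t : ℝ => t) ν)
    {r : ℕ} (hr : 1 ≤ r) :
    ∀ᵐ ω ∂μ, Tendsto (fun n : ℕ => subtreeWeight (ε · ω) (ξ · ω) (U · ω) r n /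
      (n : ℝ) ^ ((p : ℝ) * echoMoment ν 1)) atTop (𝓝 (h.limitWeight r ω)) := by
  have := isProbabilityMeasure_thinnedEchoLaw (p := p) (ν := ν)
  have h1 := h.isGrowth.tendsto_flowSum (ae_thinnedEchoLaw_nonneg hν)
    (integrable_thinnedEchoLaw hint) hr le_rfl
  rw [integral_thinnedEchoLaw_id hint] at h1
  filter_upwards [h1, h.subtreeWeight_eq] with ω h1 h2
  simp only [h2 r _ hr, mul_div_assoc]
  exact h1.const_mul _

theorem IsVersion.identDistrib_limitWeight [IsProbabilityMeasure ν] [IsProbabilityMeasure μ]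
    (h : IsVersion p ν ε ξ U μ Y) (hν : ∀ᵐ t ∂ν, 0 ≤ t) (hint : Integrable (fun t : ℝ => t) ν)
    {Ω' : Type*} [MeasurableSpace Ω'] {μ' : Measure Ω'} [IsProbabilityMeasure μ']
    {X' : Ω' → ℕ → ℝ × ℕ} (h' : IsGrowth (thinnedEchoLaw p ν) X' μ') {r : ℕ} (hr : 2 ≤ r) :
    IdentDistrib (h.limitWeight r)
      (fun q : ℝ × ℝ × ℝ => (1 - q.1) * q.2.1 * q.2.2 ^ ((p : ℝ) * echoMoment ν 1)) μ
      ((bernoulliMeasure (1 : ℝ) 0 p).prod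
        ((μ'.map (h'.limitMass 1 1)).prod (betaMeasure 1 ((r : ℝ) - 1)))) := by
  have := isProbabilityMeasure_thinnedEchoLaw (p := p) (ν := ν)
  have hν' := ae_thinnedEchoLaw_nonneg (p := p) hν
  have hint' := integrable_thinnedEchoLaw (p := p) hint
  have hb : (0 : ℝ) < (r : ℝ) - 1 := by
    have : (2 : ℝ) ≤ r := by exact_mod_cast hr
    linarith
  have := isProbabilityMeasureBeta one_pos hb
  have := Measure.isProbabilityMeasure_map
    (h'.integrable_limitMass hν' hint' le_rfl le_rfl).aemeasurable
  have h1 := h.isGrowth.identDistrib_limitMass h' hν' hint' (i := r) (r := r) (by omega) le_rfl hr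
  rw [integral_thinnedEchoLaw_id hint] at h1
  set s := (p : ℝ) * echoMoment ν 1
  set R := (μ'.map (h'.limitMass 1 1)).prod (betaMeasure 1 ((r : ℝ) - 1))
  have hg : Measurable fun q : ℝ × ℝ => q.1 * q.2 ^ s := by fun_prop
  have hF : Measurable fun q : ℝ × ℝ => (1 - q.1) * q.2 := by fun_prop
  have hK : Measurable fun ω => (Y ω r).1 := (measurable_pi_iff.1 h.measurable r).fst
  have h2 := (indepFun_iff_map_prod_eq_prod_map_map hK.aemeasurable h1.aemeasurable_fst).1
    (h.indepFun_keep_limitMass hν hint hr)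
  have hpair : AEMeasurable (fun ω => ((Y ω r).1, h.isGrowth.limitMass r r ω)) μ :=
    hK.aemeasurable.prodMk h1.aemeasurable_fst
  have h3 : h.limitWeight r = (fun q : ℝ × ℝ => (1 - q.1) * q.2) ∘
      fun ω => ((Y ω r).1, h.isGrowth.limitMass r r ω) := by
    funext ω
    simp only [IsVersion.limitWeight, rootIndicator, if_neg (show r ≠ 1 by omega), Function.comp]
  have h4 : (fun q : ℝ × ℝ × ℝ => (1 - q.1) * q.2.1 * q.2.2 ^ s)
      = (fun q : ℝ × ℝ => (1 - q.1) * q.2) ∘ Prod.map id fun q : ℝ × ℝ => q.1 * q.2 ^ s := by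
    funext q
    simp only [Function.comp, Prod.map, id]
    ring
  have hm4 : Measurable (Prod.map (id : ℝ → ℝ) fun q : ℝ × ℝ => q.1 * q.2 ^ s) :=
    measurable_id.prodMap hg
  refine ⟨h3 ▸ hF.comp_aemeasurable hpair, (h4 ▸ hF.comp hm4).aemeasurable, ?_⟩
  rw [h3, h4, ← AEMeasurable.map_map_of_aemeasurable hF.aemeasurable hpair, ← Measure.map_map hF hm4,
    h2, h.map_keep hr, h1.map_eq, ← Measure.map_prod_map _ _ measurable_id hg, Measure.map_id]

theorem IsVersion.integral_limitWeight [IsProbabilityMeasure ν] [IsProbabilityMeasure μ]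
    (h : IsVersion p ν ε ξ U μ Y) (hν : ∀ᵐ t ∂ν, 0 ≤ t) (hint : Integrable (fun t : ℝ => t) ν)
    {q : ℝ} (hq : 1 < q) (hi : Integrable (fun t : ℝ => t ^ q) (thinnedEchoLaw p ν))
    (hlt : echoMoment (thinnedEchoLaw p ν) q < q * ∫ t, t ∂(thinnedEchoLaw p ν))
    {r : ℕ} (hr : 1 ≤ r) :
    ∫ ω, h.limitWeight r ω ∂μ = (1 - (p : ℝ) * (if 1 < r then 1 else 0)) *
      ((r - 1).factorial : ℝ) / Real.Gamma ((r : ℝ) + (p : ℝ) * echoMoment ν 1) := by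
  have := isProbabilityMeasure_thinnedEchoLaw (p := p) (ν := ν)
  have hν' := ae_thinnedEchoLaw_nonneg (p := p) hν
  have hint' := integrable_thinnedEchoLaw (p := p) hint
  have h1 := h.isGrowth.integral_limitMass hν' hint' hq hi hlt hr le_rfl
  rw [integral_thinnedEchoLaw_id hint, gammaRatio, inv_div] at h1
  have h2 : Real.Gamma r = (r - 1).factorial := by
    rw [← Real.Gamma_nat_eq_factorial, Nat.cast_sub hr]
    simp
  rw [h2] at h1
  have h3 : ∫ ω, h.limitWeight r ω ∂μ
      = (1 - (p : ℝ) * (if 1 < r then 1 else 0)) * ∫ ω, h.isGrowth.limitMass r r ω ∂μ := by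
    rcases hr.eq_or_lt with rfl | hr
    · simp [IsVersion.limitWeight, rootIndicator]
    · have hK : Measurable fun ω => (Y ω r).1 := (measurable_pi_iff.1 h.measurable r).fst
      have h4 : ∫ ω, (1 - (Y ω r).1) ∂μ = 1 - (p : ℝ) := by
        have hf : Measurable fun e : ℝ => 1 - e := by fun_prop
        have h5 := integral_map (μ := μ) hK.aemeasurable (f := fun e : ℝ => 1 - e)
          hf.aestronglyMeasurable
        rw [h.map_keep hr, integral_bernoulliMeasure] at h5
        rw [← h5]
        simp
      have h6 := ((h.indepFun_keep_limitMass hν hint hr).comp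
        (by fun_prop : Measurable fun e : ℝ => 1 - e) measurable_id).integral_fun_mul_eq_mul_integral
        (hK.const_sub 1).aestronglyMeasurable
        (h.isGrowth.integrable_limitMass hν' hint' (i := r) (r := r) (by omega) le_rfl).1
      rw [if_pos hr, mul_one, ← h4]
      refine Eq.trans ?_ h6
      simp only [IsVersion.limitWeight, rootIndicator, if_neg (show r ≠ 1 by omega)]
      rfl
  rw [h3, h1, mul_div_assoc]

/-- For `r = 1` a constant limit would make `ε ξ` equal to `1`, hence `p = 1` and `ξ = 1`. For `r ≥
2` the limit vanishes with probability at least `p > 0`, yet its mean is positive because `p < 1`.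
-/
theorem IsVersion.not_limitWeight_const [IsProbabilityMeasure ν] [IsProbabilityMeasure μ]
    (h : IsVersion p ν ε ξ U μ Y) (hp : 0 < p) (hν : ∀ᵐ t ∂ν, 0 ≤ t)
    (hint : Integrable (fun t : ℝ => t) ν) (hm : 0 < ∫ t, t ∂ν)
    {q : ℝ} (hq : 1 < q) (hi : Integrable (fun t : ℝ => t ^ q) (thinnedEchoLaw p ν))
    (hlt : echoMoment (thinnedEchoLaw p ν) q < q * ∫ t, t ∂(thinnedEchoLaw p ν))
    {r : ℕ} (hr : 1 ≤ r) (hpr : p < 1 ∨ (r = 1 ∧ ν {1} < 1)) :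
    ¬ ∃ c : ℝ, h.limitWeight r =ᵐ[μ] fun _ => c := by
  have := isProbabilityMeasure_thinnedEchoLaw (p := p) (ν := ν)
  have hν' := ae_thinnedEchoLaw_nonneg (p := p) hν
  have hint' := integrable_thinnedEchoLaw (p := p) hint
  have hp0 : (0 : ℝ) < p := hp
  have hm' : 0 < (p : ℝ) * echoMoment ν 1 := by rw [echoMoment_one]; positivity
  rintro ⟨c, hc⟩
  rcases hr.eq_or_lt with rfl | hr
  · have h1 : h.isGrowth.limitMass 1 1 =ᵐ[μ] fun _ => c := by
      filter_upwards [hc] with ω hω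
      simpa [IsVersion.limitWeight, rootIndicator] using hω
    have h2 := eq_one_of_ae_thinnedEchoLaw hp (h.isGrowth.ae_eq_one_of_limitMass_const hν' hint'
      (by rwa [integral_thinnedEchoLaw_id hint]) hq hi hlt h1)
    rcases hpr with h3 | h3
    · exact h3.ne h2.1
    · exact h3.2.ne h2.2
  · have hp1 : (p : ℝ) < 1 := by
      rcases hpr with h3 | h3
      · exact h3
      · omega
    have hc0 : c = 0 := by
      by_contra hc0
      have h1 : ∀ᵐ ω ∂μ, (Y ω r).1 ≠ 1 := by
        filter_upwards [hc] with ω hω h1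
        simp only [IsVersion.limitWeight, rootIndicator, if_neg (show r ≠ 1 by omega), h1, sub_self,
          zero_mul] at hω
        exact hc0 hω.symm
      have hK : Measurable fun ω => (Y ω r).1 := (measurable_pi_iff.1 h.measurable r).fst
      have h2 := (ae_map_iff hK.aemeasurable (p := fun e : ℝ => e ≠ 1)
        (measurableSet_singleton 1).compl).2 h1
      rw [h.map_keep hr, ae_iff] at h2
      simp only [ne_eq, not_not, Set.ofPred_eq_eq_singleton] at h2
      rw [bernoulliMeasure_apply_of_mem_of_notMem p (measurableSet_singleton 1) (by simp)
        (by simp)] at h2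
      have h3 := congrArg NNReal.toReal (ENNReal.coe_eq_zero.1 h2)
      simp only [unitInterval.coe_toNNReal, NNReal.coe_zero] at h3
      exact hp0.ne' h3
    have h1 := h.integral_limitWeight hν hint hq hi hlt hr.le
    rw [integral_congr_ae hc, hc0, if_pos hr] at h1
    simp only [integral_zero, mul_one] at h1
    have h2 : 0 < Real.Gamma ((r : ℝ) + (p : ℝ) * echoMoment ν 1) :=
      Real.Gamma_pos_of_pos (by positivity)
    have h3 : (0 : ℝ) < (r - 1).factorial := by exact_mod_cast Nat.factorial_pos _
    have h4 : 0 < (1 - (p : ℝ)) * ((r - 1).factorial : ℝ) /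
        Real.Gamma ((r : ℝ) + (p : ℝ) * echoMoment ν 1) :=
      div_pos (mul_pos (by linarith) h3) h2
    exact h4.ne h1

end Model

/-! ### The main theorem -/

theorem mainTheorem7 {Ω : Type*} [MeasurableSpace Ω] (μ : Measure Ω) [IsProbabilityMeasure μ]
    (p : unitInterval) (hp : 0 < p)
    (ν : Measure ℝ) [IsProbabilityMeasure ν]
    (hν_nonneg : ∀ᵐ x ∂ν, 0 ≤ x) (hν_zero : ν {0} < 1)
    (hν_mom : ∃ α : ℝ, 1 < α ∧ MemLp (fun x : ℝ => x) (ENNReal.ofReal α) ν)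
    (ε ξ : ℕ → Ω → ℝ) (U : ℕ → Ω → ℕ) (hmodel : IsEchoModel p ν ε ξ U μ) :
    ∃ L : ℕ → Ω → ℝ,
      -- almost sure convergence to integrable limits
      (∀ r : ℕ, 1 ≤ r → Integrable (L r) μ ∧
        ∀ᵐ ω ∂μ, Tendsto
          (fun n : ℕ => subtreeWeight (ε · ω) (ξ · ω) (U · ω) r n /
            (n : ℝ) ^ ((p : ℝ) * echoMoment ν 1))
          atTop (𝓝 (L r ω))) ∧
      -- laws of the limits, through the limit `Z` of the pure echoing walk (memory parameter `1`)
      -- whose echo variables have the law of `ε ξ`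
      (∀ {Ω' : Type*} [MeasurableSpace Ω'] (μ' : Measure Ω') [IsProbabilityMeasure μ']
        (ε' ξ' : ℕ → Ω' → ℝ) (U' : ℕ → Ω' → ℕ),
        IsEchoModel 1 (thinnedEchoLaw p ν) ε' ξ' U' μ' →
        ∃ Z : Ω' → ℝ, Integrable Z μ' ∧
          (∀ᵐ ω ∂μ', Tendsto
            (fun n : ℕ => treeWeight (ε' · ω) (ξ' · ω) (U' · ω) n /
              (n : ℝ) ^ echoMoment (thinnedEchoLaw p ν) 1)
            atTop (𝓝 (Z ω))) ∧
          IdentDistrib (L 1) Z μ μ' ∧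
          ∀ r : ℕ, 2 ≤ r →
            IdentDistrib (L r)
              (fun q : ℝ × ℝ × ℝ => (1 - q.1) * q.2.1 * q.2.2 ^ ((p : ℝ) * echoMoment ν 1)) μ
              ((bernoulliMeasure (1 : ℝ) 0 p).prod
                ((μ'.map Z).prod (betaMeasure 1 ((r : ℝ) - 1))))) ∧
      -- the case `𝔼[ξ log ξ] < 𝔼 ξ`
      (∫ x, x * Real.log x ∂ν < echoMoment ν 1 →
        (∀ r : ℕ, 1 ≤ r → ∀ γ : ℝ, 1 < γ → Integrable (fun x : ℝ => x ^ γ) ν →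
          echoMoment ν γ < γ * echoMoment ν 1 →
          (∀ n : ℕ, MemLp (fun ω => subtreeWeight (ε · ω) (ξ · ω) (U · ω) r n)
            (ENNReal.ofReal γ) μ) ∧
          MemLp (L r) (ENNReal.ofReal γ) μ ∧
          Tendsto
            (fun n : ℕ => eLpNorm
              (fun ω => subtreeWeight (ε · ω) (ξ · ω) (U · ω) r n /
                (n : ℝ) ^ ((p : ℝ) * echoMoment ν 1) - L r ω)
              (ENNReal.ofReal γ) μ)
            atTop (𝓝 0)) ∧
        (∀ r : ℕ, 1 ≤ r → (p < 1 ∨ (r = 1 ∧ ν {1} < 1)) →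
          ¬ ∃ c : ℝ, L r =ᵐ[μ] fun _ => c) ∧
        (∀ r : ℕ, 1 ≤ r →
          ∫ ω, L r ω ∂μ = (1 - (p : ℝ) * (if 1 < r then 1 else 0)) *
            ((r - 1).factorial : ℝ) / Real.Gamma ((r : ℝ) + (p : ℝ) * echoMoment ν 1))) ∧
      -- the case `𝔼[ξ log ξ] ≥ 𝔼 ξ`
      (echoMoment ν 1 ≤ ∫ x, x * Real.log x ∂ν →
        ∀ r : ℕ, 1 ≤ r → ∀ᵐ ω ∂μ, L r ω = 0) := by
  have := isProbabilityMeasure_thinnedEchoLaw (p := p) (ν := ν)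
  obtain ⟨α, hα, hmem⟩ := hν_mom
  have hiα : Integrable (fun t : ℝ => t ^ α) ν := by
    have h1 := hmem.integrable_norm_rpow'
    rw [ENNReal.toReal_ofReal (by linarith)] at h1
    exact h1.congr (hν_nonneg.mono fun t ht => by simp [abs_of_nonneg ht])
  have hint : Integrable (fun t : ℝ => t) ν := by
    simpa using integrable_rpow_of_le hν_nonneg zero_le_one hα.le hiα
  have hν' := ae_thinnedEchoLaw_nonneg (p := p) hν_nonneg
  have hint' := integrable_thinnedEchoLaw (p := p) hint
  have hm := integral_pos_of_measure_zero_lt_one hν_nonneg hint hν_zero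
  have hm' := integral_thinnedEchoLaw_id (p := p) hint
  have hp0 : (0 : ℝ) < p := hp
  have hlog := integral_thinnedEchoLaw (p := p) (integrable_mul_log hν_nonneg hα hiα) (by simp)
  obtain ⟨Y, hY⟩ := hmodel.exists_isVersion hν_nonneg
  refine ⟨hY.limitWeight, fun r hr => ⟨hY.integrable_limitWeight hν_nonneg hint hr,
    hY.tendsto_subtreeWeight hν_nonneg hint hr⟩, ?_, fun hsub => ?_, fun hsup r hr => ?_⟩
  · intro Ω' _ μ' _ ε' ξ' U' hmodel'
    obtain ⟨Y', hY'⟩ := hmodel'.exists_isVersion hν'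
    -- With percolation parameter `1` nothing is thinned a second time, so the echo law remains that
    -- of `ε ξ`.
    have hG : IsGrowth (thinnedEchoLaw p ν) (fun ω => growthInput (Y' ω)) μ' := by
      have h1 := hY'.isGrowth
      rwa [thinnedEchoLaw_one] at h1
    refine ⟨hG.limitMass 1 1, hG.integrable_limitMass hν' hint' le_rfl le_rfl, ?_, ?_,
      fun r hr => hY.identDistrib_limitWeight hν_nonneg hint hG hr⟩
    · filter_upwards [hY'.treeWeight_eq, hG.tendsto_flowSum hν' hint' le_rfl le_rfl] with ω h1 h2
      simp only [h1, echoMoment_one]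
      exact h2
    · have h1 : hY.limitWeight 1 = hY.isGrowth.limitMass 1 1 := by
        funext ω
        simp [IsVersion.limitWeight, rootIndicator]
      rw [h1]
      exact hY.isGrowth.identDistrib_limitMass_one hG hν' hint'
  -- The mean and the non-degeneracy need only one admissible exponent, found just above `1`; the
  -- given `γ` is used afterwards for the convergence in `L^γ`.
  · obtain ⟨q, hq, hqi, hqlt⟩ : ∃ q : ℝ, 1 < q ∧ Integrable (fun t : ℝ => t ^ q) (thinnedEchoLaw p ν) ∧
        echoMoment (thinnedEchoLaw p ν) q < q * ∫ t, t ∂(thinnedEchoLaw p ν) := by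
      refine exists_echoMoment_lt hν' hα (integrable_thinnedEchoLaw hiα) ?_
      rw [hlog, hm']
      exact mul_lt_mul_of_pos_left hsub hp0
    refine ⟨fun r hr γ hγ hγi hγlt => ?_, fun r hr hpr => hY.not_limitWeight_const hp hν_nonneg hint hm
      hq hqi hqlt hr hpr, fun r hr => hY.integral_limitWeight hν_nonneg hint hq hqi hqlt hr⟩
    have hγi' := integrable_thinnedEchoLaw (p := p) hγi
    have hγlt' : echoMoment (thinnedEchoLaw p ν) γ < γ * ∫ t, t ∂(thinnedEchoLaw p ν) := by
      rw [echoMoment_thinnedEchoLaw (by linarith) hγi, hm', mul_left_comm]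
      exact mul_lt_mul_of_pos_left hγlt hp0
    have hroot : AEStronglyMeasurable (fun ω => rootIndicator r (Y ω)) μ :=
      ((measurable_rootIndicator r).comp hY.measurable).aestronglyMeasurable
    have hmul : ∀ f : Ω → ℝ, MemLp f (ENNReal.ofReal γ) μ →
        MemLp (fun ω => rootIndicator r (Y ω) * f ω) (ENNReal.ofReal γ) μ := fun f hf =>
      hf.of_le (hroot.mul hf.1) (ae_of_all _ fun ω => by
        rw [norm_mul]
        exact mul_le_of_le_one_left (norm_nonneg _) (hY.abs_rootIndicator_le hr ω))
    refine ⟨fun n => ?_, hmul _ (hY.isGrowth.memLp_limitMass_and_tendsto hν' hint' hγ hγi' hγlt' hr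
      le_rfl).1, ?_⟩
    · refine (hmul _ (hY.isGrowth.memLp_flowSum hν' hint' hγ hγi' hr le_rfl n)).ae_eq ?_
      filter_upwards [hY.subtreeWeight_eq] with ω hω using (hω r n hr).symm
    · have h1 := hY.isGrowth.tendsto_eLpNorm_flowSum hν' hint' hγ hγi' hγlt' hr le_rfl
      rw [hm'] at h1
      -- The same root indicator, at most `1` in absolute value, multiplies both the subtree weight
      -- and its limit, so it can only decrease the distance.
      refine tendsto_of_tendsto_of_tendsto_of_le_of_le tendsto_const_nhds h1 (fun _ => zero_le)
        fun n => eLpNorm_mono_ae ?_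
      filter_upwards [hY.subtreeWeight_eq] with ω hω
      rw [hω r n hr, IsVersion.limitWeight, mul_div_assoc, ← mul_sub, norm_mul]
      exact mul_le_of_le_one_left (norm_nonneg _) (hY.abs_rootIndicator_le hr ω)
  · have hle : ∫ t, t ∂(thinnedEchoLaw p ν) ≤ ∫ x, x * Real.log x ∂(thinnedEchoLaw p ν) := by
      rw [hlog, hm']
      exact mul_le_mul_of_nonneg_left hsup hp0.le
    filter_upwards [hY.isGrowth.limitMass_eq_zero hν' hα (integrable_thinnedEchoLaw hiα)
      (by rw [hm', echoMoment_one]; positivity) hle hr le_rfl] with ω hω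
    rw [IsVersion.limitWeight, hω, mul_zero]
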